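/- Let $P\subset\mathbb{R}^2$ be a finite nonempty set of points and let $\delta$ be the minimal distance between two points of $P$ ($\delta=0$ if $|P|=1$). For a closed square $S\supseteq Q$ with centre $o$ and a set $Q\subseteq P$, let $\mathrm{Tree}(S,Q)$ be the following rooted tree with root $o$. If $\operatorname{diam}(S)\le\delta/8$, then $o$ is joined to the at most one point of $Q$, which is a leaf. Otherwise $S$ is partitioned into four equal closed squares $S_1,\dots,S_4$, the points of $Q\setminus\{o\}$ are distributed into disjoint sets $Q_i\subseteq S_i$ (a point that lies in several $S_i$ is assigned to any one of them), and $o$ is joined to the roots of the trees $\mathrm{Tree}(S_i,Q_i)$; if $o\in Q$, this input point is also attached to $o$, as a leaf at distance $0$. The points of $P$ are thus the leaves that count as input points, and all centres of squares are Steiner vertices. The *compressed version* of such a tree is obtained by removing all subtrees without input points and contracting every path of Steiner vertices (including the root) that have a single child. Let $S_R$ be a smallest axis-aligned square containing $P$, and let $S_B$ be the square with the same centre obtained from $S_R$ by a rotation by $\pi/4$ and scaling up by the factor $\sqrt2$. The two-tree Steiner cover of $P$ consists of the red tree $\mathrm{Tree}(S_R,P)$ and the blue tree $\mathrm{Tree}(S_B,P)$.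 **Claim.** There is one algorithm that, given the coordinates of the $n=|P|\ge 1$ points of any such $P$ in an arbitrary order, computes the compressed versions of both trees (for some admissible choice of $S_R$ and of the assignments of boundary points) in $O(n\log n)$ time (at most $C(n\log n+1)$ steps with an absolute constant $C$, so that $n=1$ is covered). In each of the two trees no vertex has exactly one child, and each has at most $2n-1$ vertices (Steiner vertices and input points together). The machine model is the one customary for compressed quadtrees: a real RAM with unit-cost comparisons, indirect addressing, $+,-,\times,/$, floor, integral powers of two, and the operation that returns the index of the first binary digit after the point in which two numbers of $[0,1)$ differ. The trees are output as linked records in memory (coordinates, first child, next sibling). -/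

import Mathlib

namespace SteinerCover

/-! ### Squares in the Euclidean plane -/

/-- The Euclidean plane. -/
abbrev Plane := EuclideanSpace ℝ (Fin 2)

/-- Counter-clockwise rotation of a vector by the angle `θ`. -/
noncomputable def rot (θ : ℝ) (w : Plane) : Plane :=
  !₂[Real.cos θ * w 0 - Real.sin θ * w 1, Real.sin θ * w 0 + Real.cos θ * w 1]

/-- The vector `w` turned by a right angle. -/
noncomputable def perp (w : Plane) : Plane := !₂[-(w 1), w 0]

/-- A square of arbitrary orientation, given by its centre and by the vector `arm` that leads from
the centre to the midpoint of one side (half a side vector). -/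
structure Square where
  center : Plane
  arm : Plane

namespace Square

/-- The points of the (closed) square. -/
def carrier (S : Square) : Set Plane :=
  {p | ∃ a b : ℝ, |a| ≤ 1 ∧ |b| ≤ 1 ∧ p = S.center + a • S.arm + b • perp S.arm}

/-- The diameter of the square, that is the length of its diagonal (the side is `2 * ‖arm‖`). -/
noncomputable def diam (S : Square) : ℝ := 2 * √2 * ‖S.arm‖

/-- The axis-aligned square with centre `c` and side length `2 * h`. -/
noncomputable def axis (c : Plane) (h : ℝ) : Square := ⟨c, !₂[h, 0]⟩

/-- The square with the same centre, rotated by `π / 4` and scaled up by the factor `√2`. -/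
noncomputable def blue (S : Square) : Square := ⟨S.center, √2 • rot (Real.pi / 4) S.arm⟩

/-- The four equal squares into which a square is partitioned. -/
noncomputable def quarter (S : Square) : Fin 4 → Square :=
  ![⟨S.center + (1 / 2 : ℝ) • (S.arm + perp S.arm), (1 / 2 : ℝ) • S.arm⟩,
    ⟨S.center + (1 / 2 : ℝ) • (S.arm - perp S.arm), (1 / 2 : ℝ) • S.arm⟩,
    ⟨S.center + (1 / 2 : ℝ) • (-S.arm + perp S.arm), (1 / 2 : ℝ) • S.arm⟩,
    ⟨S.center + (1 / 2 : ℝ) • (-S.arm - perp S.arm), (1 / 2 : ℝ) • S.arm⟩]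

end Square

/-- `axis c h` is a smallest axis-aligned square that contains `P`. -/
def IsSmallestAxisSquare (P : Set Plane) (c : Plane) (h : ℝ) : Prop :=
  0 ≤ h ∧ P ⊆ (Square.axis c h).carrier ∧
    ∀ (c' : Plane) (h' : ℝ), 0 ≤ h' → P ⊆ (Square.axis c' h').carrier → h ≤ h'

/-! ### Rooted geometric trees -/

/-- Rooted trees drawn in the plane: a `leaf` is an input point, a `node` is a Steiner vertex
placed at a point of the plane, with the list of the subtrees rooted at its children. -/
inductive GTree where
  | leaf (p : Plane) : GTree
  | node (o : Plane) (children : List GTree) : GTree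

mutual
/-- The number of vertices of a tree. -/
def GTree.numVertices : GTree → ℕ
  | .leaf _ => 1
  | .node _ cs => 1 + GTree.numVerticesAll cs
/-- The number of vertices of a list of trees. -/
def GTree.numVerticesAll : List GTree → ℕ
  | [] => 0
  | t :: ts => GTree.numVertices t + GTree.numVerticesAll ts
end

mutual
/-- No vertex of the tree has exactly one child. -/
def GTree.NoSingleChild : GTree → Prop
  | .leaf _ => True
  | .node _ cs => cs.length ≠ 1 ∧ GTree.NoSingleChildAll cs
/-- No vertex of any tree of the list has exactly one child. -/
def GTree.NoSingleChildAll : List GTree → Prop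
  | [] => True
  | t :: ts => GTree.NoSingleChild t ∧ GTree.NoSingleChildAll ts
end

/-- A Steiner vertex at `o` over the given list of compressed subtrees: it vanishes if there is no
subtree, it is contracted if there is only one, and it is kept if there are at least two. -/
def GTree.contract (o : Plane) : List GTree → Option GTree
  | [] => none
  | [t] => some t
  | t₁ :: t₂ :: ts => some (.node o (t₁ :: t₂ :: ts))

mutual
/-- The compressed version of a tree: subtrees without input points are removed and every path of
Steiner vertices with a single child is contracted (`none` if there is no input point at all). -/
def GTree.compress : GTree → Option GTree
  | .leaf p => some (.leaf p)
  | .node o cs => GTree.contract o (GTree.compressAll cs)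
/-- The compressed versions of the trees of a list that contain input points. -/
def GTree.compressAll : List GTree → List GTree
  | [] => []
  | t :: ts => (GTree.compress t).toList ++ GTree.compressAll ts
end

/-! ### The recursive construction of a tree from a square -/

open Classical in
/-- The leaf for an input point that coincides with the centre `o` of the current square. -/
noncomputable def centreLeaf (o : Plane) (P : Set Plane) : List GTree :=
  if o ∈ P then [GTree.leaf o] else []

/-- `IsQuadtree δ S P T`: the tree `T`, rooted at the centre of `S`, is a possible result of the
recursive procedure for the square `S` and the points `P`. If `diam S ≤ δ / 8`, the centre is joined
to the point of `P`, if there is one. Otherwise the centre is joined to the roots of the trees of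
the four quarter squares. A point of `P` on the boundary of several quarters is
assigned to any one of them; a point of `P` at the centre of `S` is assigned to none of them and
becomes a leaf at the centre. The order of the children is immaterial. -/
inductive IsQuadtree (δ : ℝ) : Square → Set Plane → GTree → Prop
  | base_empty (S : Square) (hS : S.diam ≤ δ / 8) :
      IsQuadtree δ S ∅ (.node S.center [])
  | base_single (S : Square) (p : Plane) (hS : S.diam ≤ δ / 8) :
      IsQuadtree δ S {p} (.node S.center [.leaf p])
  | step (S : Square) (P : Set Plane) (Q : Fin 4 → Set Plane) (T : Fin 4 → GTree)
      (cs : List GTree) (hS : δ / 8 < S.diam)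
      (hdisj : Pairwise fun i j => Disjoint (Q i) (Q j))
      (hunion : ⋃ i, Q i = P \ {S.center})
      (hmem : ∀ i, Q i ⊆ (S.quarter i).carrier)
      (hrec : ∀ i, IsQuadtree δ (S.quarter i) (Q i) (T i))
      (hcs : cs.Perm (centreLeaf S.center P ++ List.ofFn T)) :
      IsQuadtree δ S P (.node S.center cs)

/-- `T` is a compressed version of the tree that the construction yields for the root square `S` and
the point set `P`; the parameter `δ` of the construction is the minimal distance between two
points of `P` (and `0` if `P` has only one point). -/
def IsCompressedQuadtree (S : Square) (P : Set Plane) (T : GTree) : Prop :=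
  ∃ U : GTree, IsQuadtree P.infsep S P U ∧ U.compress = some T

/-! ### A real random access machine with step count -/

/-- `bitDiff a b` is the index of the first digit after the binary point in which the binary
expansions of `a, b ∈ [0, 1)` differ (and `0` if `a = b`). -/
noncomputable def bitDiff (a b : ℝ) : ℕ := sInf {k : ℕ | ⌊(2 : ℝ) ^ k * a⌋ ≠ ⌊(2 : ℝ) ^ k * b⌋}

/-- A state of the machine: registers and a random access memory, both holding real numbers. -/
structure State where
  reg : ℕ → ℝ
  mem : ℕ → ℝ

/-- Arithmetic expressions: rational constants, registers, memory cells at a computed address, the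
four arithmetic operations, the floor function, integral powers of two, and `bitDiff`. -/
inductive Expr where
  | const (q : ℚ)
  | reg (i : ℕ)
  | load (a : Expr)
  | add (a b : Expr)
  | sub (a b : Expr)
  | mul (a b : Expr)
  | div (a b : Expr)
  | floor (a : Expr)
  | pow2 (a : Expr)
  | bitDiff (a b : Expr)

namespace Expr

/-- The value of an expression. -/
noncomputable def eval (s : State) : Expr → ℝ
  | const q => (q : ℝ)
  | reg i => s.reg i
  | load a => s.mem ⌊a.eval s⌋₊
  | add a b => a.eval s + b.eval s
  | sub a b => a.eval s - b.eval s
  | mul a b => a.eval s * b.eval s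
  | div a b => a.eval s / b.eval s
  | floor a => (⌊a.eval s⌋ : ℝ)
  | pow2 a => (2 : ℝ) ^ ⌊a.eval s⌋
  | bitDiff a b => (SteinerCover.bitDiff (a.eval s) (b.eval s) : ℝ)

/-- The number of steps for the evaluation of an expression: one for each operation. -/
def cost : Expr → ℕ
  | const _ => 1
  | reg _ => 1
  | load a => a.cost + 1
  | add a b => a.cost + b.cost + 1
  | sub a b => a.cost + b.cost + 1
  | mul a b => a.cost + b.cost + 1
  | div a b => a.cost + b.cost + 1
  | floor a => a.cost + 1
  | pow2 a => a.cost + 1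
  | bitDiff a b => a.cost + b.cost + 1

end Expr

/-- Tests: comparisons of expressions and their Boolean combinations. -/
inductive Test where
  | le (a b : Expr)
  | not (t : Test)
  | and (t u : Test)

namespace Test

/-- The truth value of a test. -/
def Holds (s : State) : Test → Prop
  | le a b => a.eval s ≤ b.eval s
  | not t => ¬ t.Holds s
  | and t u => t.Holds s ∧ u.Holds s

/-- The number of steps for a test. -/
def cost : Test → ℕ
  | le a b => a.cost + b.cost + 1
  | not t => t.cost + 1
  | and t u => t.cost + u.cost + 1

end Test

/-- Programs of the machine. -/
inductive Program where
  | skip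
  | assign (i : ℕ) (e : Expr)
  | store (a e : Expr)
  | seq (c d : Program)
  | ite (t : Test) (c d : Program)
  | loop (t : Test) (c : Program)

/-- `Exec c s s' k`: the program `c`, started in the state `s`, halts in the state `s'` after exactly
`k` steps. Here `assign i e` writes the value of `e` into register `i`, `store a e` writes it into
the memory cell whose address is the value of `a`, and `loop t c` repeats `c` while `t` holds. -/
inductive Exec : Program → State → State → ℕ → Prop
  | skip (s : State) : Exec .skip s s 1
  | assign (s : State) (i : ℕ) (e : Expr) :
      Exec (.assign i e) s ⟨Function.update s.reg i (e.eval s), s.mem⟩ (e.cost + 1)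
  | store (s : State) (a e : Expr) :
      Exec (.store a e) s ⟨s.reg, Function.update s.mem ⌊a.eval s⌋₊ (e.eval s)⟩
        (a.cost + e.cost + 1)
  | seq {c d : Program} {s s' s'' : State} {k l : ℕ}
      (hc : Exec c s s' k) (hd : Exec d s' s'' l) : Exec (.seq c d) s s'' (k + l)
  | ite_true {t : Test} {c d : Program} {s s' : State} {k : ℕ}
      (ht : t.Holds s) (hc : Exec c s s' k) : Exec (.ite t c d) s s' (t.cost + 1 + k)
  | ite_false {t : Test} {c d : Program} {s s' : State} {k : ℕ}
      (ht : ¬ t.Holds s) (hd : Exec d s s' k) : Exec (.ite t c d) s s' (t.cost + 1 + k)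
  | loop_true {t : Test} {c : Program} {s s' s'' : State} {k l : ℕ}
      (ht : t.Holds s) (hc : Exec c s s' k) (hl : Exec (.loop t c) s' s'' l) :
      Exec (.loop t c) s s'' (t.cost + 1 + k + l)
  | loop_false {t : Test} {c : Program} {s : State}
      (ht : ¬ t.Holds s) : Exec (.loop t c) s s (t.cost + 1)

/-- The initial state for the input points `p 0, …, p (n - 1)`: register `0` holds `n`, the memory
cells `2 * i` and `2 * i + 1` hold the coordinates of `p i`, everything else is `0`. -/
noncomputable def inputState {n : ℕ} (p : Fin n → Plane) : State where
  reg := fun i => if i = 0 then (n : ℝ) else 0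
  mem := fun a => if h : a / 2 < n then (if a % 2 = 0 then p ⟨a / 2, h⟩ 0 else p ⟨a / 2, h⟩ 1) else 0

/-- `Encodes mem r ts`: the pointer `r` refers to a linked representation of the list `ts` of trees
in the memory `mem`. The pointer is `-1` for the empty list. Otherwise it is the address of a record
of four cells for the root of the first tree: its two coordinates, a pointer to the list
of the subtrees of its children, and a pointer to the rest of the list. -/
inductive Encodes (mem : ℕ → ℝ) : ℝ → List GTree → Prop
  | nil : Encodes mem (-1) []
  | leaf (a : ℕ) (p : Plane) (ts : List GTree)
      (hx : mem a = p 0) (hy : mem (a + 1) = p 1)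
      (hc : mem (a + 2) = -1) (hs : Encodes mem (mem (a + 3)) ts) :
      Encodes mem (a : ℝ) (.leaf p :: ts)
  | node (a : ℕ) (o : Plane) (cs ts : List GTree)
      (hx : mem a = o 0) (hy : mem (a + 1) = o 1)
      (hc : Encodes mem (mem (a + 2)) cs) (hs : Encodes mem (mem (a + 3)) ts) :
      Encodes mem (a : ℝ) (.node o cs :: ts)

end SteinerCover

open SteinerCover

namespace SteinerCover

/-! ### Execution of programs -/

-- Relative to the root square the points have coordinates in [0,1]², and the squares of level k of
-- the recursion are the dyadic cells of side 2^-k. The function `cell` fixes the assignment of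
-- boundary points: they go to the upper cell, except that the coordinate 1 belongs to the last one.
-- A point at the centre of a square leaves the recursion there.
--
-- The points are sorted in Z-order. The level at which two coordinates part is found with one
-- `bitDiff` (`sep`, `exists_sep_eq`), so a comparison takes constant time and merge sort O(n log
-- n). In the sorted list each square of the recursion holds a contiguous block, cut into
-- consecutive pieces by the quarters and the centre (`Square.ZLt.rank_le_rank`). The gap of two
-- neighbours is the side of the quarters of the smallest square of the recursion in which they are
-- still together. Besides the separating sides it depends on whether the first point is a centre,
-- which a second use of `bitDiff`, on x and x - σ, detects (`bitDiff_sub_spec`, `centreSide_spec`).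
--
-- The key fact is that the compressed tree is determined by the gaps: it is the Cartesian tree of
-- the sequence of gaps, where equal maxima of a block form one vertex (`Dendro`). Consider a square
-- and its block. If all gaps are smaller than the side of the quarters, all points lie in the same
-- part and the vertex is contracted. Otherwise the maximal gap is this side, and splitting at the
-- maximal gaps gives exactly the nonempty parts (`Square.exists_pieces`). Induction down to the
-- diameter δ/8 yields `Square.exists_isQuadtree`; the number δ itself never has to be computed.
--
-- The Cartesian tree is built from right to left with a stack of unfinished vertices (`Pending`).
-- Each point pushes at most one vertex and each vertex is completed once, so this takes linear
-- time; a potential in the loop rule `runs_loop` does the accounting. The blue tree comes from the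
-- same program after a change of one register of the frame. Since each inner vertex has at least
-- two children, n leaves allow at most 2n - 1 vertices.

infixr:60 " ;; " => Program.seq

instance : Add Expr := ⟨Expr.add⟩
instance : Sub Expr := ⟨Expr.sub⟩
instance : Mul Expr := ⟨Expr.mul⟩
instance : Div Expr := ⟨Expr.div⟩

namespace Expr

variable (s : State) (a b : Expr)

@[simp] theorem eval_add : (a + b).eval s = a.eval s + b.eval s := rfl
@[simp] theorem eval_sub : (a - b).eval s = a.eval s - b.eval s := rfl
@[simp] theorem eval_mul : (a * b).eval s = a.eval s * b.eval s := rfl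
@[simp] theorem eval_div : (a / b).eval s = a.eval s / b.eval s := rfl

end Expr

namespace Test

/-- The disjunction of two tests. -/
def or (t u : Test) : Test := .not (.and (.not t) (.not u))

/-- The test for equality. -/
def eq (a b : Expr) : Test := .and (.le a b) (.le b a)

/-- The test for strict inequality. -/
def lt (a b : Expr) : Test := .not (.le b a)

@[simp] theorem holds_le (s : State) (a b : Expr) : (le a b).Holds s ↔ a.eval s ≤ b.eval s := Iff.rfl

@[simp] theorem holds_not (s : State) (t : Test) : t.not.Holds s ↔ ¬ t.Holds s := Iff.rfl

@[simp] theorem holds_and (s : State) (t u : Test) :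
    (t.and u).Holds s ↔ t.Holds s ∧ u.Holds s := Iff.rfl

@[simp] theorem holds_or (s : State) (t u : Test) : (t.or u).Holds s ↔ t.Holds s ∨ u.Holds s := by
  simp only [or, holds_not, holds_and]; tauto

@[simp] theorem holds_eq (s : State) (a b : Expr) : (eq a b).Holds s ↔ a.eval s = b.eval s := by
  simp only [eq, holds_and, holds_le]; exact ⟨fun h => le_antisymm h.1 h.2, fun h => ⟨h.le, h.ge⟩⟩

@[simp] theorem holds_lt (s : State) (a b : Expr) : (lt a b).Holds s ↔ a.eval s < b.eval s := by
  simp only [lt, holds_not, holds_le, not_le]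

end Test

namespace Program

/-- The program contains no loop. -/
def loopFree : Program → Bool
  | skip => true
  | assign _ _ => true
  | store _ _ => true
  | seq c d => c.loopFree && d.loopFree
  | ite _ c d => c.loopFree && d.loopFree
  | loop _ _ => false

/-- An upper bound for the number of steps of a loop-free program. -/
def size : Program → ℕ
  | skip => 1
  | assign _ e => e.cost + 1
  | store a e => a.cost + e.cost + 1
  | seq c d => c.size + d.size
  | ite t c d => t.cost + 1 + (c.size + d.size)
  | loop _ _ => 1

open Classical in
/-- The final state of a loop-free program. -/
noncomputable def denote : Program → State → State
  | skip, s => s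
  | assign i e, s => ⟨Function.update s.reg i (e.eval s), s.mem⟩
  | store a e, s => ⟨s.reg, Function.update s.mem ⌊a.eval s⌋₊ (e.eval s)⟩
  | seq c d, s => d.denote (c.denote s)
  | ite t c d, s => if t.Holds s then c.denote s else d.denote s
  | loop _ _, s => s

section
variable (s : State) (c d : Program)

@[simp] theorem denote_skip : skip.denote s = s := rfl
@[simp] theorem denote_assign (i : ℕ) (e : Expr) :
    (assign i e).denote s = ⟨Function.update s.reg i (e.eval s), s.mem⟩ := rfl
@[simp] theorem denote_store (a e : Expr) :
    (store a e).denote s = ⟨s.reg, Function.update s.mem ⌊a.eval s⌋₊ (e.eval s)⟩ := rfl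
@[simp] theorem denote_seq : (c ;; d).denote s = d.denote (c.denote s) := rfl
open Classical in
@[simp] theorem denote_ite (t : Test) :
    (ite t c d).denote s = if t.Holds s then c.denote s else d.denote s := rfl

end

end Program

/-- The program `c` leads from `s` to `s'` in at most `T` steps. -/
def Runs (c : Program) (s s' : State) (T : ℕ) : Prop := ∃ k ≤ T, Exec c s s' k

theorem Runs.mono {c : Program} {s s' : State} {T T' : ℕ} (h : Runs c s s' T) (hT : T ≤ T') :
    Runs c s s' T' := by
  obtain ⟨k, hk, h⟩ := h
  exact ⟨k, hk.trans hT, h⟩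

theorem Runs.seq {c d : Program} {s s' s'' : State} {T T' : ℕ} (h : Runs c s s' T)
    (h' : Runs d s' s'' T') : Runs (c ;; d) s s'' (T + T') := by
  obtain ⟨k, hk, h⟩ := h
  obtain ⟨l, hl, h'⟩ := h'
  exact ⟨k + l, by omega, .seq h h'⟩

/-- Only one branch of a conditional is executed, while `size` adds both, so the bound does not
depend on the state: a loop-free block costs an absolute constant. -/
theorem runs_denote (c : Program) (hc : c.loopFree = true) (s : State) :
    Runs c s (c.denote s) c.size := by
  induction c generalizing s with
  | skip => exact ⟨1, le_rfl, .skip s⟩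
  | assign i e => exact ⟨_, le_rfl, .assign s i e⟩
  | store a e => exact ⟨_, le_rfl, .store s a e⟩
  | seq c d ihc ihd =>
    simp only [Program.loopFree, Bool.and_eq_true] at hc
    exact (ihc hc.1 s).seq (ihd hc.2 _)
  | ite t c d ihc ihd =>
    simp only [Program.loopFree, Bool.and_eq_true] at hc
    by_cases ht : t.Holds s
    · obtain ⟨k, hk, h⟩ := ihc hc.1 s
      refine ⟨t.cost + 1 + k, by simp only [Program.size]; omega, ?_⟩
      simp only [Program.denote, if_pos ht]
      exact .ite_true ht h
    · obtain ⟨k, hk, h⟩ := ihd hc.2 s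
      refine ⟨t.cost + 1 + k, by simp only [Program.size]; omega, ?_⟩
      simp only [Program.denote, if_neg ht]
      exact .ite_false ht h
  | loop t c => simp [Program.loopFree] at hc

/-- The loop rule: `I` is an invariant, with a potential that pays for the steps. -/
theorem runs_loop {t : Test} {c : Program} (I : State → ℕ → Prop)
    (hstep : ∀ s φ, I s φ → t.Holds s →
      ∃ s' φ' k, Runs c s s' k ∧ I s' φ' ∧ t.cost + 1 + k + φ' ≤ φ)
    (s : State) (φ : ℕ) (h : I s φ) :
    ∃ s' φ' k, Runs (.loop t c) s s' k ∧ I s' φ' ∧ ¬ t.Holds s' ∧ k + φ' ≤ φ + t.cost + 1 := by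
  -- The test alone costs at least one step, so the potential drops strictly in each round. One
  -- inequality thus gives both termination and the bound.
  induction φ using Nat.strong_induction_on generalizing s with
  | _ φ ih =>
  by_cases ht : t.Holds s
  · obtain ⟨s', φ', k, ⟨k', hk', hr⟩, hI, hle⟩ := hstep s φ h ht
    obtain ⟨s'', φ'', l, ⟨l', hl', hr'⟩, hI', hn, hle'⟩ := ih φ' (by omega) s' hI
    exact ⟨s'', φ'', t.cost + 1 + k' + l', ⟨_, le_rfl, .loop_true ht hr hr'⟩, hI', hn, by omega⟩
  · exact ⟨s, φ, t.cost + 1, ⟨_, le_rfl, .loop_false ht⟩, h, ht, by omega⟩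

/-! ### Dyadic cells of the unit interval -/

/-- The index of the dyadic cell of side `(1 / 2) ^ k` that is used for `x ∈ [0, 1]`. -/
noncomputable def cell (k : ℕ) (x : ℝ) : ℤ := min ⌊(2 : ℝ) ^ k * x⌋ (2 ^ k - 1)

/-- Halving commutes with the floor, and the truncation is compatible because half of 2^(k+1) - 1
rounds down to 2^k - 1. So the cells stay nested even at the coordinate 1. -/
theorem cell_eq_div (k : ℕ) (x : ℝ) : cell k x = cell (k + 1) x / 2 := by
  have h : ⌊(2 : ℝ) ^ k * x⌋ = ⌊(2 : ℝ) ^ (k + 1) * x⌋ / 2 := by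
    have := Int.floor_div_natCast ((2 : ℝ) ^ (k + 1) * x) 2
    rw [← Nat.cast_two (R := ℤ), ← this]
    congr 1
    push_cast
    ring
  simp only [cell, h, pow_succ]
  omega

theorem cell_eq_of_le {k l : ℕ} (h : k ≤ l) {x y : ℝ} (hxy : cell l x = cell l y) :
    cell k x = cell k y := by
  induction l, h using Nat.le_induction with
  | base => exact hxy
  | succ l _ ih => exact ih (by rw [cell_eq_div l x, cell_eq_div l y, hxy])

theorem cell_mono (k : ℕ) {x y : ℝ} (h : x ≤ y) : cell k x ≤ cell k y := by
  unfold cell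
  gcongr

theorem cell_zero {x : ℝ} (h : 0 ≤ x) : cell 0 x = 0 := by
  have : 0 ≤ ⌊x⌋ := Int.floor_nonneg.2 h
  simp [cell, this]

theorem cell_le (k : ℕ) (x : ℝ) : (cell k x : ℝ) ≤ 2 ^ k * x :=
  (Int.cast_le.2 (min_le_left _ _)).trans (Int.floor_le _)

/-- For x ≤ 1 the truncation acts only at x = 1, the right end of the last cell. Together with
`cell_le` this puts each point into the closed cell assigned to it. -/
theorem le_cell_add_one (k : ℕ) {x : ℝ} (h : x ≤ 1) : 2 ^ k * x ≤ (cell k x : ℝ) + 1 := by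
  unfold cell
  rcases min_choice ⌊(2 : ℝ) ^ k * x⌋ (2 ^ k - 1) with h' | h' <;> rw [h']
  · exact (Int.lt_floor_add_one _).le
  · push_cast
    have : (2 : ℝ) ^ k * x ≤ 2 ^ k * 1 := by gcongr
    linarith

theorem cell_of_lt_one (k : ℕ) {x : ℝ} (h : x < 1) : cell k x = ⌊(2 : ℝ) ^ k * x⌋ := by
  have : ⌊(2 : ℝ) ^ k * x⌋ < 2 ^ k := by
    rw [Int.floor_lt]
    push_cast
    have : (2 : ℝ) ^ k * x < 2 ^ k * 1 := by gcongr
    linarith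
  simp only [cell]
  omega

theorem cell_one (k : ℕ) : cell k 1 = 2 ^ k - 1 := by
  have : ⌊(2 : ℝ) ^ k * 1⌋ = 2 ^ k := by
    rw [Int.floor_eq_iff]; simp
  rw [cell, this]
  omega

theorem two_pow_mul_half_pow (k : ℕ) : (2 : ℝ) ^ k * (1 / 2) ^ k = 1 := by
  rw [← mul_pow]; norm_num

theorem half_pow_lt_iff {k l : ℕ} : (1 / 2 : ℝ) ^ k < (1 / 2) ^ l ↔ l < k :=
  pow_lt_pow_iff_right_of_lt_one₀ (by norm_num) (by norm_num)

theorem half_pow_le_iff {k l : ℕ} : (1 / 2 : ℝ) ^ k ≤ (1 / 2) ^ l ↔ l ≤ k :=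
  pow_le_pow_iff_right_of_lt_one₀ (by norm_num) (by norm_num)

theorem half_pow_inj {k l : ℕ} : (1 / 2 : ℝ) ^ k = (1 / 2) ^ l ↔ k = l := by
  constructor
  · intro h
    exact le_antisymm (half_pow_le_iff.1 h.ge) (half_pow_le_iff.1 h.le)
  · rintro rfl; rfl

theorem two_zpow_neg_natCast (k : ℕ) : (2 : ℝ) ^ ⌊(0 : ℝ) - (k : ℝ)⌋ = (1 / 2) ^ k := by
  have : ⌊(0 : ℝ) - (k : ℝ)⌋ = -(k : ℤ) := by
    rw [Int.floor_eq_iff]; push_cast; constructor <;> linarith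
  rw [this, zpow_neg, zpow_natCast, one_div, inv_pow]

theorem exists_one_lt_two_pow_mul {t : ℝ} (h : 0 < t) : ∃ k : ℕ, 1 < 2 ^ k * t := by
  obtain ⟨k, hk⟩ := exists_pow_lt_of_lt_one h (by norm_num : (1 / 2 : ℝ) < 1)
  refine ⟨k, ?_⟩
  have := two_pow_mul_half_pow k
  have : (2 : ℝ) ^ k * (1 / 2) ^ k < 2 ^ k * t := by gcongr
  linarith

/-- Cells shorter than the distance of two points separate them. -/
theorem exists_cell_ne {x y : ℝ} (hx : x ≤ 1) (hy : y ≤ 1) (h : x ≠ y) :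
    ∃ k, cell k x ≠ cell k y := by
  wlog hxy : x < y generalizing x y
  · obtain ⟨k, hk⟩ := this hy hx h.symm (lt_of_le_of_ne (not_lt.1 hxy) h.symm)
    exact ⟨k, hk.symm⟩
  obtain ⟨k, hk⟩ := exists_one_lt_two_pow_mul (sub_pos.2 hxy)
  refine ⟨k, fun he => ?_⟩
  have h1 := cell_le k x
  have h2 := le_cell_add_one k hy
  rw [he] at h1
  linarith

-- Separating sides computed from binary digits

/-- The side of the largest dyadic cells that separate `x` and `y` (`0` if `x = y`). -/
noncomputable def sep (x y : ℝ) : ℝ :=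
  if x = y then 0
  else if 1 ≤ x ∨ 1 ≤ y then
    if 2 - x - y ≤ (2 : ℝ) ^ ⌊0 - (bitDiff 0 (2 - x - y) : ℝ)⌋ then
      (2 : ℝ) ^ ⌊0 - (bitDiff 0 (2 - x - y) : ℝ)⌋ / 2
    else (2 : ℝ) ^ ⌊0 - (bitDiff 0 (2 - x - y) : ℝ)⌋
  else (2 : ℝ) ^ ⌊0 - (bitDiff x y : ℝ)⌋

theorem bitDiff_comm (x y : ℝ) : bitDiff x y = bitDiff y x := by
  simp only [bitDiff, ne_comm]

theorem sep_comm (x y : ℝ) : sep x y = sep y x := by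
  simp only [sep, bitDiff_comm x y, or_comm (a := 1 ≤ x), eq_comm (a := x),
    show 2 - x - y = 2 - y - x by ring]

theorem bitDiff_spec {a b : ℝ} (h : ∃ k : ℕ, ⌊(2 : ℝ) ^ k * a⌋ ≠ ⌊(2 : ℝ) ^ k * b⌋) :
    ⌊(2 : ℝ) ^ bitDiff a b * a⌋ ≠ ⌊(2 : ℝ) ^ bitDiff a b * b⌋ ∧
      ∀ k < bitDiff a b, ⌊(2 : ℝ) ^ k * a⌋ = ⌊(2 : ℝ) ^ k * b⌋ :=
  ⟨Nat.sInf_mem h, fun _ hk => not_not.1 (Nat.notMem_of_lt_sInf hk)⟩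

/-- Below 1 the cells are plain floors, and `bitDiff` is the first level where these differ. If one
coordinate is 1 and the other has distance t from it, the truncated cells differ at level k exactly
if 1 < 2^k t. The comparison of the digits of 0 and t tests 1 ≤ 2^k t instead; the two conditions
disagree only if t is a power of two, which explains the correction by one level in `sep`. -/
theorem exists_sep_eq {x y : ℝ} (hx0 : 0 ≤ x) (hx : x ≤ 1) (hy0 : 0 ≤ y) (hy : y ≤ 1) (h : x ≠ y) :
    ∃ m : ℕ, sep x y = (1 / 2) ^ (m + 1) ∧ ∀ k, cell k x = cell k y ↔ k ≤ m := by
  wlog hxy : x < y generalizing x y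
  · obtain ⟨m, hm, hm'⟩ := this hy0 hy hx0 hx h.symm (lt_of_le_of_ne (not_lt.1 hxy) h.symm)
    exact ⟨m, by rw [sep_comm, hm], fun k => by rw [eq_comm, hm']⟩
  have key : ∀ j : ℕ, cell j x ≠ cell j y → (∀ k < j, cell k x = cell k y) →
      ∃ m : ℕ, j = m + 1 ∧ ∀ k, cell k x = cell k y ↔ k ≤ m := by
    intro j hj hlt
    have hj0 : j ≠ 0 := by
      rintro rfl
      exact hj (by rw [cell_zero hx0, cell_zero hy0])
    obtain ⟨m, rfl⟩ := Nat.exists_eq_succ_of_ne_zero hj0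
    refine ⟨m, rfl, fun k => ⟨fun hk => ?_, fun hk => hlt k (by omega)⟩⟩
    by_contra hk'
    exact hj (cell_eq_of_le (by omega) hk)
  have hx1 : x < 1 := by linarith
  rw [sep, if_neg h]
  rcases lt_or_ge y 1 with hy1 | hy1
  · rw [if_neg (by push Not; exact ⟨hx1, hy1⟩), two_zpow_neg_natCast]
    obtain ⟨k, hk⟩ := exists_cell_ne hx hy h
    obtain ⟨h1, h2⟩ := bitDiff_spec (a := x) (b := y)
      ⟨k, by rwa [cell_of_lt_one k hx1, cell_of_lt_one k hy1] at hk⟩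
    simp only [← cell_of_lt_one _ hx1, ← cell_of_lt_one _ hy1] at h1 h2
    obtain ⟨m, hm, hm'⟩ := key _ h1 h2
    exact ⟨m, by rw [hm], hm'⟩
  · obtain rfl : y = 1 := le_antisymm hy hy1
    rw [if_pos (Or.inr le_rfl), two_zpow_neg_natCast, show 2 - x - 1 = 1 - x by ring]
    have ht : 0 < 1 - x := by linarith
    have hne : ∀ k, cell k x ≠ cell k 1 ↔ 1 < (2 : ℝ) ^ k * (1 - x) := by
      intro k
      rw [cell_one, cell_of_lt_one k hx1]
      have h1 : ⌊(2 : ℝ) ^ k * x⌋ ≤ 2 ^ k - 1 := by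
        rw [← cell_of_lt_one k hx1]; exact min_le_right _ _
      have h2 : ⌊(2 : ℝ) ^ k * x⌋ < 2 ^ k - 1 ↔ 1 < (2 : ℝ) ^ k * (1 - x) := by
        rw [Int.floor_lt]
        push_cast
        constructor <;> intro h <;> linarith
      rw [← h2]
      exact ⟨fun h => lt_of_le_of_ne h1 h, fun h => h.ne⟩
    have hfl : ∀ k, ⌊(2 : ℝ) ^ k * 0⌋ ≠ ⌊(2 : ℝ) ^ k * (1 - x)⌋ ↔ 1 ≤ (2 : ℝ) ^ k * (1 - x) := by
      intro k
      have h0 : 0 ≤ ⌊(2 : ℝ) ^ k * (1 - x)⌋ := Int.floor_nonneg.2 (by positivity)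
      have h1 : 1 ≤ ⌊(2 : ℝ) ^ k * (1 - x)⌋ ↔ 1 ≤ (2 : ℝ) ^ k * (1 - x) := by
        rw [Int.le_floor, Int.cast_one]
      rw [mul_zero, Int.floor_zero, ← h1]
      omega
    obtain ⟨k, hk⟩ := exists_one_lt_two_pow_mul ht
    obtain ⟨h1, h2⟩ := bitDiff_spec (a := 0) (b := 1 - x) ⟨k, (hfl k).2 hk.le⟩
    rw [hfl] at h1
    have h2' : ∀ k < bitDiff 0 (1 - x), (2 : ℝ) ^ k * (1 - x) < 1 := fun k hk =>
      not_le.1 fun h => (hfl k).2 h (h2 k hk)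
    have hp := two_pow_mul_half_pow (bitDiff 0 (1 - x))
    have hpos : (0 : ℝ) < 2 ^ bitDiff 0 (1 - x) := by positivity
    generalize bitDiff 0 (1 - x) = j at *
    split_ifs with h3
    -- Here the distance 1 - x is exactly (1/2)^j: at level j both points are still in the last
    -- cell, and the next level separates them.
    · have h4 : (2 : ℝ) ^ j * (1 - x) ≤ 1 := (mul_le_mul_of_nonneg_left h3 hpos.le).trans hp.le
      obtain ⟨m, hm, hm'⟩ := key (j + 1) ((hne _).2 (by rw [pow_succ]; nlinarith))
        (fun k hk => not_not.1 fun h => by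
          have h5 := (hne k).1 h
          rcases (Nat.lt_succ_iff.1 hk).lt_or_eq with h6 | rfl
          · linarith [h2' k h6]
          · linarith)
      exact ⟨m, by rw [← hm, pow_succ]; ring, hm'⟩
    · have h4 : 1 < (2 : ℝ) ^ j * (1 - x) :=
        hp.symm.trans_lt (mul_lt_mul_of_pos_left (not_le.1 h3) hpos)
      obtain ⟨m, hm, hm'⟩ := key j ((hne _).2 h4)
        (fun k hk => not_not.1 fun h => by linarith [(hne k).1 h, h2' k hk])
      exact ⟨m, by rw [hm], hm'⟩

theorem sep_self (x : ℝ) : sep x x = 0 := if_pos rfl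

theorem sep_lt_iff {x y : ℝ} (hx0 : 0 ≤ x) (hx : x ≤ 1) (hy0 : 0 ≤ y) (hy : y ≤ 1) (k : ℕ) :
    sep x y < (1 / 2) ^ k ↔ cell k x = cell k y := by
  by_cases h : x = y
  · subst h
    simp [sep_self]
  · obtain ⟨m, hm, hm'⟩ := exists_sep_eq hx0 hx hy0 hy h
    rw [hm, hm', half_pow_lt_iff]
    omega

/-! ### Centres of dyadic cells -/

/-- `x` is the midpoint of a dyadic interval of length `(1 / 2) ^ k`. -/
def IsMidpoint (k : ℕ) (x : ℝ) : Prop := ∃ m : ℤ, (2 : ℝ) ^ (k + 1) * x = 2 * m + 1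

/-- Subtracting one unit of the last place changes the digits from the lowest nonzero one on. At a
level k ≤ m the floors differ exactly if 2^k x is an integer, so the first difference is at the
first level where x is an endpoint of cells. For a midpoint of level k this is level k + 1. -/
theorem bitDiff_sub_spec {m : ℕ} {x : ℝ} (hx : x / (1 / 2) ^ m = ⌊x / (1 / 2) ^ m⌋) :
    bitDiff x (x - (1 / 2) ^ m) ≤ m ∧
      ∀ k, IsMidpoint k x ↔ bitDiff x (x - (1 / 2) ^ m) = k + 1 := by
  have hp := two_pow_mul_half_pow m
  obtain ⟨i, hi⟩ : ∃ i : ℤ, (2 : ℝ) ^ m * x = i := by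
    refine ⟨⌊x / (1 / 2) ^ m⌋, ?_⟩
    rw [← hx, one_div, inv_pow, div_inv_eq_mul, mul_comm]
  have hint : ∀ k ≤ m, (⌊(2 : ℝ) ^ k * x⌋ ≠ ⌊(2 : ℝ) ^ k * (x - (1 / 2) ^ m)⌋ ↔
      ∃ z : ℤ, (2 : ℝ) ^ k * x = z) := by
    intro k hk
    obtain ⟨l, rfl⟩ := Nat.exists_eq_add_of_le hk
    have h2 : (2 : ℝ) ^ k * (1 / 2) ^ (k + l) = (1 / 2) ^ l := by
      rw [pow_add, ← mul_assoc, two_pow_mul_half_pow, one_mul]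
    have hl := two_pow_mul_half_pow l
    have hl0 : (0 : ℝ) < 2 ^ l := by positivity
    have hh0 : (0 : ℝ) < (1 / 2) ^ l := by positivity
    constructor
    · intro h
      by_contra hz
      apply h
      rw [mul_sub, h2]
      symm
      rw [Int.floor_eq_iff]
      have h3 := Int.floor_le ((2 : ℝ) ^ k * x)
      have h4 := Int.lt_floor_add_one ((2 : ℝ) ^ k * x)
      refine ⟨?_, by linarith⟩
      -- Because 2^(k+l) x is an integer, a number 2^k x that is not an integer exceeds its floor by
      -- at least (1/2)^l. Subtracting (1/2)^l therefore does not change the floor.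
      have h5 : (⌊(2 : ℝ) ^ k * x⌋ : ℝ) < (2 : ℝ) ^ k * x :=
        lt_of_le_of_ne h3 fun h => hz ⟨_, h.symm⟩
      have h6 : (2 : ℝ) ^ l * ⌊(2 : ℝ) ^ k * x⌋ < i := by
        rw [← hi, pow_add]
        nlinarith
      have h7 : (2 : ℝ) ^ l * ⌊(2 : ℝ) ^ k * x⌋ + 1 ≤ i := by exact_mod_cast h6
      have h8 : (2 : ℝ) ^ l * ⌊(2 : ℝ) ^ k * x⌋ ≤ 2 ^ l * ((2 : ℝ) ^ k * x - (1 / 2) ^ l) := by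
        rw [mul_sub, hl, ← mul_assoc, ← pow_add, add_comm l k, hi]
        linarith
      exact le_of_mul_le_mul_left h8 hl0
    · rintro ⟨z, hz⟩
      rw [mul_sub, h2, hz, Int.floor_intCast]
      refine ne_of_gt ?_
      rw [Int.floor_lt]
      linarith
  obtain ⟨h1, h2⟩ := bitDiff_spec (a := x) (b := x - (1 / 2) ^ m)
    ⟨m, (hint m le_rfl).2 ⟨i, hi⟩⟩
  have hle : bitDiff x (x - (1 / 2) ^ m) ≤ m := by
    by_contra h
    exact (hint m le_rfl).2 ⟨i, hi⟩ (h2 m (by omega))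
  rw [hint _ hle] at h1
  refine ⟨hle, fun k => ⟨?_, ?_⟩⟩
  · rintro ⟨z, hz⟩
    obtain ⟨a, ha⟩ := h1
    generalize bitDiff x (x - (1 / 2) ^ m) = j at *
    rcases lt_trichotomy j (k + 1) with h | h | h
    · exfalso
      obtain ⟨l, hl⟩ := Nat.exists_eq_add_of_lt h
      have : (2 : ℝ) ^ (k + 1) * x = 2 * (2 ^ l * a) := by
        rw [hl, ← ha]; ring
      rw [hz] at this
      have : 2 * z + 1 = 2 * (2 ^ l * a) := by exact_mod_cast this
      omega
    · exact h
    · exfalso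
      exact (hint (k + 1) (by omega)).2 ⟨2 * z + 1, by rw [hz]; push_cast; ring⟩ (h2 _ h)
  · intro h
    rw [h] at h1 h2 hle
    obtain ⟨a, ha⟩ := h1
    rcases Int.even_or_odd' a with ⟨b, rfl | rfl⟩
    · exfalso
      refine (hint k (by omega)).2 ⟨b, ?_⟩ (h2 k (by omega))
      rw [pow_succ] at ha
      push_cast at ha
      linarith
    · exact ⟨b, by rw [ha]; push_cast; ring⟩

/-- Ensures that the divisibility tests in `centreSide` do not reject a genuine centre. -/
theorem IsMidpoint.dvd {k m : ℕ} {x : ℝ} (h : IsMidpoint k x) (hk : k < m) :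
    x / (1 / 2) ^ m = ⌊x / (1 / 2) ^ m⌋ := by
  obtain ⟨z, hz⟩ := h
  obtain ⟨l, rfl⟩ := Nat.exists_eq_add_of_lt hk
  have : x / (1 / 2) ^ (k + l + 1) = ((2 ^ l * (2 * z + 1) : ℤ) : ℝ) := by
    push_cast
    rw [← hz, one_div, inv_pow, div_inv_eq_mul]
    ring
  rw [this, Int.floor_intCast]

/-- The side of the quarters of the largest dyadic square with the centre `(x, y)`, if both
coordinates are multiples of `σ` and if there is such a square; otherwise `σ`. -/
noncomputable def centreSide (σ x y : ℝ) : ℝ :=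
  if x / σ = ⌊x / σ⌋ ∧ y / σ = ⌊y / σ⌋ ∧
      (2 : ℝ) ^ ⌊0 - (bitDiff x (x - σ) : ℝ)⌋ = (2 : ℝ) ^ ⌊0 - (bitDiff y (y - σ) : ℝ)⌋ ∧
      (2 : ℝ) ^ ⌊0 - (bitDiff x (x - σ) : ℝ)⌋ ≤ 1 / 2 then
    (2 : ℝ) ^ ⌊0 - (bitDiff x (x - σ) : ℝ)⌋
  else σ

/-- The index found by `bitDiff` determines the level of a midpoint, so a point is a centre in at
most one level. The number l is this level if it exists and is at most m, and it is m otherwise. -/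
theorem centreSide_spec (m : ℕ) (x y : ℝ) :
    ∃ l : ℕ, centreSide ((1 / 2) ^ (m + 1)) x y = (1 / 2) ^ (l + 1) ∧
      ∀ k, k ≤ l ↔ k ≤ m ∧ ∀ k' < k, ¬ (IsMidpoint k' x ∧ IsMidpoint k' y) := by
  unfold centreSide
  simp only [two_zpow_neg_natCast]
  split_ifs with h
  · obtain ⟨hx, hy, hxy, hle⟩ := h
    obtain ⟨h1, h2⟩ := bitDiff_sub_spec hx
    obtain ⟨h3, h4⟩ := bitDiff_sub_spec hy
    rw [half_pow_inj] at hxy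
    simp only [h2, h4, ← hxy]
    generalize bitDiff x (x - (1 / 2) ^ (m + 1)) = j at *
    -- The bound 1/2 in the test excludes the index 0, which belongs to the coordinates 0 and 1;
    -- they are never midpoints. For x = 0 the number x - σ is negative, but the definition of
    -- `bitDiff` still yields 0.
    have hj : 1 ≤ j := half_pow_le_iff.1 (by simpa using hle)
    obtain ⟨l, rfl⟩ := Nat.exists_eq_add_of_le' hj
    refine ⟨l, rfl, fun k => ⟨fun hk => ⟨by omega, fun k' hk' => by omega⟩, ?_⟩⟩
    rintro ⟨h5, h6⟩
    by_contra h7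
    exact h6 l (by omega) (by omega)
  · refine ⟨m, rfl, fun k => ⟨fun hk => ⟨hk, fun k' hk' hm => h ?_⟩, fun h => h.1⟩⟩
    have hx := hm.1.dvd (m := m + 1) (by omega)
    have hy := hm.2.dvd (m := m + 1) (by omega)
    have h1 := ((bitDiff_sub_spec hx).2 k').1 hm.1
    have h2 := ((bitDiff_sub_spec hy).2 k').1 hm.2
    refine ⟨hx, hy, by rw [h1, h2], ?_⟩
    rw [h1, ← pow_one (1 / 2 : ℝ), ← pow_mul, one_mul, half_pow_le_iff]
    omega

/-! ### Coordinates relative to a square -/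

namespace Square

variable (S : Square)

/-- The first coordinate relative to the square, normalized to `[0, 1]`. -/
noncomputable def coordX (p : Plane) : ℝ :=
  ((p 0 - S.center 0) * S.arm 0 + (p 1 - S.center 1) * S.arm 1) /
    (2 * (S.arm 0 * S.arm 0 + S.arm 1 * S.arm 1)) + 1 / 2

/-- The second coordinate relative to the square, normalized to `[0, 1]`. -/
noncomputable def coordY (p : Plane) : ℝ :=
  ((p 1 - S.center 1) * S.arm 0 - (p 0 - S.center 0) * S.arm 1) /
    (2 * (S.arm 0 * S.arm 0 + S.arm 1 * S.arm 1)) + 1 / 2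

/-- The point `center + a • arm + b • perp arm`. -/
noncomputable def point (a b : ℝ) : Plane :=
  !₂[S.center 0 + a * S.arm 0 - b * S.arm 1, S.center 1 + a * S.arm 1 + b * S.arm 0]

/-- The normalized coordinates of the point belong to the unit square. -/
def InUnit (p : Plane) : Prop :=
  0 ≤ S.coordX p ∧ S.coordX p ≤ 1 ∧ 0 ≤ S.coordY p ∧ S.coordY p ≤ 1

theorem point_eq (a b : ℝ) : S.point a b = S.center + a • S.arm + b • perp S.arm := by
  ext i
  fin_cases i <;> simp [point, perp]
  ring

theorem norm_arm_sq : ‖S.arm‖ ^ 2 = S.arm 0 * S.arm 0 + S.arm 1 * S.arm 1 := by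
  rw [EuclideanSpace.norm_sq_eq]
  simp [pow_two]

variable {S}

theorem normSq_pos (hS : S.arm ≠ 0) : 0 < S.arm 0 * S.arm 0 + S.arm 1 * S.arm 1 := by
  rw [← norm_arm_sq]
  have := norm_pos_iff.2 hS
  positivity

theorem coordX_point (hS : S.arm ≠ 0) (a b : ℝ) : S.coordX (S.point a b) = (a + 1) / 2 := by
  have hN : S.arm 0 ^ 2 + S.arm 1 ^ 2 ≠ 0 := by
    simpa only [pow_two] using (normSq_pos hS).ne'
  simp only [coordX, point]
  simp only [Matrix.cons_val_zero, Matrix.cons_val_one]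
  field_simp
  ring

theorem coordY_point (hS : S.arm ≠ 0) (a b : ℝ) : S.coordY (S.point a b) = (b + 1) / 2 := by
  have hN : S.arm 0 ^ 2 + S.arm 1 ^ 2 ≠ 0 := by
    simpa only [pow_two] using (normSq_pos hS).ne'
  simp only [coordY, point]
  simp only [Matrix.cons_val_zero, Matrix.cons_val_one]
  field_simp
  ring

theorem point_coord (hS : S.arm ≠ 0) (p : Plane) :
    S.point (2 * S.coordX p - 1) (2 * S.coordY p - 1) = p := by
  have hN : S.arm 0 ^ 2 + S.arm 1 ^ 2 ≠ 0 := by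
    simpa only [pow_two] using (normSq_pos hS).ne'
  ext i
  fin_cases i
  · simp [point, coordX, coordY]
    field_simp
    ring
  · simp [point, coordX, coordY]
    field_simp
    ring

theorem coord_injective (hS : S.arm ≠ 0) {p q : Plane} (hx : S.coordX p = S.coordX q)
    (hy : S.coordY p = S.coordY q) : p = q := by
  rw [← point_coord hS p, ← point_coord hS q, hx, hy]

theorem inUnit_of_mem_carrier {p : Plane} (h : p ∈ S.carrier) : S.InUnit p := by
  by_cases hS : S.arm = 0
  -- In a degenerate square the division by zero gives 0, so both coordinates are 1/2.
  · simp [InUnit, coordX, coordY, hS]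
    norm_num
  · obtain ⟨a, b, ha, hb, rfl⟩ := h
    rw [← point_eq, InUnit, coordX_point hS, coordY_point hS]
    rw [abs_le] at ha hb
    exact ⟨by linarith, by linarith, by linarith, by linarith⟩

end Square

/-! ### The Z-order -/

namespace Square

variable (S : Square)

/-- The comparison that the program uses for sorting. -/
def ZLe (p q : Plane) : Prop :=
  if sep (S.coordY p) (S.coordY q) ≤ sep (S.coordX p) (S.coordX q) then S.coordX p ≤ S.coordX q
  else S.coordY p ≤ S.coordY q

/-- The points belong to the same dyadic square of level `k`. -/
def SameCell (k : ℕ) (p q : Plane) : Prop :=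
  cell k (S.coordX p) = cell k (S.coordX q) ∧ cell k (S.coordY p) = cell k (S.coordY q)

/-- The strict Z-order: `p` precedes `q` in the first level where their cells differ. -/
def ZLt (p q : Plane) : Prop :=
  ∃ k, S.SameCell k p q ∧ (cell (k + 1) (S.coordX p) < cell (k + 1) (S.coordX q) ∨
    cell (k + 1) (S.coordX p) = cell (k + 1) (S.coordX q) ∧
      cell (k + 1) (S.coordY p) < cell (k + 1) (S.coordY q))

variable {S}

theorem SameCell.of_le {k l : ℕ} (h : k ≤ l) {p q : Plane} (hpq : S.SameCell l p q) :
    S.SameCell k p q :=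
  ⟨cell_eq_of_le h hpq.1, cell_eq_of_le h hpq.2⟩

/-- The coarser of the two levels at which the pairs part decides. -/
theorem ZLt.trans {p q r : Plane} (h : S.ZLt p q) (h' : S.ZLt q r) : S.ZLt p r := by
  obtain ⟨k, hk, hlt⟩ := h
  obtain ⟨l, hl, hlt'⟩ := h'
  rcases lt_trichotomy k l with hkl | rfl | hkl
  · have h1 := hl.of_le hkl.le
    have h2 := hl.of_le (show k + 1 ≤ l from hkl)
    exact ⟨k, ⟨hk.1.trans h1.1, hk.2.trans h1.2⟩, by rwa [← h2.1, ← h2.2]⟩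
  · exact ⟨k, ⟨hk.1.trans hl.1, hk.2.trans hl.2⟩, by omega⟩
  · have h1 := hk.of_le hkl.le
    have h2 := hk.of_le (show l + 1 ≤ k from hkl)
    exact ⟨l, ⟨h1.1.trans hl.1, h1.2.trans hl.2⟩, by rwa [h2.1, h2.2]⟩

theorem ZLt.irrefl (p : Plane) : ¬ S.ZLt p p := by
  rintro ⟨k, -, h⟩
  omega

theorem ZLe.total (p q : Plane) : S.ZLe p q ∨ S.ZLe q p := by
  unfold ZLe
  rw [sep_comm (S.coordX q), sep_comm (S.coordY q)]
  split_ifs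
  · exact le_total _ _
  · exact le_total _ _

theorem cell_lt_iff {k : ℕ} {x y : ℝ} (h : cell k x ≠ cell k y) : cell k x < cell k y ↔ x ≤ y := by
  constructor
  · intro h'
    by_contra hxy
    exact absurd (cell_mono k (not_le.1 hxy).le) (not_le.2 h')
  · exact fun h' => lt_of_le_of_ne (cell_mono k h') h

/-- A larger separating side means an earlier difference, so the coordinate with the larger side
decides; for equal sides both differ at the same level and the first coordinate has priority. Where
two cells differ, their order is that of the coordinates. Hence no digits need to be interleaved. -/
theorem ZLe_iff {p q : Plane} (hp : S.InUnit p) (hq : S.InUnit q) :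
    S.ZLe p q ↔ S.ZLt p q ∨ (S.coordX p = S.coordX q ∧ S.coordY p = S.coordY q) := by
  obtain ⟨hx0, hx1, hy0, hy1⟩ := hp
  obtain ⟨hx0', hx1', hy0', hy1'⟩ := hq
  have hsx := fun k => sep_lt_iff hx0 hx1 hx0' hx1' k
  have hsy := fun k => sep_lt_iff hy0 hy1 hy0' hy1' k
  simp only [ZLt, SameCell, ZLe]
  generalize S.coordX p = x at *
  generalize S.coordX q = x' at *
  generalize S.coordY p = y at *
  generalize S.coordY q = y' at *
  -- The level of the first difference is unique, so a witness for `ZLt` has to be this level.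
  have hlevel : ∀ k m : ℕ, (∀ k, (cell k x = cell k x' ∧ cell k y = cell k y') ↔ k ≤ m) →
      (cell k x = cell k x' ∧ cell k y = cell k y') ∧ (cell (k + 1) x < cell (k + 1) x' ∨
        cell (k + 1) x = cell (k + 1) x' ∧ cell (k + 1) y < cell (k + 1) y') → k = m := by
    rintro k m hm ⟨h1, h2⟩
    rw [hm] at h1
    have : ¬ k + 1 ≤ m := by
      rw [← hm]; omega
    omega
  split_ifs with h
  · by_cases hx : x = x'
    · subst hx
      rw [sep_self] at h
      have hy : y = y' := by
        by_contra hy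
        obtain ⟨m, hm, -⟩ := exists_sep_eq hy0 hy1 hy0' hy1' hy
        have : (0 : ℝ) < (1 / 2) ^ (m + 1) := by positivity
        linarith
      simp [hy]
    · obtain ⟨m, hm, hm'⟩ := exists_sep_eq hx0 hx1 hx0' hx1' hx
      have hne : cell (m + 1) x ≠ cell (m + 1) x' := by rw [Ne, hm']; omega
      have hboth : ∀ k, (cell k x = cell k x' ∧ cell k y = cell k y') ↔ k ≤ m := by
        intro k
        refine ⟨fun h => (hm' k).1 h.1, fun hk => ⟨(hm' k).2 hk, ?_⟩⟩
        rw [← hsy]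
        exact h.trans_lt (by rw [hm, half_pow_lt_iff]; omega)
      simp only [hx, false_and, or_false]
      rw [← cell_lt_iff hne]
      constructor
      · exact fun h => ⟨m, (hboth m).2 le_rfl, Or.inl h⟩
      · rintro ⟨k, hk⟩
        obtain rfl := hlevel k m hboth hk
        omega
  · have hy : y ≠ y' := by
      rintro rfl
      rw [sep_self] at h
      by_cases hx : x = x'
      · subst hx; rw [sep_self] at h; exact h le_rfl
      · obtain ⟨m, hm, -⟩ := exists_sep_eq hx0 hx1 hx0' hx1' hx
        rw [hm] at h
        exact h (by positivity)
    obtain ⟨m, hm, hm'⟩ := exists_sep_eq hy0 hy1 hy0' hy1' hy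
    have hne : cell (m + 1) y ≠ cell (m + 1) y' := by rw [Ne, hm']; omega
    have hxm : cell (m + 1) x = cell (m + 1) x' := by
      rw [← hsx, ← hm]; exact not_le.1 h
    have hboth : ∀ k, (cell k x = cell k x' ∧ cell k y = cell k y') ↔ k ≤ m := by
      intro k
      exact ⟨fun h => (hm' k).1 h.2, fun hk => ⟨cell_eq_of_le (by omega) hxm, (hm' k).2 hk⟩⟩
    simp only [hy, and_false, or_false]
    rw [← cell_lt_iff hne]
    constructor
    · exact fun h => ⟨m, (hboth m).2 le_rfl, Or.inr ⟨hxm, h⟩⟩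
    · rintro ⟨k, hk⟩
      obtain rfl := hlevel k m hboth hk
      omega

/-- Inherited from the description by cells, which is valid in the unit square only; `ZLe.total`
needs no such restriction. -/
theorem ZLe.trans {p q r : Plane} (hp : S.InUnit p) (hq : S.InUnit q) (hr : S.InUnit r)
    (h : S.ZLe p q) (h' : S.ZLe q r) : S.ZLe p r := by
  rw [ZLe_iff hp hq] at h
  rw [ZLe_iff hq hr] at h'
  rw [ZLe_iff hp hr]
  rcases h with h | ⟨hx, hy⟩
  · rcases h' with h' | ⟨hx', hy'⟩
    · exact Or.inl (h.trans h')
    · left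
      simpa only [ZLt, SameCell, hx', hy'] using h
  · rcases h' with h' | ⟨hx', hy'⟩
    · left
      simpa only [ZLt, SameCell, hx, hy] using h'
    · exact Or.inr ⟨hx.trans hx', hy.trans hy'⟩

theorem ZLe.lt (hS : S.arm ≠ 0) {p q : Plane} (hp : S.InUnit p) (hq : S.InUnit q) (hne : p ≠ q)
    (h : S.ZLe p q) : S.ZLt p q := by
  rw [ZLe_iff hp hq] at h
  exact h.resolve_right fun h => hne (coord_injective hS h.1 h.2)

/-! ### Gaps between consecutive points -/

variable (S)

/-- The side of the quarters of the smallest square of the recursion that contains both of the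
consecutive points `p` and `q` and that separates them. -/
noncomputable def gap (p q : Plane) : ℝ :=
  centreSide (max (sep (S.coordY p) (S.coordY q)) (sep (S.coordX p) (S.coordX q)))
    (S.coordX p) (S.coordY p)

variable {S}

/-- It suffices to test whether p is a centre: a centre q comes first in its quarter, so its
predecessor p is in another quarter or outside the square, and the cells separate them anyway
(`ZLt.not_isMidpoint`). -/
theorem gap_spec {p q : Plane} (hp : S.InUnit p) (hq : S.InUnit q) (h : S.ZLt p q) :
    ∃ l : ℕ, S.gap p q = (1 / 2) ^ (l + 1) ∧ ∀ k, k ≤ l ↔ S.SameCell k p q ∧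
      ∀ k' < k, ¬ (IsMidpoint k' (S.coordX p) ∧ IsMidpoint k' (S.coordY p)) := by
  obtain ⟨k, hk, hne⟩ := h
  obtain ⟨hx0, hx1, hy0, hy1⟩ := hp
  obtain ⟨hx0', hx1', hy0', hy1'⟩ := hq
  have hboth : ∀ k, max (sep (S.coordY p) (S.coordY q)) (sep (S.coordX p) (S.coordX q)) <
      (1 / 2) ^ k ↔ S.SameCell k p q := by
    intro k
    rw [max_lt_iff, sep_lt_iff hx0 hx1 hx0' hx1', sep_lt_iff hy0 hy1 hy0' hy1', and_comm]
    rfl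
  obtain ⟨m, hm⟩ : ∃ m : ℕ, max (sep (S.coordY p) (S.coordY q)) (sep (S.coordX p) (S.coordX q)) =
      (1 / 2) ^ (m + 1) := by
    rcases max_choice (sep (S.coordY p) (S.coordY q)) (sep (S.coordX p) (S.coordX q)) with h | h
    · rw [h]
      have hy : S.coordY p ≠ S.coordY q := by
        intro hy
        rw [hy, sep_self] at h
        have := (hboth (k + 1)).1 (by rw [hy, sep_self, h]; positivity)
        rw [SameCell] at this
        omega
      obtain ⟨m, hm, -⟩ := exists_sep_eq hy0 hy1 hy0' hy1' hy
      exact ⟨m, hm⟩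
    · rw [h]
      have hx : S.coordX p ≠ S.coordX q := by
        intro hx
        rw [hx, sep_self] at h
        have := (hboth (k + 1)).1 (by rw [hx, sep_self, h]; positivity)
        rw [SameCell] at this
        omega
      obtain ⟨m, hm, -⟩ := exists_sep_eq hx0 hx1 hx0' hx1' hx
      exact ⟨m, hm⟩
  have hm' : ∀ k, S.SameCell k p q ↔ k ≤ m := by
    intro k
    rw [← hboth, hm, half_pow_lt_iff]
    omega
  simp only [hm']
  rw [gap, hm]
  exact centreSide_spec m _ _

/-- The index of the dyadic interval of length `2 * g` that contains `x`. -/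
noncomputable def cellAt (g x : ℝ) : ℝ :=
  if 1 / (2 * g) ≤ ⌊x / (2 * g)⌋ then ⌊x / (2 * g)⌋ - 1 else ⌊x / (2 * g)⌋

variable (S)

/-- The centre of the square of the recursion with quarters of side `g` that contains `p`. -/
noncomputable def nodeCentre (g : ℝ) (p : Plane) : Plane :=
  S.point ((2 * cellAt g (S.coordX p) + 1) * (2 * g) - 1)
    ((2 * cellAt g (S.coordY p) + 1) * (2 * g) - 1)

/-- The square with the indices `i`, `j` in level `k` of the recursion. -/
noncomputable def sub (k : ℕ) (i j : ℤ) : Square :=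
  ⟨S.point ((2 * i + 1) * (1 / 2) ^ k - 1) ((2 * j + 1) * (1 / 2) ^ k - 1), (1 / 2 : ℝ) ^ k • S.arm⟩

variable {S}

/-- This is the truncation of `cell`, done with the number 1 / (2 * g) = 2^k of cells in a row, so
that the program need not know the level k. -/
theorem cellAt_eq (k : ℕ) {x : ℝ} (hx : x ≤ 1) : cellAt ((1 / 2) ^ (k + 1)) x = cell k x := by
  have h1 : 2 * (1 / 2 : ℝ) ^ (k + 1) = (2 ^ k)⁻¹ := by
    rw [pow_succ, one_div, inv_pow]; ring
  rw [cellAt, h1, one_div, inv_inv, div_inv_eq_mul, mul_comm x, cell]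
  have h2 : ⌊(2 : ℝ) ^ k * x⌋ ≤ 2 ^ k := by
    rw [Int.floor_le_iff]
    push_cast
    have : (2 : ℝ) ^ k * x ≤ 2 ^ k * 1 := by gcongr
    linarith
  split_ifs with h
  · have h3 : (2 : ℤ) ^ k ≤ ⌊(2 : ℝ) ^ k * x⌋ := by exact_mod_cast h
    rw [min_eq_right (by omega), le_antisymm h2 h3]
    push_cast
    rfl
  · have h3 : ¬ (2 : ℤ) ^ k ≤ ⌊(2 : ℝ) ^ k * x⌋ := by exact_mod_cast h
    rw [min_eq_left (by omega)]

theorem nodeCentre_eq (k : ℕ) {p : Plane} (hp : S.InUnit p) :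
    S.nodeCentre ((1 / 2) ^ (k + 1)) p =
      (S.sub k (cell k (S.coordX p)) (cell k (S.coordY p))).center := by
  have h1 : 2 * (1 / 2 : ℝ) ^ (k + 1) = (1 / 2) ^ k := by rw [pow_succ]; ring
  rw [nodeCentre, cellAt_eq k hp.2.1, cellAt_eq k hp.2.2.2, h1]
  rfl

end Square

/-! ### Trees from gaps -/

mutual
/-- `Dendro gap ctr L T`: the tree `T` has the leaves `L`; at each vertex, the list of the leaves is
split at all gaps of maximal size `g`, and the vertex is placed at `ctr g p` for the first leaf
`p`. -/
inductive Dendro (gap : Plane → Plane → ℝ) (ctr : ℝ → Plane → Plane) : List Plane → GTree → Prop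
  | leaf (p : Plane) : Dendro gap ctr [p] (.leaf p)
  | node (g : ℝ) (p : Plane) (L : List Plane) (ts : List GTree) (h : Forest gap ctr g (p :: L) ts)
      (hts : 2 ≤ ts.length) : Dendro gap ctr (p :: L) (.node (ctr g p) ts)
/-- The list of the trees for the blocks of a list that is split at the gaps of size `g`. -/
inductive Forest (gap : Plane → Plane → ℝ) (ctr : ℝ → Plane → Plane) :
    ℝ → List Plane → List GTree → Prop
  | nil (g : ℝ) : Forest gap ctr g [] []
  | cons (g : ℝ) (A B : List Plane) (T : GTree) (ts : List GTree) (hT : Dendro gap ctr A T)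
      (hA : A.IsChain fun p q => gap p q < g)
      (hAB : ∀ p ∈ A.getLast?, ∀ q ∈ B.head?, gap p q = g) (h : Forest gap ctr g B ts) :
      Forest gap ctr g (A ++ B) (T :: ts)
end

section Dendro

variable {gap : Plane → Plane → ℝ} {ctr : ℝ → Plane → Plane}

theorem Dendro.ne_nil {L : List Plane} {T : GTree} (h : Dendro gap ctr L T) : L ≠ [] := by
  cases h <;> simp

theorem Forest.isChain {g : ℝ} {L : List Plane} {ts : List GTree} (h : Forest gap ctr g L ts) :
    L.IsChain fun p q => gap p q ≤ g := by
  induction ts generalizing L with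
  | nil => cases h; simp
  | cons T ts ih =>
    cases h with
    | cons _ A B _ _ hT hA hAB h =>
    rw [List.isChain_append]
    exact ⟨hA.imp fun _ _ h => h.le, ih h, fun p hp q hq => (hAB p hp q hq).le⟩

theorem Forest.length_le {g : ℝ} {L : List Plane} {ts : List GTree} (h : Forest gap ctr g L ts) :
    ts.length ≤ L.length := by
  induction ts generalizing L with
  | nil => simp
  | cons T ts ih =>
    cases h with
    | cons _ A B _ _ hT hA hAB h =>
    have := ih h
    have := List.length_pos_iff.2 hT.ne_nil
    simp only [List.length_cons, List.length_append]
    omega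

theorem Dendro.eq_leaf {p : Plane} {T : GTree} (h : Dendro gap ctr [p] T) : T = .leaf p := by
  cases h with
  | leaf => rfl
  | node g _ _ ts h hts =>
    have := h.length_le
    simp only [List.length_cons, List.length_nil] at this
    omega

/-- Two blocks have a boundary between them, and the gap at this boundary is g itself. -/
theorem Forest.not_isChain {g : ℝ} {L : List Plane} {ts : List GTree} (h : Forest gap ctr g L ts)
    (hts : 2 ≤ ts.length) : ¬ L.IsChain fun p q => gap p q < g := by
  cases h with
  | nil => simp at hts
  | cons _ A B T ts hT hA hAB h =>
  cases h with
  | nil => simp at hts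
  | cons _ A' B' T' ts hT' hA' hAB' h =>
  rw [List.isChain_append]
  rintro ⟨-, -, h3⟩
  obtain ⟨p, hp⟩ := (⟨_, List.getLast?_eq_some_getLast hT.ne_nil⟩ : ∃ p, p ∈ A.getLast?)
  have hne : A' ++ B' ≠ [] := by simp [hT'.ne_nil]
  obtain ⟨q, hq⟩ := Option.isSome_iff_exists.1 (List.isSome_head?.2 hne)
  exact absurd (hAB p hp q hq) (h3 p hp q hq).ne

/-- The tree for a possibly empty list of leaves. -/
def DendroOption (gap : Plane → Plane → ℝ) (ctr : ℝ → Plane → Plane) (L : List Plane)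
    (o : Option GTree) : Prop :=
  (L = [] ∧ o = none) ∨ ∃ T, o = some T ∧ Dendro gap ctr L T

/-- The blocks are determined by the list and g. If A were not the first block, the shorter of the
two would end at a gap equal to g that lies inside the longer one, where all gaps are smaller. An
empty A peels off nothing, as needed for empty quarters. -/
theorem Forest.peel {g : ℝ} {A B : List Plane} {ts : List GTree}
    (h : Forest gap ctr g (A ++ B) ts) (hA : A.IsChain fun p q => gap p q < g)
    (hAB : ∀ p ∈ A.getLast?, ∀ q ∈ B.head?, gap p q = g) :
    ∃ o ts', ts = o.toList ++ ts' ∧ DendroOption gap ctr A o ∧ Forest gap ctr g B ts' := by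
  by_cases hA0 : A = []
  · subst hA0
    exact ⟨none, ts, rfl, Or.inl ⟨rfl, rfl⟩, h⟩
  generalize hL : A ++ B = L at h
  cases h with
  | nil => simp [hA0] at hL
  | cons _ A' B' T ts hT hA' hAB' h =>
  have key : A = A' ∧ B = B' := by
    rcases List.append_eq_append_iff.1 hL with ⟨C, h1, h2⟩ | ⟨C, h1, h2⟩
    · rcases C with _ | ⟨q, C⟩
      · exact ⟨by simpa using h1.symm, by simpa using h2⟩
      · exfalso
        subst h1 h2
        obtain ⟨p, hp⟩ := (⟨_, List.getLast?_eq_some_getLast hA0⟩ : ∃ p, p ∈ A.getLast?)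
        rw [List.isChain_append] at hA'
        exact (hA'.2.2 p hp q rfl).ne (hAB p hp q rfl)
    · rcases C with _ | ⟨q, C⟩
      · exact ⟨by simpa using h1, by simpa using h2.symm⟩
      · exfalso
        subst h1 h2
        obtain ⟨p, hp⟩ := (⟨_, List.getLast?_eq_some_getLast hT.ne_nil⟩ : ∃ p, p ∈ A'.getLast?)
        rw [List.isChain_append] at hA
        exact (hA.2.2 p hp q rfl).ne (hAB' p hp q rfl)
  obtain ⟨rfl, rfl⟩ := key
  exact ⟨some T, ts, rfl, Or.inr ⟨T, rfl, hT⟩, h⟩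

mutual
theorem Dendro.noSingleChild : ∀ {L : List Plane} (T : GTree), Dendro gap ctr L T → T.NoSingleChild
  | _, .leaf _, _ => by simp [GTree.NoSingleChild]
  | _, .node _ ts, .node _ _ _ _ h hts => by
    simp only [GTree.NoSingleChild]
    exact ⟨by omega, Forest.noSingleChild ts h⟩
theorem Forest.noSingleChild : ∀ {g : ℝ} {L : List Plane} (ts : List GTree),
    Forest gap ctr g L ts → GTree.NoSingleChildAll ts
  | _, _, [], _ => by simp [GTree.NoSingleChildAll]
  | _, _, T :: ts, .cons _ _ _ _ _ hT _ _ h => by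
    simp only [GTree.NoSingleChildAll]
    exact ⟨Dendro.noSingleChild T hT, Forest.noSingleChild ts h⟩
end

mutual
-- Each tree of a forest saves one vertex against twice the number of its leaves; this is the
-- summand `ts.length` in the companion bound. At a node the two or more savings pay for the node
-- and leave one over.
theorem Dendro.numVertices_lt :
    ∀ {L : List Plane} (T : GTree), Dendro gap ctr L T → T.numVertices < 2 * L.length
  | _, .leaf _, h => by
    have := List.length_pos_iff.2 h.ne_nil
    simp only [GTree.numVertices]
    omega
  | _, .node _ ts, .node _ _ _ _ h hts => by
    have := Forest.numVerticesAll_le ts h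
    simp only [GTree.numVertices]
    omega
theorem Forest.numVerticesAll_le : ∀ {g : ℝ} {L : List Plane} (ts : List GTree),
    Forest gap ctr g L ts → GTree.numVerticesAll ts + ts.length ≤ 2 * L.length
  | _, _, [], _ => by simp [GTree.numVerticesAll]
  | _, _, T :: ts, .cons _ _ _ _ _ hT _ _ h => by
    have := Dendro.numVertices_lt T hT
    have := Forest.numVerticesAll_le ts h
    simp only [GTree.numVerticesAll, List.length_append, List.length_cons]
    omega
end

end Dendro

/-! ### Compressed quadtrees from gaps -/

theorem GTree.compressAll_append (l₁ l₂ : List GTree) :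
    GTree.compressAll (l₁ ++ l₂) = GTree.compressAll l₁ ++ GTree.compressAll l₂ := by
  induction l₁ with
  | nil => simp [GTree.compressAll]
  | cons T ts ih => simp [GTree.compressAll, ih]

theorem GTree.contract_of_two_le (o : Plane) {ts : List GTree} (h : 2 ≤ ts.length) :
    GTree.contract o ts = some (.node o ts) := by
  rcases ts with _ | ⟨a, _ | ⟨b, ts⟩⟩
  · simp at h
  · simp at h
  · rfl

-- Geometry of the dyadic squares of the recursion

namespace Square

variable {S : Square}

theorem norm_sq_smul_add_smul_perp (w : Plane) (a b : ℝ) :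
    ‖a • w + b • perp w‖ ^ 2 = (a ^ 2 + b ^ 2) * ‖w‖ ^ 2 := by
  simp only [EuclideanSpace.norm_sq_eq, Fin.sum_univ_two, Real.norm_eq_abs, sq_abs]
  simp [perp]
  ring

theorem dist_le_diam {p q : Plane} (hp : p ∈ S.carrier) (hq : q ∈ S.carrier) :
    dist p q ≤ S.diam := by
  obtain ⟨a, b, ha, hb, rfl⟩ := hp
  obtain ⟨c, d, hc, hd, rfl⟩ := hq
  have h : (S.center + a • S.arm + b • perp S.arm) - (S.center + c • S.arm + d • perp S.arm) =
      (a - c) • S.arm + (b - d) • perp S.arm := by module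
  rw [dist_eq_norm, h, diam]
  refine abs_le_of_sq_le_sq' ?_ (by positivity) |>.2
  rw [norm_sq_smul_add_smul_perp, mul_pow, mul_pow, Real.sq_sqrt (by norm_num)]
  rw [abs_le] at ha hb hc hd
  gcongr
  nlinarith

theorem diam_sub (k : ℕ) (i j : ℤ) : (S.sub k i j).diam = (1 / 2) ^ k * S.diam := by
  simp only [diam, sub, norm_smul, norm_pow, Real.norm_eq_abs]
  rw [abs_of_pos (by norm_num)]
  ring

theorem quarter_sub (k : ℕ) (i j : ℤ) (q : Fin 4) : (S.sub k i j).quarter q =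
    S.sub (k + 1) (2 * i + ![1, 1, 0, 0] q) (2 * j + ![1, 0, 1, 0] q) := by
  have ext' : ∀ {S T : Square}, S.center = T.center → S.arm = T.arm → S = T := by
    rintro ⟨_, _⟩ ⟨_, _⟩ rfl rfl
    rfl
  apply ext'
  · ext l
    fin_cases q <;> fin_cases l <;> simp [quarter, sub, point, perp] <;> ring
  · ext l
    fin_cases q <;> fin_cases l <;> simp [quarter, sub] <;> ring

theorem mem_carrier_sub (hS : S.arm ≠ 0) {p : Plane} (hp : S.InUnit p) (k : ℕ) :
    p ∈ (S.sub k (cell k (S.coordX p)) (cell k (S.coordY p))).carrier := by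
  have h2 := two_pow_mul_half_pow k
  obtain ⟨-, hx, -, hy⟩ := hp
  have h1 := cell_le k (S.coordX p)
  have h1' := le_cell_add_one k hx
  have h3 := cell_le k (S.coordY p)
  have h3' := le_cell_add_one k hy
  refine ⟨2 * (2 ^ k * S.coordX p - cell k (S.coordX p)) - 1,
    2 * (2 ^ k * S.coordY p - cell k (S.coordY p)) - 1, ?_, ?_, ?_⟩
  · rw [abs_le]; constructor <;> linarith
  · rw [abs_le]; constructor <;> linarith
  · conv_lhs => rw [← point_coord hS p]
    have e : ∀ x i : ℝ, 2 * x - 1 = (2 * i + 1) * (1 / 2) ^ k - 1 +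
        (2 * (2 ^ k * x - i) - 1) * (1 / 2) ^ k := by
      intro x i
      linear_combination (-2 * x) * h2
    ext l
    fin_cases l
    · simp [sub, point, perp, -one_div]
      linear_combination S.arm 0 * e (S.coordX p) (cell k (S.coordX p)) -
        S.arm 1 * e (S.coordY p) (cell k (S.coordY p))
    · simp [sub, point, perp, -one_div]
      linear_combination S.arm 1 * e (S.coordX p) (cell k (S.coordX p)) +
        S.arm 0 * e (S.coordY p) (cell k (S.coordY p))

theorem eq_center_sub_iff (hS : S.arm ≠ 0) {p : Plane} (k : ℕ) (i j : ℤ) :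
    p = (S.sub k i j).center ↔
      (2 : ℝ) ^ (k + 1) * S.coordX p = 2 * i + 1 ∧ (2 : ℝ) ^ (k + 1) * S.coordY p = 2 * j + 1 := by
  have h2 := two_pow_mul_half_pow k
  have e : ∀ x i : ℝ, (2 : ℝ) ^ (k + 1) * x = 2 * i + 1 ↔
      x = ((2 * i + 1) * (1 / 2) ^ k - 1 + 1) / 2 := by
    intro x i
    have hk : (2 : ℝ) ^ k ≠ 0 := by positivity
    rw [pow_succ, one_div, inv_pow]
    field_simp
    constructor <;> intro h <;> linarith
  rw [e, e]
  constructor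
  · rintro rfl
    exact ⟨coordX_point hS _ _, coordY_point hS _ _⟩
  · rintro ⟨hx, hy⟩
    refine coord_injective hS ?_ ?_
    · rw [hx]; exact (coordX_point hS _ _).symm
    · rw [hy]; exact (coordY_point hS _ _).symm

end Square

/-- A midpoint is the lower end of the upper half of its interval, hence it is assigned to the odd
cell of the next level. -/
theorem IsMidpoint.cell_eq {k : ℕ} {x : ℝ} (h : IsMidpoint k x) (hx : x ≤ 1) :
    (2 : ℝ) ^ (k + 1) * x = cell (k + 1) x ∧ cell (k + 1) x = 2 * cell k x + 1 := by
  obtain ⟨m, hm⟩ := h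
  have h1 : (2 : ℝ) ^ (k + 1) * x ≤ 2 ^ (k + 1) * 1 := by gcongr
  -- The left side is odd and the right side even, so the inequality is strict and the truncation in
  -- `cell` does not act.
  have h2 : 2 * m + 1 ≤ (2 : ℤ) ^ (k + 1) := by
    rw [hm, mul_one] at h1
    exact_mod_cast h1
  have h3 : cell (k + 1) x = 2 * m + 1 := by
    have : ⌊(2 : ℝ) ^ (k + 1) * x⌋ = 2 * m + 1 := by
      rw [hm]; exact_mod_cast Int.floor_intCast (2 * m + 1)
    rw [cell, this]
    rw [pow_succ] at *
    omega
  refine ⟨by rw [hm, h3]; push_cast; ring, ?_⟩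
  have := cell_eq_div k x
  omega

-- The quarters and the centre along the Z-order

namespace Square

variable {S : Square}

open Classical in
/-- The rank of the part of a square of level `k` that contains `p`: the parts are, in
this order, the quarters `3`, `2`, `1`, the centre, and the quarter `0`. -/
noncomputable def rank (S : Square) (k : ℕ) (p : Plane) : ℕ :=
  if IsMidpoint k (S.coordX p) ∧ IsMidpoint k (S.coordY p) then 3
  else if cell (k + 1) (S.coordX p) % 2 = 0 then if cell (k + 1) (S.coordY p) % 2 = 0 then 0 else 1
  else if cell (k + 1) (S.coordY p) % 2 = 0 then 2 else 4

theorem rank_le (k : ℕ) (p : Plane) : S.rank k p ≤ 4 := by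
  unfold rank; split_ifs <;> omega

theorem rank_eq_three_iff (k : ℕ) (p : Plane) :
    S.rank k p = 3 ↔ IsMidpoint k (S.coordX p) ∧ IsMidpoint k (S.coordY p) := by
  unfold rank; split_ifs <;> simp_all

/-- A centre is the lowest corner, in both coordinates, of its cell in the next level, so no point
of that cell precedes it. -/
theorem ZLt.not_isMidpoint {k : ℕ} {p q : Plane} (hq : S.InUnit q) (h : S.ZLt p q)
    (hpq : S.SameCell (k + 1) p q) :
    ¬ (IsMidpoint k (S.coordX q) ∧ IsMidpoint k (S.coordY q)) := by
  rintro ⟨hx, hy⟩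
  have hpos : (0 : ℝ) < 2 ^ (k + 1) := by positivity
  have h1 : S.coordX q ≤ S.coordX p := by
    refine le_of_mul_le_mul_left ?_ hpos
    rw [(hx.cell_eq hq.2.1).1, ← hpq.1]
    exact cell_le _ _
  have h2 : S.coordY q ≤ S.coordY p := by
    refine le_of_mul_le_mul_left ?_ hpos
    rw [(hy.cell_eq hq.2.2.2).1, ← hpq.2]
    exact cell_le _ _
  obtain ⟨l, -, hl⟩ := h
  have := cell_mono (l + 1) h1
  have := cell_mono (l + 1) h2
  omega

/-- The parities of the cells of the next level order the quarters, the first coordinate having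
priority. The centre lies in the last quarter and comes first there, so it fits in just before the
rest of that quarter. -/
theorem ZLt.rank_le_rank {k : ℕ} {p q : Plane} (hp : S.InUnit p) (hq : S.InUnit q) (h : S.ZLt p q)
    (hpq : S.SameCell k p q) : S.rank k p ≤ S.rank k q := by
  have hpx := cell_eq_div k (S.coordX p)
  have hpy := cell_eq_div k (S.coordY p)
  have hqx := cell_eq_div k (S.coordX q)
  have hqy := cell_eq_div k (S.coordY q)
  have hp3 : IsMidpoint k (S.coordX p) ∧ IsMidpoint k (S.coordY p) →
      cell (k + 1) (S.coordX p) = 2 * cell k (S.coordX p) + 1 ∧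
      cell (k + 1) (S.coordY p) = 2 * cell k (S.coordY p) + 1 :=
    fun h => ⟨(h.1.cell_eq hp.2.1).2, (h.2.cell_eq hp.2.2.2).2⟩
  have hq3 : IsMidpoint k (S.coordX q) ∧ IsMidpoint k (S.coordY q) →
      cell (k + 1) (S.coordX q) = 2 * cell k (S.coordX q) + 1 ∧
      cell (k + 1) (S.coordY q) = 2 * cell k (S.coordY q) + 1 :=
    fun h => ⟨(h.1.cell_eq hq.2.1).2, (h.2.cell_eq hq.2.2.2).2⟩
  obtain ⟨hcx, hcy⟩ := hpq
  by_cases hs : S.SameCell (k + 1) p q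
  · have hq' := h.not_isMidpoint hq hs
    obtain ⟨hs1, hs2⟩ := hs
    simp only [rank, if_neg hq', hs1, hs2]
    split_ifs with h1 h2 h3 h4 h5 <;> first | omega | (have := hp3 h1; omega)
  · obtain ⟨l, hl, hlt⟩ := h
    have hlk : l = k := by
      rcases lt_trichotomy l k with h | h | h
      · have h1 := cell_eq_of_le (show l + 1 ≤ k from h) hcx
        have h2 := cell_eq_of_le (show l + 1 ≤ k from h) hcy
        omega
      · exact h
      · exact absurd (hl.of_le h) hs
    subst hlk
    unfold rank
    by_cases h1 : IsMidpoint l (S.coordX p) ∧ IsMidpoint l (S.coordY p)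
    · have := hp3 h1
      have := cell_eq_div l (S.coordX q)
      omega
    rw [if_neg h1]
    by_cases h2 : IsMidpoint l (S.coordX q) ∧ IsMidpoint l (S.coordY q)
    · have := hq3 h2
      rw [if_pos h2]
      split_ifs <;> omega
    rw [if_neg h2]
    split_ifs <;> omega

/-- A gap below the side of the quarters means that the pair reaches the next level together: it
lies in one quarter and p is not removed as the centre. This amounts to equal ranks, because two
points cannot both have the rank of the centre. The assumed bound on the gap says that the pair has
reached level k together. -/
theorem gap_lt_iff_rank_eq {k : ℕ} {p q : Plane} (hp : S.InUnit p)
    (hq : S.InUnit q) (h : S.ZLt p q) (hpq : S.SameCell k p q) (hg : S.gap p q < (1 / 2) ^ k) :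
    (S.gap p q < (1 / 2) ^ (k + 1) ↔ S.rank k p = S.rank k q) ∧ S.gap p q ≤ (1 / 2) ^ (k + 1) := by
  obtain ⟨l, hl, hl'⟩ := gap_spec hp hq h
  rw [hl, half_pow_lt_iff] at hg
  have hkl : k ≤ l := by omega
  rw [hl, half_pow_lt_iff, half_pow_le_iff]
  refine ⟨?_, by omega⟩
  have h1 : k + 1 < l + 1 ↔ S.SameCell (k + 1) p q ∧ S.rank k p ≠ 3 := by
    rw [show k + 1 < l + 1 ↔ k + 1 ≤ l by omega, hl', Ne, rank_eq_three_iff]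
    refine and_congr_right fun _ => ⟨fun h => h k (by omega), fun h k' hk' => ?_⟩
    rcases (Nat.lt_succ_iff.1 hk').lt_or_eq with h3 | rfl
    · exact ((hl' k).1 hkl).2 k' h3
    · exact h
  rw [h1]
  constructor
  · rintro ⟨h2, h3⟩
    have h4 := h.not_isMidpoint hq h2
    rw [Ne, rank_eq_three_iff] at h3
    simp only [rank, if_neg h3, if_neg h4, h2.1, h2.2]
  · intro h2
    have h3 : S.rank k p ≠ 3 := by
      intro h3
      have h4 := h3
      rw [h2] at h4
      rw [rank_eq_three_iff] at h3 h4
      have h5 := h3.1.cell_eq hp.2.1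
      have h6 := h3.2.cell_eq hp.2.2.2
      have h7 := h4.1.cell_eq hq.2.1
      have h8 := h4.2.cell_eq hq.2.2.2
      have h9 : S.SameCell (k + 1) p q := ⟨by rw [h5.2, h7.2, hpq.1], by rw [h6.2, h8.2, hpq.2]⟩
      exact h.not_isMidpoint hq h9 h4
    refine ⟨?_, h3⟩
    have h4 := h3
    rw [h2] at h4
    rw [Ne, rank_eq_three_iff] at h3 h4
    have hpx := cell_eq_div k (S.coordX p)
    have hpy := cell_eq_div k (S.coordY p)
    have hqx := cell_eq_div k (S.coordX q)
    have hqy := cell_eq_div k (S.coordY q)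
    obtain ⟨hcx, hcy⟩ := hpq
    simp only [rank, if_neg h3, if_neg h4] at h2
    unfold SameCell
    split_ifs at h2 <;> first | contradiction | (constructor <;> omega)

theorem eq_center_of_rank_eq_three (hS : S.arm ≠ 0) {k : ℕ} {p : Plane} (hp : S.InUnit p)
    (h : S.rank k p = 3) :
    p = (S.sub k (cell k (S.coordX p)) (cell k (S.coordY p))).center := by
  rw [rank_eq_three_iff] at h
  rw [eq_center_sub_iff hS]
  obtain ⟨h1, h2⟩ := h.1.cell_eq hp.2.1
  obtain ⟨h3, h4⟩ := h.2.cell_eq hp.2.2.2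
  rw [h1, h2, h3, h4]
  push_cast
  exact ⟨rfl, rfl⟩

theorem rank_center (hS : S.arm ≠ 0) (k : ℕ) (i j : ℤ) : S.rank k (S.sub k i j).center = 3 := by
  rw [rank_eq_three_iff]
  have := (eq_center_sub_iff hS (p := (S.sub k i j).center) k i j).1 rfl
  exact ⟨⟨i, this.1⟩, ⟨j, this.2⟩⟩

end Square

/-- In a list sorted by rank the points of one rank are consecutive, so the filters recover the
blocks. -/
theorem eq_flatten_filter_rank {α : Type*} (r : α → ℕ) (L : List α)
    (hL : L.Pairwise fun a b => r a ≤ r b) (h4 : ∀ a ∈ L, r a ≤ 4) :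
    L = L.filter (r · = 0) ++ (L.filter (r · = 1) ++ (L.filter (r · = 2) ++
      (L.filter (r · = 3) ++ (L.filter (r · = 4) ++ [])))) := by
  induction L with
  | nil => rfl
  | cons a L ih =>
    rw [List.pairwise_cons] at hL
    have ih := ih hL.2 fun b hb => h4 b (List.mem_cons_of_mem _ hb)
    have hnil : ∀ m < r a, L.filter (r · = m) = [] := by
      intro m hm
      rw [List.filter_eq_nil_iff]
      intro b hb
      have := hL.1 b hb
      simp only [decide_eq_true_eq]
      omega
    have ha := h4 a List.mem_cons_self
    conv_lhs => rw [ih]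
    generalize hra : r a = m at *
    interval_cases m <;> simp [hra, hnil]

-- The recursion on squares follows the splitting at gaps

namespace Square

variable {S : Square}

/-- The pieces of the compressed tree for the parts of a square. -/
theorem exists_pieces {k : ℕ} {i j : ℤ} {L : List Plane} {o : Option GTree}
    (hL : ∀ p ∈ L, S.InUnit p ∧ cell k (S.coordX p) = i ∧ cell k (S.coordY p) = j)
    (hchain : L.IsChain fun p q => (S.gap p q < (1 / 2) ^ (k + 1) ↔ S.rank k p = S.rank k q) ∧
      S.gap p q ≤ (1 / 2) ^ (k + 1))
    (hrank : L.Pairwise fun p q => S.rank k p ≤ S.rank k q)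
    (ho : DendroOption S.gap S.nodeCentre L o) :
    ∃ f : ℕ → Option GTree,
      (∀ r, r ≤ 4 → DendroOption S.gap S.nodeCentre (L.filter (S.rank k · = r)) (f r)) ∧
      GTree.contract (S.sub k i j).center ((f 0).toList ++ ((f 1).toList ++ ((f 2).toList ++
        ((f 3).toList ++ (f 4).toList)))) = o := by
  rcases ho with ⟨rfl, rfl⟩ | ⟨T, rfl, hT⟩
  · exact ⟨fun _ => none, fun r _ => Or.inl ⟨by simp, rfl⟩, rfl⟩
  -- If all gaps are smaller than the side of the quarters, all points have the same rank, and the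
  -- vertex of the square has a single child and is contracted. Otherwise the root of `T` is the
  -- vertex of this square.
  by_cases hlt : L.IsChain fun p q => S.gap p q < (1 / 2) ^ (k + 1)
  · obtain ⟨p, L', rfl⟩ := List.exists_cons_of_ne_nil hT.ne_nil
    have heq : (p :: L').IsChain fun p q => S.rank k p = S.rank k q := by
      rw [List.isChain_iff_getElem] at hlt hchain ⊢
      exact fun n hn => (hchain n hn).1.1 (hlt n hn)
    have htr : Trans (fun p q => S.rank k p = S.rank k q) (fun p q => S.rank k p = S.rank k q)
        (fun p q => S.rank k p = S.rank k q) := ⟨fun h h' => h.trans h'⟩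
    rw [List.isChain_iff_pairwise, List.pairwise_cons] at heq
    have hall : ∀ q ∈ p :: L', S.rank k q = S.rank k p := by
      intro q hq
      rcases List.mem_cons.1 hq with rfl | hq
      · rfl
      · exact (heq.1 q hq).symm
    refine ⟨fun r => if r = S.rank k p then some T else none, fun r _ => ?_, ?_⟩
    · by_cases hr : r = S.rank k p
      · right
        refine ⟨T, by simp [hr], ?_⟩
        rwa [List.filter_eq_self.2]
        intro q hq
        simp [hall q hq, hr]
      · left
        refine ⟨?_, by simp [hr]⟩
        rw [List.filter_eq_nil_iff]
        intro q hq
        simp [hall q hq, Ne.symm hr]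
    · have := rank_le (S := S) k p
      generalize S.rank k p = r at *
      interval_cases r <;> simp [GTree.contract]
  · have hle : L.IsChain fun p q => S.gap p q ≤ (1 / 2) ^ (k + 1) := hchain.imp fun _ _ h => h.2
    cases hT with
    | leaf p => simp at hlt
    | node g p L' ts h hts =>
    -- The gap g of the root is the maximum over the list. It is at most the side of the quarters,
    -- and by the case assumption it is not smaller.
    have hg : g = (1 / 2) ^ (k + 1) := by
      rcases lt_trichotomy g ((1 / 2) ^ (k + 1)) with h' | h' | h'
      · exact absurd (h.isChain.imp fun _ _ h => h.trans_lt h') hlt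
      · exact h'
      · exact absurd (hle.imp fun _ _ h => h.trans_lt h') (h.not_isChain hts)
    subst hg
    have hp := hL p List.mem_cons_self
    rw [nodeCentre_eq k hp.1, hp.2.1, hp.2.2]
    clear hlt hle hp
    have hsplit := eq_flatten_filter_rank (S.rank k) _ hrank fun q _ => rank_le k q
    have hmem : ∀ r, ∀ q ∈ (p :: L').filter (S.rank k · = r), S.rank k q = r := by
      intro r q hq
      simpa using (List.mem_filter.1 hq).2
    -- Within a rank the gaps are smaller than g, and between different ranks they equal g. So each
    -- nonempty rank class is one block of the forest, and the classes can be peeled off in turn.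
    have step : ∀ (r : ℕ) (B : List Plane) (us : List GTree), (∀ q ∈ B, r < S.rank k q) →
        Forest S.gap S.nodeCentre ((1 / 2) ^ (k + 1)) ((p :: L').filter (S.rank k · = r) ++ B) us →
        ((p :: L').filter (S.rank k · = r) ++ B).IsChain (fun p q =>
          (S.gap p q < (1 / 2) ^ (k + 1) ↔ S.rank k p = S.rank k q) ∧
            S.gap p q ≤ (1 / 2) ^ (k + 1)) →
        ∃ o us', us = o.toList ++ us' ∧
          DendroOption S.gap S.nodeCentre ((p :: L').filter (S.rank k · = r)) o ∧
          Forest S.gap S.nodeCentre ((1 / 2) ^ (k + 1)) B us' := by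
      intro r B us hB hF hC
      rw [List.isChain_append] at hC
      refine hF.peel ?_ ?_
      · refine List.IsChain.imp_of_mem_imp (fun a b ha hb h => ?_) hC.1
        exact h.1.2 (by rw [hmem r a ha, hmem r b hb])
      · intro a ha b hb
        have h1 := hC.2.2 a ha b hb
        have h2 := hB b (List.mem_of_mem_head? hb)
        have h3 := hmem r a (List.mem_of_mem_getLast? ha)
        refine le_antisymm h1.2 (not_lt.1 fun h4 => ?_)
        have := h1.1.1 h4
        omega
    rw [hsplit] at h hchain
    obtain ⟨o0, t1, rfl, h0, h⟩ := step 0 _ _ (by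
      simp only [List.mem_append]; rintro q (hq | hq | hq | hq | hq) <;>
      first | (have := hmem _ q hq; omega) | simp at hq) h hchain
    replace hchain := hchain.right_of_append
    obtain ⟨o1, t2, rfl, h1, h⟩ := step 1 _ _ (by
      simp only [List.mem_append]; rintro q (hq | hq | hq | hq) <;>
      first | (have := hmem _ q hq; omega) | simp at hq) h hchain
    replace hchain := hchain.right_of_append
    obtain ⟨o2, t3, rfl, h2, h⟩ := step 2 _ _ (by
      simp only [List.mem_append]; rintro q (hq | hq | hq) <;>
      first | (have := hmem _ q hq; omega) | simp at hq) h hchain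
    replace hchain := hchain.right_of_append
    obtain ⟨o3, t4, rfl, h3, h⟩ := step 3 _ _ (by
      simp only [List.mem_append]; rintro q (hq | hq) <;>
      first | (have := hmem _ q hq; omega) | simp at hq) h hchain
    replace hchain := hchain.right_of_append
    obtain ⟨o4, t5, rfl, h4, h⟩ := step 4 _ _ (by simp) h hchain
    have ht5 : t5 = [] := by
      have := h.length_le
      simpa using this
    subst ht5
    refine ⟨fun r => ![o0, o1, o2, o3, o4] (Fin.ofNat 5 r), ?_, ?_⟩
    · intro r hr
      interval_cases r
      exacts [h0, h1, h2, h3, h4]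
    · rw [List.append_nil] at hts ⊢
      exact GTree.contract_of_two_le _ hts

/-- Induction on the number m of halvings that brings the diameter down to δ/8. The compressed tree
is given, and the uncompressed tree is recovered from the pieces belonging to the quarters and the
centre. Levels at which nothing is split only add empty subtrees and chains with single children, so
the compressed result does not depend on where the recursion stops. -/
theorem exists_isQuadtree {δ : ℝ} (hS : S.arm ≠ 0) (hδ : 0 < δ) (m : ℕ) :
    ∀ (k : ℕ) (i j : ℤ) (L : List Plane) (o : Option GTree),
      (1 / 2) ^ m * (S.sub k i j).diam ≤ δ / 8 →
      (∀ p ∈ L, S.InUnit p ∧ cell k (S.coordX p) = i ∧ cell k (S.coordY p) = j) →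
      L.Pairwise S.ZLt → (L.Pairwise fun p q => δ ≤ dist p q) →
      (L.IsChain fun p q => S.gap p q < (1 / 2) ^ k) →
      DendroOption S.gap S.nodeCentre L o →
      ∃ U, IsQuadtree δ (S.sub k i j) {p | p ∈ L} U ∧ U.compress = o := by
  have hbase : ∀ (k : ℕ) (i j : ℤ) (L : List Plane) (o : Option GTree),
      (S.sub k i j).diam ≤ δ / 8 →
      (∀ p ∈ L, S.InUnit p ∧ cell k (S.coordX p) = i ∧ cell k (S.coordY p) = j) →
      (L.Pairwise fun p q => δ ≤ dist p q) → DendroOption S.gap S.nodeCentre L o →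
      ∃ U, IsQuadtree δ (S.sub k i j) {p | p ∈ L} U ∧ U.compress = o := by
    intro k i j L o hd hL hsep ho
    have hcar : ∀ p ∈ L, p ∈ (S.sub k i j).carrier := by
      intro p hp
      obtain ⟨h1, rfl, rfl⟩ := hL p hp
      exact mem_carrier_sub hS h1 k
    rcases L with _ | ⟨p, _ | ⟨q, L⟩⟩
    · rcases ho with ⟨-, rfl⟩ | ⟨T, rfl, hT⟩
      · refine ⟨.node (S.sub k i j).center [], ?_, rfl⟩
        convert IsQuadtree.base_empty (S.sub k i j) hd using 1
        simp
      · exact absurd rfl hT.ne_nil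
    · rcases ho with ⟨h, -⟩ | ⟨T, rfl, hT⟩
      · simp at h
      · rw [hT.eq_leaf]
        refine ⟨.node (S.sub k i j).center [.leaf p], ?_, rfl⟩
        convert IsQuadtree.base_single (S.sub k i j) p hd using 1
        simp
    -- Two points have distance at least δ, which is more than the diameter δ/8 of the square.
    · exfalso
      have h1 := dist_le_diam (hcar p (by simp)) (hcar q (by simp))
      rw [List.pairwise_cons] at hsep
      have h2 := hsep.1 q (by simp)
      linarith
  induction m with
  | zero =>
    intro k i j L o hd hL _ hsep _ ho
    exact hbase k i j L o (by simpa using hd) hL hsep ho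
  | succ m ih =>
    intro k i j L o hd hL hlt hsep hchain ho
    rcases le_or_gt (S.sub k i j).diam (δ / 8) with hd' | hd'
    · exact hbase k i j L o hd' hL hsep ho
    have hsame : ∀ p ∈ L, ∀ q ∈ L, S.SameCell k p q := fun p hp q hq =>
      ⟨by rw [(hL p hp).2.1, (hL q hq).2.1], by rw [(hL p hp).2.2, (hL q hq).2.2]⟩
    have hrank : L.Pairwise fun p q => S.rank k p ≤ S.rank k q :=
      List.Pairwise.imp_of_mem (fun hp hq h =>
        h.rank_le_rank (hL _ hp).1 (hL _ hq).1 (hsame _ hp _ hq)) hlt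
    have hgap : L.IsChain fun p q => (S.gap p q < (1 / 2) ^ (k + 1) ↔ S.rank k p = S.rank k q) ∧
        S.gap p q ≤ (1 / 2) ^ (k + 1) := by
      rw [List.isChain_iff_getElem] at hchain ⊢
      intro n hn
      have hp := List.getElem_mem (show n < L.length by omega)
      have hq := List.getElem_mem hn
      exact gap_lt_iff_rank_eq (hL _ hp).1 (hL _ hq).1
        (List.pairwise_iff_getElem.1 hlt n (n + 1) _ hn (by omega)) (hsame _ hp _ hq) (hchain n hn)
    obtain ⟨f, hf, hfo⟩ := exists_pieces hL hgap hrank ho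
    have hparity : ∀ p ∈ L, 2 * i ≤ cell (k + 1) (S.coordX p) ∧
        cell (k + 1) (S.coordX p) ≤ 2 * i + 1 ∧ 2 * j ≤ cell (k + 1) (S.coordY p) ∧
        cell (k + 1) (S.coordY p) ≤ 2 * j + 1 := by
      intro p hp
      obtain ⟨-, h1, h2⟩ := hL p hp
      have := cell_eq_div k (S.coordX p)
      have := cell_eq_div k (S.coordY p)
      omega
    -- The vector `![4, 2, 1, 0]` lists the ranks of the quarters in the order of `Square.quarter`;
    -- rank 3 is the centre.
    have hcell : ∀ c : Fin 4, ∀ p ∈ L, S.rank k p = ![4, 2, 1, 0] c →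
        cell (k + 1) (S.coordX p) = 2 * i + ![1, 1, 0, 0] c ∧
        cell (k + 1) (S.coordY p) = 2 * j + ![1, 0, 1, 0] c := by
      intro c p hp hr
      have := hparity p hp
      unfold rank at hr
      fin_cases c <;> simp at hr ⊢ <;> split_ifs at hr <;> omega
    have hinf : ∀ r, L.filter (S.rank k · = r) <:+: L := by
      intro r
      by_cases hr : r ≤ 4
      · have h := eq_flatten_filter_rank (S.rank k) L hrank fun q _ => rank_le k q
        generalize hA : L.filter (S.rank k · = r) = A
        rw [h, ← hA]
        interval_cases r
        · exact ⟨[], _, by simp; rfl⟩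
        · exact ⟨L.filter (S.rank k · = 0), _, by simp; rfl⟩
        · exact ⟨L.filter (S.rank k · = 0) ++ L.filter (S.rank k · = 1), _, by simp; rfl⟩
        · exact ⟨L.filter (S.rank k · = 0) ++ L.filter (S.rank k · = 1) ++
            L.filter (S.rank k · = 2), _, by simp; rfl⟩
        · exact ⟨L.filter (S.rank k · = 0) ++ L.filter (S.rank k · = 1) ++
            L.filter (S.rank k · = 2) ++ L.filter (S.rank k · = 3), [], by simp⟩
      · rw [List.filter_eq_nil_iff.2]
        · exact List.nil_infix
        · intro q _
          have := rank_le (S := S) k q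
          simp only [decide_eq_true_eq]
          omega
    have hrec : ∀ c : Fin 4, ∃ U, IsQuadtree δ ((S.sub k i j).quarter c)
        {p | p ∈ L.filter (S.rank k · = ![4, 2, 1, 0] c)} U ∧ U.compress = f (![4, 2, 1, 0] c) := by
      intro c
      rw [quarter_sub]
      refine ih (k + 1) _ _ _ _ ?_ ?_ (hlt.sublist (hinf _).sublist)
        (hsep.sublist (hinf _).sublist) ?_ (hf _ ?_)
      · rw [diam_sub] at hd ⊢
        rw [pow_succ] at hd ⊢
        linarith
      · intro p hp
        rw [List.mem_filter, decide_eq_true_eq] at hp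
        exact ⟨(hL p hp.1).1, hcell c p hp.1 hp.2⟩
      · refine List.IsChain.imp_of_mem_imp (fun a b ha hb h => ?_) (hgap.infix (hinf _))
        rw [List.mem_filter, decide_eq_true_eq] at ha hb
        exact h.1.2 (by rw [ha.2, hb.2])
      · fin_cases c <;> decide
    choose V hV hVf using hrec
    have hcentre : ∀ p ∈ L, S.rank k p = 3 ↔ p = (S.sub k i j).center := by
      intro p hp
      constructor
      · intro h
        rw [eq_center_of_rank_eq_three hS (hL p hp).1 h, (hL p hp).2.1, (hL p hp).2.2]
      · rintro rfl
        exact rank_center hS k i j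
    have hleaf : GTree.compressAll (centreLeaf (S.sub k i j).center {p | p ∈ L}) =
        (f 3).toList := by
      have h3 := hf 3 (by norm_num)
      by_cases hc : (S.sub k i j).center ∈ L
      · have hA : L.filter (S.rank k · = 3) = [(S.sub k i j).center] := by
          have hlt' := hlt.sublist (hinf 3).sublist
          have hall : ∀ p ∈ L.filter (S.rank k · = 3), p = (S.sub k i j).center := by
            intro p hp
            rw [List.mem_filter, decide_eq_true_eq] at hp
            exact (hcentre p hp.1).1 hp.2
          have hin : (S.sub k i j).center ∈ L.filter (S.rank k · = 3) := by
            rw [List.mem_filter, decide_eq_true_eq]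
            exact ⟨hc, rank_center hS k i j⟩
          generalize L.filter (S.rank k · = 3) = A at *
          rcases A with _ | ⟨p, _ | ⟨q, A⟩⟩
          · simp at hin
          · rw [hall p (by simp)]
          · exfalso
            rw [List.pairwise_cons] at hlt'
            have := hlt'.1 q (by simp)
            rw [hall p (by simp), hall q (by simp)] at this
            exact this.irrefl
        rw [hA] at h3
        rcases h3 with ⟨h, -⟩ | ⟨T, hT, hD⟩
        · simp at h
        · rw [hT, hD.eq_leaf, centreLeaf, if_pos (by exact hc)]
          simp [GTree.compressAll, GTree.compress]
      · have hA : L.filter (S.rank k · = 3) = [] := by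
          rw [List.filter_eq_nil_iff]
          intro p hp
          rw [decide_eq_true_eq, hcentre p hp]
          rintro rfl
          exact hc hp
        rw [hA] at h3
        rcases h3 with ⟨-, h⟩ | ⟨T, hT, hD⟩
        · rw [h, centreLeaf, if_neg (by exact hc)]
          rfl
        · exact absurd rfl hD.ne_nil
    -- The children are listed by rank, so that compression returns the pieces in the order of the
    -- sorted list; the definition of `IsQuadtree` admits any permutation.
    refine ⟨.node (S.sub k i j).center ([V 3, V 2, V 1] ++
      centreLeaf (S.sub k i j).center {p | p ∈ L} ++ [V 0]),
      .step _ _ (fun c => {p | p ∈ L.filter (S.rank k · = ![4, 2, 1, 0] c)}) V _ hd' ?_ ?_ ?_ hV ?_,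
      ?_⟩
    · intro a b hab
      rw [Set.disjoint_left]
      intro p hp hp'
      rw [Set.mem_ofPred_eq, List.mem_filter, decide_eq_true_eq] at hp hp'
      have h := hp.2.symm.trans hp'.2
      revert hab h
      fin_cases a <;> fin_cases b <;> simp
    · ext p
      simp only [Set.mem_iUnion, Set.mem_ofPred_eq, List.mem_filter, decide_eq_true_eq,
        Set.mem_sdiff, Set.mem_singleton_iff]
      constructor
      · rintro ⟨c, hp, hr⟩
        refine ⟨hp, fun h => ?_⟩
        rw [(hcentre p hp).2 h] at hr
        revert hr
        fin_cases c <;> simp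
      · rintro ⟨hp, hne⟩
        rw [← hcentre p hp] at hne
        have := rank_le (S := S) k p
        generalize S.rank k p = r at *
        interval_cases r
        · exact ⟨3, hp, rfl⟩
        · exact ⟨2, hp, rfl⟩
        · exact ⟨1, hp, rfl⟩
        · exact absurd rfl hne
        · exact ⟨0, hp, rfl⟩
    · intro c p hp
      rw [Set.mem_ofPred_eq, List.mem_filter, decide_eq_true_eq] at hp
      obtain ⟨h1, h2⟩ := hcell c p hp.1 hp.2
      rw [quarter_sub, ← h1, ← h2]
      exact mem_carrier_sub hS (hL p hp.1).1 (k + 1)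
    · have : List.ofFn V = [V 0, V 1, V 2, V 3] := by simp [List.ofFn_succ]
      rw [this]
      refine List.Perm.trans (l₂ := centreLeaf (S.sub k i j).center {p | p ∈ L} ++
        ([V 3, V 2, V 1] ++ [V 0])) ?_ (List.Perm.append_left _ ?_)
      · rw [← List.append_assoc]
        exact List.perm_append_comm.append_right _
      · have h : [V 0, V 1, V 2, V 3].reverse = [V 3, V 2, V 1] ++ [V 0] := rfl
        rw [← h]
        exact List.reverse_perm _
    · rw [← hfo]
      simp only [GTree.compress, GTree.compressAll_append, hleaf]
      simp [GTree.compressAll, hVf]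

/-- A tree with the maximal gaps of the sorted points as inner vertices is a compressed version of
the tree for the square. -/
theorem isCompressedQuadtree (hS : S.arm ≠ 0) {L : List Plane} {T : GTree}
    (hL : ∀ p ∈ L, S.InUnit p) (hlt : L.Pairwise S.ZLt) (h2 : 2 ≤ L.length)
    (hT : Dendro S.gap S.nodeCentre L T) : IsCompressedQuadtree S {p | p ∈ L} T := by
  have hne : L.Pairwise fun p q => p ≠ q := hlt.imp fun h => by
    rintro rfl
    exact h.irrefl
  have hfin : {p | p ∈ L}.Finite := L.finite_toSet
  have hnt : {p | p ∈ L}.Nontrivial := by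
    rcases L with _ | ⟨p, _ | ⟨q, L⟩⟩
    · simp at h2
    · simp at h2
    · rw [List.pairwise_cons] at hne
      exact ⟨p, by simp, q, by simp, hne.1 q (by simp)⟩
  have hδ := hfin.infsep_pos_iff_nontrivial.2 hnt
  have hsub : S.sub 0 0 0 = S := by
    simp only [sub, point_eq]
    simp
  -- Choice of the depth at which all squares have diameter at most δ/8; the summand 1 only keeps
  -- the denominator positive.
  obtain ⟨m, hm⟩ := exists_pow_lt_of_lt_one
    (show 0 < {p | p ∈ L}.infsep / 8 / (S.diam + 1) by rw [diam]; positivity)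
    (by norm_num : (1 / 2 : ℝ) < 1)
  have hd : 0 ≤ S.diam := by rw [diam]; positivity
  have hdiam : (1 / 2) ^ m * (S.sub 0 0 0).diam ≤ {p | p ∈ L}.infsep / 8 := by
    rw [hsub]
    rw [lt_div_iff₀ (by linarith)] at hm
    have : (0 : ℝ) < (1 / 2) ^ m := by positivity
    nlinarith
  have hcell : ∀ p ∈ L, S.InUnit p ∧ cell 0 (S.coordX p) = 0 ∧ cell 0 (S.coordY p) = 0 :=
    fun p hp => ⟨hL p hp, cell_zero (hL p hp).1, cell_zero (hL p hp).2.2.1⟩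
  have hsep : L.Pairwise fun p q => {p | p ∈ L}.infsep ≤ dist p q :=
    List.Pairwise.imp_of_mem (fun hp hq h => Set.infsep_le_dist_of_mem hp hq h) hne
  have hchain : L.IsChain fun p q => S.gap p q < (1 / 2) ^ 0 := by
    rw [List.isChain_iff_getElem]
    intro n hn
    obtain ⟨l, hl, -⟩ := gap_spec (hL _ (List.getElem_mem (show n < L.length by omega)))
      (hL _ (List.getElem_mem hn)) (List.pairwise_iff_getElem.1 hlt n (n + 1) _ hn (by omega))
    rw [hl, half_pow_lt_iff]
    omega
  obtain ⟨U, hU, hU'⟩ := exists_isQuadtree hS hδ m 0 0 0 L (some T) hdiam hcell hlt hsep hchain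
    (Or.inr ⟨T, rfl, hT⟩)
  rw [hsub] at hU
  exact ⟨U, hU, hU'⟩

end Square

/-- The compressed version of the tree for a single point is a leaf. -/
theorem isCompressedQuadtree_singleton {S : Square} (hS : S.arm = 0) (p : Plane) :
    IsCompressedQuadtree S {p} (.leaf p) := by
  refine ⟨_, .base_single S p ?_, rfl⟩
  -- Both δ and the diameter are 0, so the recursion stops at the root.
  rw [Set.subsingleton_singleton.infsep_zero, Square.diam, hS]
  simp

/-! ### The program that compares two points

The registers `3`, `4` hold the centre of the current square and `5`, `6` its arm; register `2` holds
the number of points. The registers `20` to `32` are used by the comparisons. -/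

/-- The registers `3` to `6` describe the square `S`. -/
structure Framed (S : Square) (s : State) : Prop where
  centre_x : s.reg 3 = S.center 0
  centre_y : s.reg 4 = S.center 1
  arm_x : s.reg 5 = S.arm 0
  arm_y : s.reg 6 = S.arm 1

/-- The first `R` registers and the memory cells from `A` on are the same in both states. -/
structure Keeps (R A : ℕ) (s s' : State) : Prop where
  reg : ∀ i < R, s'.reg i = s.reg i
  mem : ∀ a, A ≤ a → s'.mem a = s.mem a

theorem Keeps.refl (R A : ℕ) (s : State) : Keeps R A s s := ⟨fun _ _ => rfl, fun _ _ => rfl⟩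

theorem Keeps.trans {R A : ℕ} {s s' s'' : State} (h : Keeps R A s s') (h' : Keeps R A s' s'') :
    Keeps R A s s'' :=
  ⟨fun i hi => (h'.reg i hi).trans (h.reg i hi), fun a ha => (h'.mem a ha).trans (h.mem a ha)⟩

theorem Keeps.mono {R R' A A' : ℕ} {s s' : State} (h : Keeps R A s s') (hR : R' ≤ R)
    (hA : A ≤ A') : Keeps R' A' s s' :=
  ⟨fun i hi => h.reg i (by omega), fun a ha => h.mem a (by omega)⟩

theorem Framed.of_keeps {S : Square} {R A : ℕ} {s s' : State} (hS : Framed S s)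
    (h : Keeps R A s s') (hR : 7 ≤ R) : Framed S s' :=
  ⟨(h.reg 3 (by omega)).trans hS.1, (h.reg 4 (by omega)).trans hS.2,
    (h.reg 5 (by omega)).trans hS.3, (h.reg 6 (by omega)).trans hS.4⟩

theorem natFloor_eq_of_eq_cast {x : ℝ} {a : ℕ} (h : x = a) : ⌊x⌋₊ = a := by
  rw [h, Nat.floor_natCast]

/-- The first normalized coordinate. -/
def exprX (a b : Expr) : Expr :=
  ((a - .reg 3) * .reg 5 + (b - .reg 4) * .reg 6) /
    (.const 2 * (.reg 5 * .reg 5 + .reg 6 * .reg 6)) + .const (1 / 2)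

/-- The second normalized coordinate. -/
def exprY (a b : Expr) : Expr :=
  ((b - .reg 4) * .reg 5 - (a - .reg 3) * .reg 6) /
    (.const 2 * (.reg 5 * .reg 5 + .reg 6 * .reg 6)) + .const (1 / 2)

theorem eval_exprX {S : Square} {s : State} (hS : Framed S s) {a b : Expr} {p : Plane}
    (ha : a.eval s = p 0) (hb : b.eval s = p 1) : (exprX a b).eval s = S.coordX p := by
  simp [exprX, Square.coordX, Expr.eval, hS.1, hS.2, hS.3, hS.4, ha, hb]

theorem eval_exprY {S : Square} {s : State} (hS : Framed S s) {a b : Expr} {p : Plane}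
    (ha : a.eval s = p 0) (hb : b.eval s = p 1) : (exprY a b).eval s = S.coordY p := by
  simp [exprY, Square.coordY, Expr.eval, hS.1, hS.2, hS.3, hS.4, ha, hb]

/-- The power of two whose exponent is minus the index of the first differing digit. -/
def diffPower (a b : Expr) : Expr := .pow2 (.const 0 - .bitDiff a b)

theorem eval_diffPower (s : State) (a b : Expr) :
    (diffPower a b).eval s = (2 : ℝ) ^ ⌊0 - (bitDiff (a.eval s) (b.eval s) : ℝ)⌋ := by
  simp [diffPower, Expr.eval]

/-- Write the value of `sep` for the registers `x` and `y` into the register `out`. -/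
def sepProgram (x y out : ℕ) : Program :=
  .ite (.eq (.reg x) (.reg y)) (.assign out (.const 0))
    (.ite (.or (.le (.const 1) (.reg x)) (.le (.const 1) (.reg y)))
      (.ite (.le (.const 2 - .reg x - .reg y)
          (diffPower (.const 0) (.const 2 - .reg x - .reg y)))
        (.assign out (diffPower (.const 0) (.const 2 - .reg x - .reg y) / .const 2))
        (.assign out (diffPower (.const 0) (.const 2 - .reg x - .reg y))))
      (.assign out (diffPower (.reg x) (.reg y))))

theorem denote_sepProgram (x y out : ℕ) (s : State) :
    (sepProgram x y out).denote s =
      ⟨Function.update s.reg out (sep (s.reg x) (s.reg y)), s.mem⟩ := by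
  simp only [sepProgram, Program.denote_ite, Program.denote_assign, Test.holds_eq, Test.holds_or,
    Test.holds_le, eval_diffPower, Expr.eval_sub, Expr.eval_div, Expr.eval, sep]
  norm_num
  split_ifs <;> rfl

/-- Compute the normalized coordinates of the point in the registers `a`, `b`. -/
def coordProgram (a b x y : ℕ) : Program :=
  .assign x (exprX (.reg a) (.reg b)) ;; .assign y (exprY (.reg a) (.reg b))

/-- Load the points with the numbers in the registers `i`, `j` into the registers `20` to `23`, and
compute their coordinates (`24` to `27`) and the separating sides (`28`, `29`). -/
def loadPair (i j : ℕ) : Program :=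
  .assign 20 (.load (.const 2 * .reg i)) ;; .assign 21 (.load (.const 2 * .reg i + .const 1)) ;;
  .assign 22 (.load (.const 2 * .reg j)) ;; .assign 23 (.load (.const 2 * .reg j + .const 1)) ;;
  coordProgram 20 21 24 25 ;; coordProgram 22 23 26 27 ;;
  sepProgram 24 26 28 ;; sepProgram 25 27 29

/-- The point number `i` in the memory. -/
noncomputable def pointAt (mem : ℕ → ℝ) (i : ℕ) : Plane := !₂[mem (2 * i), mem (2 * i + 1)]

/-- The registers after `loadPair`. -/
structure PairLoaded (S : Square) (p q : Plane) (s : State) : Prop where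
  px : s.reg 20 = p 0
  py : s.reg 21 = p 1
  qx : s.reg 22 = q 0
  qy : s.reg 23 = q 1
  coordXp : s.reg 24 = S.coordX p
  coordYp : s.reg 25 = S.coordY p
  coordXq : s.reg 26 = S.coordX q
  coordYq : s.reg 27 = S.coordY q
  sepX : s.reg 28 = sep (S.coordX p) (S.coordX q)
  sepY : s.reg 29 = sep (S.coordY p) (S.coordY q)

theorem denote_coordProgram {S : Square} {s : State} (hS : Framed S s) {a b x y : ℕ} {p : Plane}
    (ha : s.reg a = p 0) (hb : s.reg b = p 1) (hx : 6 < x) (hxa : a ≠ x) (hxb : b ≠ x) :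
    (coordProgram a b x y).denote s =
      ⟨Function.update (Function.update s.reg x (S.coordX p)) y (S.coordY p), s.mem⟩ := by
  have h1 : (exprX (.reg a) (.reg b)).eval s = S.coordX p := eval_exprX hS ha hb
  simp only [coordProgram, Program.denote_seq, Program.denote_assign, h1]
  rw [eval_exprY (S := S) (p := p)]
  · constructor
    · simp only [Function.update_of_ne (show 3 ≠ x by omega), hS.1]
    · simp only [Function.update_of_ne (show 4 ≠ x by omega), hS.2]
    · simp only [Function.update_of_ne (show 5 ≠ x by omega), hS.3]
    · simp only [Function.update_of_ne (show 6 ≠ x by omega), hS.4]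
  · simp only [Expr.eval, Function.update_of_ne hxa, ha]
  · simp only [Expr.eval, Function.update_of_ne hxb, hb]

theorem loadPair_spec {S : Square} {s : State} (hS : Framed S s) {i j : ℕ} {a b : ℕ}
    (ha : s.reg a = (i : ℝ)) (hb : s.reg b = (j : ℝ)) (hb' : b < 20 ∨ 30 ≤ b) (ha' : a < 20 ∨ 30 ≤ a) :
    PairLoaded S (pointAt s.mem i) (pointAt s.mem j) ((loadPair a b).denote s) ∧
      ((loadPair a b).denote s).mem = s.mem ∧
      ∀ r, r < 20 ∨ 30 ≤ r → ((loadPair a b).denote s).reg r = s.reg r := by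
  have hi : ⌊2 * (i : ℝ)⌋₊ = 2 * i := natFloor_eq_of_eq_cast (by push_cast; ring)
  have hi' : ⌊2 * (i : ℝ) + 1⌋₊ = 2 * i + 1 := natFloor_eq_of_eq_cast (by push_cast; ring)
  have hj : ⌊2 * (j : ℝ)⌋₊ = 2 * j := natFloor_eq_of_eq_cast (by push_cast; ring)
  have hj' : ⌊2 * (j : ℝ) + 1⌋₊ = 2 * j + 1 := natFloor_eq_of_eq_cast (by push_cast; ring)
  set s1 : State := ⟨Function.update (Function.update (Function.update (Function.update s.reg 20
    (s.mem (2 * i))) 21 (s.mem (2 * i + 1))) 22 (s.mem (2 * j))) 23 (s.mem (2 * j + 1)), s.mem⟩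
    with hs1
  have h1 : (loadPair a b).denote s = (coordProgram 20 21 24 25 ;; coordProgram 22 23 26 27 ;;
      sepProgram 24 26 28 ;; sepProgram 25 27 29).denote s1 := by
    have e0 : a ≠ 20 := by omega
    have e1 : b ≠ 20 := by omega
    have e2 : b ≠ 21 := by omega
    have e3 : b ≠ 22 := by omega
    simp [loadPair, Expr.eval, ha, hb, hi, hi', hj, hj', hs1, e0, e1, e2, e3]
  have hS1 : Framed S s1 := by
    constructor <;> simp [hs1, hS.1, hS.2, hS.3, hS.4]
  rw [h1]
  simp only [Program.denote_seq]
  rw [denote_coordProgram (p := pointAt s.mem i) hS1 (by simp [hs1, pointAt])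
    (by simp [hs1, pointAt]) (by norm_num) (by norm_num) (by norm_num)]
  rw [denote_coordProgram (S := S) (p := pointAt s.mem j) ?_ (by simp [hs1, pointAt])
    (by simp [hs1, pointAt]) (by norm_num) (by norm_num) (by norm_num)]
  · simp only [denote_sepProgram]
    refine ⟨?_, rfl, ?_⟩
    · constructor <;> simp [hs1] <;> simp [pointAt]
    · intro r hr
      have : ∀ m, 20 ≤ m → m < 30 → r ≠ m := by omega
      simp [hs1, this]
  · constructor <;> simp [hS1.1, hS1.2, hS1.3, hS1.4]

/-- The test `ZLe` for the loaded pair. -/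
def zleTest : Test :=
  .or (.and (.le (.reg 29) (.reg 28)) (.le (.reg 24) (.reg 26)))
    (.and (.not (.le (.reg 29) (.reg 28))) (.le (.reg 25) (.reg 27)))

theorem PairLoaded.holds_zleTest {S : Square} {p q : Plane} {s : State} (h : PairLoaded S p q s) :
    zleTest.Holds s ↔ S.ZLe p q := by
  simp only [zleTest, Test.holds_or, Test.holds_and, Test.holds_not, Test.holds_le, Expr.eval,
    h.coordXp, h.coordYp, h.coordXq, h.coordYq, h.sepX, h.sepY, Square.ZLe]
  split_ifs with h1 <;> simp [h1]

/-! ### Sorting -/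

/-- The memory cells from `base` on hold the coordinates of the points of the list. -/
def ArrayAt (mem : ℕ → ℝ) (base : ℕ) (L : List Plane) : Prop :=
  ∀ (i : ℕ) (h : i < L.length), mem (base + 2 * i) = L[i] 0 ∧ mem (base + 2 * i + 1) = L[i] 1

theorem ArrayAt.congr {mem mem' : ℕ → ℝ} {base : ℕ} {L : List Plane} (h : ArrayAt mem base L)
    (hm : ∀ a, base ≤ a → a < base + 2 * L.length → mem' a = mem a) : ArrayAt mem' base L := by
  intro i hi
  rw [hm _ (by omega) (by omega), hm _ (by omega) (by omega)]
  exact h i hi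

theorem ArrayAt.concat {mem : ℕ → ℝ} {base : ℕ} {L : List Plane} (h : ArrayAt mem base L)
    (p : Plane) : ArrayAt (Function.update (Function.update mem (base + 2 * L.length) (p 0))
      (base + 2 * L.length + 1) (p 1)) base (L ++ [p]) := by
  intro i hi
  rw [List.length_append, List.length_singleton] at hi
  rcases (Nat.lt_succ_iff.1 hi).lt_or_eq with h1 | rfl
  · rw [List.getElem_append_left h1, Function.update_of_ne (by omega),
      Function.update_of_ne (by omega), Function.update_of_ne (by omega),
      Function.update_of_ne (by omega)]
    exact h i h1
  · rw [List.getElem_concat_length (by rfl)]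
    refine ⟨?_, Function.update_self _ _ _⟩
    rw [Function.update_of_ne (by omega), Function.update_self]

theorem ArrayAt.pointAt {mem : ℕ → ℝ} {L : List Plane} (h : ArrayAt mem 0 L) {i : ℕ}
    (hi : i < L.length) : pointAt mem i = L[i] := by
  have := h i hi
  simp only [zero_add] at this
  ext l
  fin_cases l
  · simp [SteinerCover.pointAt, this.1]
  · simp [SteinerCover.pointAt, this.2]

/-- The entries of a list with the numbers from `i` to `j - 1`. -/
def segment {α : Type*} (L : List α) (i j : ℕ) : List α := (L.take j).drop i

theorem segment_eq_cons {α : Type*} {L : List α} {i j : ℕ} (h : i < j) (hj : j ≤ L.length) :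
    segment L i j = L[i]'(by omega) :: segment L (i + 1) j := by
  have hi : i < (L.take j).length := by rw [List.length_take]; omega
  rw [segment, List.drop_eq_getElem_cons hi, List.getElem_take]
  rfl

theorem segment_eq_nil {α : Type*} {L : List α} {i j : ℕ} (h : j ≤ i) : segment L i j = [] := by
  rw [segment, List.drop_eq_nil_iff, List.length_take]
  omega

theorem length_segment {α : Type*} {L : List α} {i j : ℕ} (hj : j ≤ L.length) :
    (segment L i j).length = j - i := by
  rw [segment, List.length_drop, List.length_take, min_eq_left hj]

theorem take_append_segment {α : Type*} (L : List α) {i j : ℕ} (h : i ≤ j) :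
    L.take i ++ segment L i j = L.take j := by
  have : L.take i = (L.take j).take i := by rw [List.take_take, min_eq_left h]
  rw [segment, this, List.take_append_drop]

theorem segment_append_segment {α : Type*} (L : List α) {i j k : ℕ} (h : i ≤ j) (h' : j ≤ k) :
    segment L i j ++ segment L j k = segment L i k := by
  have h1 : L.take i ++ (segment L i j ++ segment L j k) = L.take i ++ segment L i k := by
    rw [← List.append_assoc, take_append_segment L h, take_append_segment L h',
      take_append_segment L (h.trans h')]
  exact List.append_cancel_left h1

/-- The usual argument for merging, relativized to a predicate on the entries because `Square.ZLe`
is known to be transitive only for points in the unit square. -/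
theorem pairwise_merge_of_mem {α : Type*} {R : α → α → Prop} {le : α → α → Bool} {P : α → Prop}
    (hle : ∀ a b, le a b = true ↔ R a b)
    (htrans : ∀ a b c, P a → P b → P c → R a b → R b c → R a c) (htotal : ∀ a b, R a b ∨ R b a) :
    ∀ l₁ l₂ : List α, (∀ a ∈ l₁, P a) → (∀ a ∈ l₂, P a) → l₁.Pairwise R → l₂.Pairwise R →
      (l₁.merge l₂ le).Pairwise R
  | [], l₂, _, _, _, h₂ => by simpa using h₂
  | a :: l₁, [], _, _, h₁, _ => by simpa using h₁
  | a :: l₁, b :: l₂, hP₁, hP₂, h₁, h₂ => by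
    have hmem : ∀ {l l' : List α} {c : α}, c ∈ l.merge l' le → c ∈ l ∨ c ∈ l' := by
      intro l l' c hc
      rwa [(List.merge_perm_append le).mem_iff, List.mem_append] at hc
    rw [List.cons_merge_cons]
    have ha := hP₁ a (by simp)
    have hb := hP₂ b (by simp)
    rw [List.pairwise_cons] at h₁ h₂
    split_ifs with h
    · rw [hle] at h
      refine List.pairwise_cons.2 ⟨fun c hc => ?_, pairwise_merge_of_mem hle htrans htotal l₁
        (b :: l₂) (fun c hc => hP₁ c (by simp [hc])) hP₂ h₁.2 (List.pairwise_cons.2 h₂)⟩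
      rcases hmem hc with hc | hc
      · exact h₁.1 c hc
      · rcases List.mem_cons.1 hc with rfl | hc'
        · exact h
        · exact htrans a b c ha hb (hP₂ c hc) h (h₂.1 c hc')
    · rw [hle] at h
      have h := (htotal a b).resolve_left h
      refine List.pairwise_cons.2 ⟨fun c hc => ?_, pairwise_merge_of_mem hle htrans htotal
        (a :: l₁) l₂ hP₁ (fun c hc => hP₂ c (by simp [hc])) (List.pairwise_cons.2 h₁) h₂.2⟩
      rcases hmem hc with hc | hc
      · rcases List.mem_cons.1 hc with rfl | hc'
        · exact h
        · exact htrans b a c hb ha (hP₁ c hc) h (h₁.1 c hc')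
      · exact h₂.1 c hc
  termination_by l₁ l₂ => l₁.length + l₂.length

open Classical in
/-- The comparison `ZLe` as a Boolean function. -/
noncomputable def zle (S : Square) (p q : Plane) : Bool := decide (S.ZLe p q)

theorem zle_eq_true_iff {S : Square} (p q : Plane) : zle S p q = true ↔ S.ZLe p q := by
  simp [zle]

/-- One step of the merging of two blocks. -/
def mergeBody : Program :=
  loadPair 12 13 ;;
  .ite (.and (.lt (.reg 12) (.reg 10)) (.or (.le (.reg 11) (.reg 13)) zleTest))
    (.store (.const 2 * (.reg 2 + .reg 14)) (.reg 20) ;;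
      .store (.const 2 * (.reg 2 + .reg 14) + .const 1) (.reg 21) ;;
      .assign 12 (.reg 12 + .const 1))
    (.store (.const 2 * (.reg 2 + .reg 14)) (.reg 22) ;;
      .store (.const 2 * (.reg 2 + .reg 14) + .const 1) (.reg 23) ;;
      .assign 13 (.reg 13 + .const 1)) ;;
  .assign 14 (.reg 14 + .const 1)

/-- The invariant of the merging loop: the points `M` are already stored. -/
structure MergeInv (S : Square) (L M : List Plane) (i m j hi k : ℕ) (s : State) : Prop where
  framed : Framed S s
  reg2 : s.reg 2 = L.length
  reg10 : s.reg 10 = m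
  reg11 : s.reg 11 = hi
  reg12 : s.reg 12 = i
  reg13 : s.reg 13 = j
  reg14 : s.reg 14 = k
  source : ArrayAt s.mem 0 L
  target : ArrayAt s.mem (2 * L.length) M
  length : M.length = k

/-- One round emits the head of the `List.merge` of what is left of the two blocks, and the
remainders merge to its tail. -/
theorem mergeBody_spec {S : Square} {L M : List Plane} {i m j hi k : ℕ} {s : State}
    (h : MergeInv S L M i m j hi k s) (hij : i < m ∨ j < hi) (hm : m ≤ L.length)
    (hhi : hi ≤ L.length) (hk : k < L.length) :
    ∃ p i' j', MergeInv S L (M ++ [p]) i' m j' hi (k + 1) (mergeBody.denote s) ∧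
      (segment L i m).merge (segment L j hi) (zle S) =
        p :: (segment L i' m).merge (segment L j' hi) (zle S) ∧
      (i' = i + 1 ∧ j' = j ∧ i < m ∨ i' = i ∧ j' = j + 1 ∧ j < hi) ∧
      Keeps 12 (4 * L.length) s (mergeBody.denote s) := by
  obtain ⟨hp, hmem, hreg⟩ := loadPair_spec h.framed h.reg12 h.reg13 (by norm_num) (by norm_num)
  set s1 := (loadPair 12 13).denote s with hs1
  have haddr : ⌊2 * ((L.length : ℝ) + k)⌋₊ = 2 * L.length + 2 * k :=
    natFloor_eq_of_eq_cast (by push_cast; ring)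
  have haddr' : ⌊2 * ((L.length : ℝ) + k) + 1⌋₊ = 2 * L.length + 2 * k + 1 :=
    natFloor_eq_of_eq_cast (by push_cast; ring)
  -- The pair is loaded even if one block is exhausted; in that case the index comparisons settle
  -- the test, whatever the loaded values are.
  have htest : (Test.and (.lt (.reg 12) (.reg 10)) (.or (.le (.reg 11) (.reg 13)) zleTest)).Holds s1
      ↔ i < m ∧ (hi ≤ j ∨ S.ZLe (pointAt s.mem i) (pointAt s.mem j)) := by
    simp only [Test.holds_and, Test.holds_or, Test.holds_lt, Test.holds_le, Expr.eval,
      hp.holds_zleTest, hreg 12 (by norm_num), hreg 10 (by norm_num), hreg 11 (by norm_num),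
      hreg 13 (by norm_num), h.reg10, h.reg11, h.reg12, h.reg13, Nat.cast_lt, Nat.cast_le]
  have hfr : ∀ (q : Plane) (r : ℕ) (v : ℝ), 12 ≤ r →
      Keeps 12 (4 * L.length) s ⟨Function.update (Function.update s1.reg r v) 14 (k + 1),
        Function.update (Function.update s1.mem (2 * L.length + 2 * k) (q 0))
          (2 * L.length + 2 * k + 1) (q 1)⟩ := by
    intro q r v hr
    constructor
    · intro l hl
      simp only [Function.update_of_ne (show l ≠ 14 by omega),
        Function.update_of_ne (show l ≠ r by omega), hreg l (by omega)]
    · intro a ha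
      simp only [Function.update_of_ne (show a ≠ 2 * L.length + 2 * k + 1 by omega),
        Function.update_of_ne (show a ≠ 2 * L.length + 2 * k by omega), hmem]
  have hsrc : ∀ q : Plane, ArrayAt (Function.update (Function.update s1.mem
      (2 * L.length + 2 * k) (q 0)) (2 * L.length + 2 * k + 1) (q 1)) 0 L := by
    intro q
    refine h.source.congr fun a _ ha => ?_
    rw [Function.update_of_ne (by omega), Function.update_of_ne (by omega), hmem]
  have htgt : ∀ q : Plane, ArrayAt (Function.update (Function.update s1.mem
      (2 * L.length + 2 * k) (q 0)) (2 * L.length + 2 * k + 1) (q 1)) (2 * L.length)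
      (M ++ [q]) := by
    intro q
    rw [← h.length, hmem]
    exact h.target.concat q
  by_cases ht : i < m ∧ (hi ≤ j ∨ S.ZLe (pointAt s.mem i) (pointAt s.mem j))
  · have hpi : pointAt s.mem i = L[i] := h.source.pointAt (by omega)
    have hden : mergeBody.denote s = ⟨Function.update (Function.update s1.reg 12 (i + 1)) 14 (k + 1),
        Function.update (Function.update s1.mem (2 * L.length + 2 * k) (L[i] 0))
          (2 * L.length + 2 * k + 1) (L[i] 1)⟩ := by
      rw [mergeBody, Program.denote_seq, ← hs1, Program.denote_seq, Program.denote_ite,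
        if_pos (htest.2 ht)]
      simp [Expr.eval, hreg, h.reg2, h.reg14, h.reg12, haddr, haddr', hp.px, hp.py, hpi]
    have hkeep := hfr L[i] 12 (i + 1) le_rfl
    rw [← hden] at hkeep
    refine ⟨L[i], i + 1, j, ?_, ?_, Or.inl ⟨rfl, rfl, ht.1⟩, hkeep⟩
    · refine ⟨h.framed.of_keeps hkeep (by norm_num), ?_, ?_, ?_, ?_, ?_, ?_, ?_, ?_, ?_⟩
      · rw [hkeep.reg 2 (by norm_num), h.reg2]
      · rw [hkeep.reg 10 (by norm_num), h.reg10]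
      · rw [hkeep.reg 11 (by norm_num), h.reg11]
      · simp [hden]
      · simp [hden, hreg, h.reg13]
      · simp [hden]
      · rw [hden]; exact hsrc _
      · rw [hden]; exact htgt _
      · simp [h.length]
    · rw [segment_eq_cons ht.1 hm]
      rcases lt_or_ge j hi with hj | hj
      · rw [segment_eq_cons hj hhi, List.cons_merge_cons, if_pos]
        rw [zle_eq_true_iff]
        have := ht.2.resolve_left (by omega)
        rwa [hpi, h.source.pointAt (by omega)] at this
      · rw [segment_eq_nil hj]
        simp
  · have hj : j < hi := by
      by_contra hj
      exact ht ⟨hij.resolve_right hj, Or.inl (by omega)⟩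
    have hpj : pointAt s.mem j = L[j] := h.source.pointAt (by omega)
    have hden : mergeBody.denote s = ⟨Function.update (Function.update s1.reg 13 (j + 1)) 14 (k + 1),
        Function.update (Function.update s1.mem (2 * L.length + 2 * k) (L[j] 0))
          (2 * L.length + 2 * k + 1) (L[j] 1)⟩ := by
      rw [mergeBody, Program.denote_seq, ← hs1, Program.denote_seq, Program.denote_ite,
        if_neg (mt htest.1 ht)]
      simp [Expr.eval, hreg, h.reg2, h.reg14, h.reg13, haddr, haddr', hp.qx, hp.qy, hpj]
    have hkeep := hfr L[j] 13 (j + 1) (by norm_num)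
    rw [← hden] at hkeep
    refine ⟨L[j], i, j + 1, ?_, ?_, Or.inr ⟨rfl, rfl, hj⟩, hkeep⟩
    · refine ⟨h.framed.of_keeps hkeep (by norm_num), ?_, ?_, ?_, ?_, ?_, ?_, ?_, ?_, ?_⟩
      · rw [hkeep.reg 2 (by norm_num), h.reg2]
      · rw [hkeep.reg 10 (by norm_num), h.reg10]
      · rw [hkeep.reg 11 (by norm_num), h.reg11]
      · simp [hden, hreg, h.reg12]
      · simp [hden]
      · simp [hden]
      · rw [hden]; exact hsrc _
      · rw [hden]; exact htgt _
      · simp [h.length]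
    · rw [segment_eq_cons hj hhi]
      rcases lt_or_ge i m with hi' | hi'
      · rw [segment_eq_cons hi' hm, List.cons_merge_cons, if_neg]
        rw [zle_eq_true_iff]
        intro hle
        refine ht ⟨hi', Or.inr ?_⟩
        rwa [hpj, h.source.pointAt (by omega)]
      · rw [segment_eq_nil hi']
        simp

/-- The merging of two adjacent blocks. -/
def mergeLoop : Program := .loop (.lt (.reg 14) (.reg 11)) mergeBody

/-- The number of steps for one round of the merging loop. -/
def mergeCost : ℕ := (Test.lt (.reg 14) (.reg 11)).cost + 1 + mergeBody.size

/-- The output so far, followed by the merge of the remainders, never changes. The relation i + j =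
m + k ties the output position to the two indices, so the output is full exactly when both blocks
are used up. -/
theorem runs_mergeLoop {S : Square} {L M : List Plane} {lo m hi : ℕ} {s : State}
    (h : MergeInv S L M lo m m hi lo s) (hlm : lo ≤ m) (hmh : m ≤ hi) (hhi : hi ≤ L.length) :
    ∃ s', Runs mergeLoop s s' (mergeCost * (hi - lo) + mergeCost) ∧
      Keeps 12 (4 * L.length) s s' ∧ ArrayAt s'.mem 0 L ∧
      ArrayAt s'.mem (2 * L.length)
        (M ++ (segment L lo m).merge (segment L m hi) (zle S)) := by
  obtain ⟨s', φ', t, hrun, ⟨i, j, k, M', hM, hk, hle, hi', hj', hmerge, hkeep, -⟩, hn, ht⟩ :=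
    runs_loop (t := .lt (.reg 14) (.reg 11)) (c := mergeBody)
    (fun s' φ => ∃ i j k M', MergeInv S L M' i m j hi k s' ∧ i + j = m + k ∧ k ≤ hi ∧ i ≤ m ∧ j ≤ hi ∧
      M' ++ (segment L i m).merge (segment L j hi) (zle S) =
        M ++ (segment L lo m).merge (segment L m hi) (zle S) ∧
      Keeps 12 (4 * L.length) s s' ∧ φ = mergeCost * (hi - k))
    (by
      rintro s1 φ ⟨i, j, k, M', hM, hk, hle, hi', hj', hmerge, hkeep, rfl⟩ ht
      have hkh : k < hi := by
        simpa only [Test.holds_lt, Expr.eval, hM.reg14, hM.reg11, Nat.cast_lt] using ht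
      obtain ⟨p, i', j', hM', hseg, hstep, hkeep'⟩ :=
        mergeBody_spec hM (by omega) (by omega) hhi (by omega)
      refine ⟨_, _, _, runs_denote mergeBody rfl s1, ⟨i', j', k + 1, _, hM', by omega, by omega,
        by omega, by omega, ?_, hkeep.trans hkeep', rfl⟩, ?_⟩
      · rw [← hmerge, hseg, List.append_assoc]
        rfl
      · rw [show hi - k = hi - (k + 1) + 1 by omega, mul_add, mul_one, mergeCost]
        omega)
    s (mergeCost * (hi - lo))
    ⟨lo, m, lo, M, h, by omega, by omega, hlm, hmh, rfl, .refl _ _ _, rfl⟩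
  have hkh : ¬ k < hi := by
    simpa only [Test.holds_lt, Expr.eval, hM.reg14, hM.reg11, Nat.cast_lt] using hn
  refine ⟨s', hrun.mono ?_, hkeep, hM.source, ?_⟩
  · unfold mergeCost at *
    omega
  · rw [← hmerge, segment_eq_nil (by omega), segment_eq_nil (by omega)]
    simpa using hM.target

-- Merge passes with blocks of doubling length

/-- The blocks of length `w` are sorted. -/
def BlockSorted (S : Square) (w : ℕ) (L : List Plane) : Prop :=
  ∀ a, (segment L (a * w) (a * w + w)).Pairwise S.ZLe

theorem BlockSorted.append {S : Square} {w : ℕ} {M N : List Plane} (hM : BlockSorted S w M)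
    (hw : w ∣ M.length) (hN : N.Pairwise S.ZLe) (hNw : N.length ≤ w) :
    BlockSorted S w (M ++ N) := by
  obtain ⟨b, hb⟩ := hw
  intro a
  rcases lt_trichotomy a b with h | rfl | h
  · have : a * w + w ≤ M.length := by
      rw [hb]
      calc a * w + w = w * (a + 1) := by ring
        _ ≤ w * b := Nat.mul_le_mul_left _ h
    rw [segment, List.take_append_of_le_length this]
    exact hM a
  · have : a * w = M.length := by rw [hb, mul_comm]
    rw [this, segment, List.take_length_add_append, List.drop_left, List.take_of_length_le hNw]
    exact hN
  · have : (M ++ N).length ≤ a * w := by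
      rw [List.length_append, hb]
      calc w * b + N.length ≤ w * (b + 1) := by rw [mul_add]; omega
        _ ≤ w * a := Nat.mul_le_mul_left _ h
        _ = a * w := mul_comm _ _
    rw [segment, List.drop_eq_nil_iff.2]
    · exact .nil
    · rw [List.length_take]
      omega

theorem BlockSorted.pairwise_segment {S : Square} {w : ℕ} {L : List Plane} (h : BlockSorted S w L)
    {lo hi : ℕ} (hlo : w ∣ lo) (hhi : hi ≤ lo + w) : (segment L lo hi).Pairwise S.ZLe := by
  obtain ⟨a, rfl⟩ := hlo
  have h1 := h a
  rw [mul_comm] at hhi ⊢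
  refine h1.sublist ?_
  rw [segment, segment, show hi = min hi (a * w + w) by omega, ← List.take_take]
  exact (List.take_sublist _ _).drop _

/-- Write the minimum of the value of `e` and the number of points into the register `out`. -/
def minProgram (e : Expr) (out : ℕ) : Program :=
  .assign out e ;; .ite (.lt (.reg 2) (.reg out)) (.assign out (.reg 2)) .skip

theorem denote_minProgram (e : Expr) (out : ℕ) (hout : 2 ≠ out) (s : State) :
    (minProgram e out).denote s =
      ⟨Function.update s.reg out (min (e.eval s) (s.reg 2)), s.mem⟩ := by
  simp only [minProgram, Program.denote_seq, Program.denote_assign, Program.denote_ite,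
    Program.denote_skip, Test.holds_lt, Expr.eval, Function.update_self,
    Function.update_of_ne hout]
  split_ifs with h
  · rw [min_eq_right h.le, Function.update_idem]
  · rw [min_eq_left (not_lt.1 h)]

/-- The preparation of the merging of two blocks. -/
def passSetup : Program :=
  .assign 12 (.reg 9) ;; minProgram (.reg 9 + .reg 8) 10 ;; .assign 13 (.reg 10) ;;
  minProgram (.reg 9 + .const 2 * .reg 8) 11 ;; .assign 14 (.reg 9)

/-- The merging of the next two blocks. -/
def passBody : Program := passSetup ;; mergeLoop ;; .assign 9 (.reg 11)

/-- The merging of all pairs of adjacent blocks. -/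
def passLoop : Program := .loop (.lt (.reg 9) (.reg 2)) passBody

theorem passSetup_spec {S : Square} {L M : List Plane} {lo w : ℕ} {s : State} (hS : Framed S s)
    (h2 : s.reg 2 = L.length) (h8 : s.reg 8 = w) (h9 : s.reg 9 = lo) (hL : ArrayAt s.mem 0 L)
    (hM : ArrayAt s.mem (2 * L.length) M) (hlen : M.length = lo) :
    MergeInv S L M lo (min (lo + w) L.length) (min (lo + w) L.length)
      (min (lo + 2 * w) L.length) lo (passSetup.denote s) ∧
      Keeps 10 0 s (passSetup.denote s) := by
  have h : passSetup.denote s = ⟨Function.update (Function.update (Function.update (Function.update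
      (Function.update s.reg 12 lo) 10 ((min (lo + w) L.length : ℕ) : ℝ)) 13
      ((min (lo + w) L.length : ℕ) : ℝ)) 11 ((min (lo + 2 * w) L.length : ℕ) : ℝ)) 14 lo, s.mem⟩ := by
    simp [passSetup, denote_minProgram, Expr.eval, h2, h8, h9]
  rw [h]
  have hkeep : Keeps 10 0 s ⟨Function.update (Function.update (Function.update (Function.update
      (Function.update s.reg 12 lo) 10 ((min (lo + w) L.length : ℕ) : ℝ)) 13
      ((min (lo + w) L.length : ℕ) : ℝ)) 11 ((min (lo + 2 * w) L.length : ℕ) : ℝ)) 14 lo, s.mem⟩ := by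
    refine ⟨fun r hr => ?_, fun _ _ => rfl⟩
    have : ∀ m, 10 ≤ m → r ≠ m := by omega
    simp [this]
  refine ⟨⟨hS.of_keeps hkeep (by norm_num), ?_, ?_, ?_, ?_, ?_, ?_, hL, hM, hlen⟩, hkeep⟩ <;>
    simp [h2]

/-- The number of steps for the merging of two blocks, per point. -/
def passCost : ℕ :=
  (Test.lt (.reg 9) (.reg 2)).cost + 1 + passSetup.size + 2 * mergeCost +
    (Program.assign 9 (.reg 11)).size

theorem passBody_spec {S : Square} {L M : List Plane} {lo w : ℕ} {s : State} (hS : Framed S s)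
    (hu : ∀ p ∈ L, S.InUnit p)
    (h2 : s.reg 2 = L.length) (h8 : s.reg 8 = w) (h9 : s.reg 9 = lo) (hL : ArrayAt s.mem 0 L)
    (hM : ArrayAt s.mem (2 * L.length) M) (hlen : M.length = lo) (hlo : 2 * w ∣ lo) (hw : 0 < w)
    (hsorted : BlockSorted S w L) (hlt : lo < L.length) (hMs : BlockSorted S (2 * w) M)
    (hMp : M.Perm (L.take lo)) :
    ∃ s' M', Runs passBody s s' (passSetup.size + (mergeCost * (min (lo + 2 * w) L.length - lo) +
        mergeCost + (Program.assign 9 (.reg 11)).size)) ∧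
      s'.reg 9 = (min (lo + 2 * w) L.length : ℕ) ∧ Keeps 9 (4 * L.length) s s' ∧
      ArrayAt s'.mem 0 L ∧ ArrayAt s'.mem (2 * L.length) M' ∧
      M'.length = min (lo + 2 * w) L.length ∧ BlockSorted S (2 * w) M' ∧
      M'.Perm (L.take (min (lo + 2 * w) L.length)) := by
  obtain ⟨hinv, hkeep⟩ := passSetup_spec hS h2 h8 h9 hL hM hlen
  obtain ⟨s1, hrun, hkeep1, hL1, hM1⟩ := runs_mergeLoop hinv (by omega) (by omega) (by omega)
  have hlen' : ((segment L lo (min (lo + w) L.length)).merge (segment L (min (lo + w) L.length)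
      (min (lo + 2 * w) L.length)) (zle S)).length = min (lo + 2 * w) L.length - lo := by
    rw [List.length_merge, length_segment (by omega), length_segment (by omega)]
    omega
  refine ⟨_, _, (runs_denote _ rfl s).seq (hrun.seq (runs_denote _ rfl s1)), ?_, ?_, hL1, hM1,
    ?_, ?_, ?_⟩
  rotate_left 3
  · refine hMs.append (by rwa [hlen]) ?_ (by omega)
    have hd : w ∣ lo := (Dvd.intro_left 2 rfl).trans hlo
    refine pairwise_merge_of_mem (P := S.InUnit) zle_eq_true_iff
      (fun a b c ha hb hc h h' => h.trans ha hb hc h') Square.ZLe.total _ _ ?_ ?_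
      (hsorted.pairwise_segment hd (by omega)) ?_
    · exact fun p hp => hu p (List.mem_of_mem_take (List.mem_of_mem_drop hp))
    · exact fun p hp => hu p (List.mem_of_mem_take (List.mem_of_mem_drop hp))
    -- The second block is empty if the list ends within the first one.
    · rcases le_or_gt L.length (lo + w) with h | h
      · rw [segment_eq_nil (by omega)]
        exact .nil
      · rw [min_eq_left h.le]
        exact hsorted.pairwise_segment (hd.add (dvd_refl w)) (by omega)
  · rw [← take_append_segment L (show lo ≤ min (lo + 2 * w) L.length by omega)]
    refine hMp.append ((List.merge_perm_append _).trans ?_)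
    rw [segment_append_segment L (by omega) (by omega)]
  · simp [Expr.eval, hkeep1.reg 11 (by norm_num), hinv.reg11]
  · refine ((hkeep.mono (by norm_num) (by omega)).trans (hkeep1.mono (by norm_num) le_rfl)).trans
      ⟨fun r hr => ?_, fun _ _ => rfl⟩
    simp [show r ≠ 9 by omega]
  · rw [List.length_append, hlen', hlen]
    omega

/-- The start `lo` of the next pair of blocks is a multiple of 2w until the last pair, which may be
shorter and after which `lo` is the length of the list. -/
theorem runs_passLoop {S : Square} {L : List Plane} {w : ℕ} {s : State} (hS : Framed S s)
    (hu : ∀ p ∈ L, S.InUnit p)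
    (h2 : s.reg 2 = L.length) (h8 : s.reg 8 = w) (h9 : s.reg 9 = 0) (hL : ArrayAt s.mem 0 L)
    (hw : 0 < w) (hsorted : BlockSorted S w L) :
    ∃ s' M, Runs passLoop s s' (passCost * (L.length + 1)) ∧ Keeps 9 (4 * L.length) s s' ∧
      ArrayAt s'.mem (2 * L.length) M ∧ BlockSorted S (2 * w) M ∧ M.Perm L := by
  obtain ⟨s', φ', t, hrun, ⟨lo, M, h9', hlo, hle, hL', hM, hlen, hMs, hMp, hkeep, -⟩, hn, ht⟩ :=
    runs_loop (t := .lt (.reg 9) (.reg 2)) (c := passBody)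
    (fun s' φ => ∃ (lo : ℕ) (M : List Plane), s'.reg 9 = lo ∧ (2 * w ∣ lo ∨ lo = L.length) ∧
      lo ≤ L.length ∧ ArrayAt s'.mem 0 L ∧ ArrayAt s'.mem (2 * L.length) M ∧ M.length = lo ∧
      BlockSorted S (2 * w) M ∧ M.Perm (L.take lo) ∧ Keeps 9 (4 * L.length) s s' ∧
      φ = passCost * (L.length - lo))
    (by
      rintro s1 φ ⟨lo, M, h9', hlo, hle, hL', hM, hlen, hMs, hMp, hkeep, rfl⟩ ht
      have hlt : lo < L.length := by
        simpa only [Test.holds_lt, Expr.eval, h9', hkeep.reg 2 (by norm_num), h2, Nat.cast_lt]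
          using ht
      have hlo' : 2 * w ∣ lo := hlo.resolve_right (by omega)
      obtain ⟨s2, M', hrun, h9'', hkeep', hL'', hM', hlen', hMs', hMp'⟩ :=
        passBody_spec (hS.of_keeps hkeep (by norm_num)) hu
          ((hkeep.reg 2 (by norm_num)).trans h2) ((hkeep.reg 8 (by norm_num)).trans h8) h9' hL' hM
          hlen hlo' hw hsorted hlt hMs hMp
      refine ⟨s2, _, _, hrun, ⟨min (lo + 2 * w) L.length, M', h9'', ?_, min_le_right _ _, hL'', hM',
        hlen', hMs', hMp', hkeep.trans hkeep', rfl⟩, ?_⟩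
      · rcases le_total (lo + 2 * w) L.length with h | h
        · rw [min_eq_left h]
          exact Or.inl (hlo'.add (dvd_refl _))
        · exact Or.inr (min_eq_right h)
      · generalize hhi : min (lo + 2 * w) L.length = hi
        obtain ⟨d, hd⟩ : ∃ d, hi = lo + (d + 1) := ⟨hi - lo - 1, by omega⟩
        have h1 : L.length - lo = L.length - hi + (d + 1) := by omega
        rw [h1, mul_add passCost, show hi - lo = d + 1 by omega]
        -- The fixed cost of a pair of blocks is charged to its d + 1 points, of which there is at
        -- least one.
        have h3 : mergeCost * (d + 1) + mergeCost ≤ 2 * mergeCost * (d + 1) := by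
          have : mergeCost ≤ mergeCost * (d + 1) := Nat.le_mul_of_pos_right _ (by omega)
          rw [mul_assoc]
          omega
        have h4 : passCost * (d + 1) = 2 * mergeCost * (d + 1) +
            ((Test.lt (.reg 9) (.reg 2)).cost + 1 + passSetup.size +
              (Program.assign 9 (.reg 11)).size) * (d + 1) := by
          unfold passCost; ring
        have h5 := Nat.le_mul_of_pos_right ((Test.lt (.reg 9) (.reg 2)).cost + 1 + passSetup.size +
              (Program.assign 9 (.reg 11)).size) (show 0 < d + 1 by omega)
        omega)
    s (passCost * L.length)
    ⟨0, [], by simpa using h9, Or.inl (dvd_zero _), by omega, hL, fun i hi => by simp at hi, rfl,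
      fun a => by simp [segment], by simp, .refl _ _ _, rfl⟩
  have hlo : lo = L.length := by
    have : ¬ lo < L.length := by
      simpa only [Test.holds_lt, Expr.eval, h9', hkeep.reg 2 (by norm_num), h2, Nat.cast_lt]
        using hn
    omega
  refine ⟨s', M, hrun.mono ?_, hkeep, hM, hMs, ?_⟩
  · rw [mul_add, mul_one]
    have : (Test.lt (.reg 9) (.reg 2)).cost + 1 ≤ passCost := by unfold passCost; omega
    omega
  · rwa [hlo, List.take_length] at hMp

/-- Copy the merged blocks back. -/
def copyBody : Program :=
  .store (.reg 12) (.load (.const 2 * .reg 2 + .reg 12)) ;; .assign 12 (.reg 12 + .const 1)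

/-- Copy all merged blocks back. -/
def copyLoop : Program := .loop (.lt (.reg 12) (.const 2 * .reg 2)) copyBody

/-- The number of steps for one round of the copying loop. -/
def copyCost : ℕ := (Test.lt (.reg 12) (.const 2 * .reg 2)).cost + 1 + copyBody.size

theorem runs_copyLoop {M : List Plane} {s : State} (h2 : s.reg 2 = M.length) (h12 : s.reg 12 = 0)
    (hM : ArrayAt s.mem (2 * M.length) M) :
    ∃ s', Runs copyLoop s s' (copyCost * (2 * M.length + 1)) ∧ Keeps 12 (2 * M.length) s s' ∧
      ArrayAt s'.mem 0 M := by
  obtain ⟨s', φ', t, hrun, ⟨i, h12', hle, hcopy, hkeep, -⟩, hn, ht⟩ :=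
    runs_loop (t := .lt (.reg 12) (.const 2 * .reg 2)) (c := copyBody)
    (fun s' φ => ∃ i : ℕ, s'.reg 12 = i ∧ i ≤ 2 * M.length ∧
      (∀ a < i, s'.mem a = s.mem (2 * M.length + a)) ∧ Keeps 12 (2 * M.length) s s' ∧
      φ = copyCost * (2 * M.length - i))
    (by
      rintro s1 φ ⟨i, h12', hle, hcopy, hkeep, rfl⟩ ht
      have hlt : i < 2 * M.length := by
        have : (i : ℝ) < 2 * M.length := by
          simpa [Expr.eval, h12', hkeep.reg 2 (by norm_num), h2] using ht
        exact_mod_cast this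
      have haddr : ⌊2 * (M.length : ℝ) + i⌋₊ = 2 * M.length + i :=
        natFloor_eq_of_eq_cast (by push_cast; ring)
      have hden : copyBody.denote s1 = ⟨Function.update s1.reg 12 (i + 1),
          Function.update s1.mem i (s1.mem (2 * M.length + i))⟩ := by
        simp [copyBody, Expr.eval, h12', hkeep.reg 2 (by norm_num), h2, haddr]
      refine ⟨_, _, _, runs_denote copyBody rfl s1, ⟨i + 1, ?_, hlt, ?_, ?_, rfl⟩, ?_⟩
      · simp [hden]
      · intro a ha
        rw [hden]
        rcases (Nat.lt_succ_iff.1 ha).lt_or_eq with h | rfl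
        · simp only [Function.update_of_ne h.ne]
          exact hcopy a h
        · simp only [Function.update_self]
          exact hkeep.mem _ (by omega)
      · refine hkeep.trans ?_
        rw [hden]
        refine ⟨fun r hr => ?_, fun a ha => ?_⟩
        · simp [show r ≠ 12 by omega]
        · simp [show a ≠ i by omega]
      · rw [show 2 * M.length - i = 2 * M.length - (i + 1) + 1 by omega, mul_add, mul_one, copyCost]
        omega)
    s (copyCost * (2 * M.length))
    ⟨0, by simpa using h12, by omega, by simp, .refl _ _ _, rfl⟩
  have hi : i = 2 * M.length := by
    have : ¬ (i : ℝ) < 2 * M.length := by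
      simpa [Expr.eval, h12', hkeep.reg 2 (by norm_num), h2] using hn
    have : ¬ i < 2 * M.length := by exact_mod_cast this
    omega
  refine ⟨s', hrun.mono ?_, hkeep, ?_⟩
  · rw [mul_add, mul_one]
    unfold copyCost at *
    omega
  · intro j hj
    rw [hcopy _ (by omega), hcopy _ (by omega), zero_add]
    exact hM j hj

/-- One pass of the sorting. -/
def sortBody : Program :=
  .assign 9 (.const 0) ;; passLoop ;; .assign 12 (.const 0) ;; copyLoop ;;
    .assign 8 (.const 2 * .reg 8)

/-- Merge sort with respect to the Z-order. -/
def sortProgram : Program := .assign 8 (.const 1) ;; .loop (.lt (.reg 8) (.reg 2)) sortBody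

/-- The number of steps for one pass, per point. -/
def sortCost : ℕ :=
  (Test.lt (.reg 8) (.reg 2)).cost + 1 + (Program.assign 9 (.const 0)).size + passCost +
    (Program.assign 12 (.const 0)).size + 2 * copyCost + (Program.assign 8 (.const 2 * .reg 8)).size +
    (Program.assign 8 (.const 1)).size

theorem sortBody_spec {S : Square} {L : List Plane} {w : ℕ} {s : State} (hS : Framed S s)
    (hu : ∀ p ∈ L, S.InUnit p) (h2 : s.reg 2 = L.length) (h8 : s.reg 8 = w)
    (hL : ArrayAt s.mem 0 L) (hw : 0 < w) (hsorted : BlockSorted S w L) :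
    ∃ s' M, Runs sortBody s s' ((Program.assign 9 (.const 0)).size + (passCost * (L.length + 1) +
        ((Program.assign 12 (.const 0)).size + (copyCost * (2 * L.length + 1) +
          (Program.assign 8 (.const 2 * .reg 8)).size)))) ∧
      Keeps 8 (4 * L.length) s s' ∧ s'.reg 8 = (2 * w : ℕ) ∧ ArrayAt s'.mem 0 M ∧
      BlockSorted S (2 * w) M ∧ M.Perm L := by
  set s1 := (Program.assign 9 (.const 0)).denote s with hs1
  have hk1 : Keeps 9 0 s s1 := by
    refine ⟨fun r hr => ?_, fun _ _ => rfl⟩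
    simp [hs1, show r ≠ 9 by omega]
  obtain ⟨s2, M, hrun2, hk2, hM, hMs, hMp⟩ := runs_passLoop (hS.of_keeps hk1 (by norm_num)) hu
    ((hk1.reg 2 (by norm_num)).trans h2) ((hk1.reg 8 (by norm_num)).trans h8)
    (by simp [hs1, Expr.eval]) hL hw hsorted
  set s3 := (Program.assign 12 (.const 0)).denote s2 with hs3
  have hk3 : Keeps 12 0 s2 s3 := by
    refine ⟨fun r hr => ?_, fun _ _ => rfl⟩
    simp [hs3, show r ≠ 12 by omega]
  have hk03 : Keeps 9 (4 * L.length) s s3 :=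
    ((hk1.mono le_rfl (by omega)).trans hk2).trans (hk3.mono (by norm_num) (by omega))
  obtain ⟨s4, hrun4, hk4, hM4⟩ := runs_copyLoop (M := M) (s := s3)
    (by rw [hk03.reg 2 (by norm_num), h2, hMp.length_eq]) (by simp [hs3, Expr.eval])
    (by rw [hMp.length_eq]; exact hM)
  rw [hMp.length_eq] at hrun4 hk4
  have hk04 := hk03.trans (hk4.mono (R' := 9) (A' := 4 * L.length) (by norm_num) (by omega))
  refine ⟨_, M, (runs_denote _ rfl s).seq (hrun2.seq ((runs_denote _ rfl s2).seq (hrun4.seq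
    (runs_denote _ rfl s4)))), ?_, ?_, hM4, hMs, hMp⟩
  · refine (hk04.mono (by norm_num) le_rfl).trans ⟨fun r hr => ?_, fun _ _ => rfl⟩
    simp [show r ≠ 8 by omega]
  · simp [Expr.eval, hk04.reg 8 (by norm_num), h8]

/-- After e passes the blocks of length 2^e are sorted. At most `Nat.clog 2 n` passes of linear cost
are needed until one block covers the list. -/
theorem runs_sortProgram {S : Square} {L : List Plane} {s : State} (hS : Framed S s)
    (hu : ∀ p ∈ L, S.InUnit p) (h2 : s.reg 2 = L.length) (hL : ArrayAt s.mem 0 L) :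
    ∃ s' M, Runs sortProgram s s' (sortCost * ((L.length + 1) * (Nat.clog 2 L.length + 1))) ∧
      Keeps 8 (4 * L.length) s s' ∧ ArrayAt s'.mem 0 M ∧ M.Pairwise S.ZLe ∧ M.Perm L := by
  set s1 := (Program.assign 8 (.const 1)).denote s with hs1
  have hk1 : Keeps 8 0 s s1 := by
    refine ⟨fun r hr => ?_, fun _ _ => rfl⟩
    simp [hs1, show r ≠ 8 by omega]
  have hpot : (Test.lt (.reg 8) (.reg 2)).cost + 1 + ((Program.assign 9 (.const 0)).size +
      (passCost * (L.length + 1) + ((Program.assign 12 (.const 0)).size +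
        (copyCost * (2 * L.length + 1) + (Program.assign 8 (.const 2 * .reg 8)).size)))) ≤
      sortCost * (L.length + 1) := by
    have key : ∀ a b P c K d e n : ℕ, a + 1 + (b + (P * (n + 1) + (c + (K * (2 * n + 1) + d)))) ≤
        (a + 1 + b + P + c + 2 * K + d + e) * (n + 1) := by
      intro a b P c K d e n
      have h1 := Nat.le_mul_of_pos_right (a + 1 + b + c + d) (show 0 < n + 1 by omega)
      have h2 : (a + 1 + b + P + c + 2 * K + d + e) * (n + 1) = (a + 1 + b + c + d) * (n + 1) +
          P * (n + 1) + K * (2 * n + 1) + K + e * (n + 1) := by ring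
      omega
    exact key _ _ _ _ _ _ _ _
  obtain ⟨s', φ', t, hrun, ⟨e, M, h8, hM, hMs, hMp, hkeep, -⟩, hn, ht⟩ :=
    runs_loop (t := .lt (.reg 8) (.reg 2)) (c := sortBody)
    (fun s' φ => ∃ (e : ℕ) (M : List Plane), s'.reg 8 = (2 ^ e : ℕ) ∧ ArrayAt s'.mem 0 M ∧
      BlockSorted S (2 ^ e) M ∧ M.Perm L ∧ Keeps 8 (4 * L.length) s s' ∧
      φ = sortCost * (L.length + 1) * (Nat.clog 2 L.length - e))
    (by
      rintro s2 φ ⟨e, M, h8, hM, hMs, hMp, hkeep, rfl⟩ ht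
      have h2' : s2.reg 2 = M.length := by rw [hkeep.reg 2 (by norm_num), h2, hMp.length_eq]
      have hlt : 2 ^ e < L.length := by
        have : ((2 ^ e : ℕ) : ℝ) < L.length := by
          rw [← h8, ← hMp.length_eq, ← h2']; simpa [Expr.eval] using ht
        exact_mod_cast this
      have he : e < Nat.clog 2 L.length := (Nat.lt_clog_iff_pow_lt (by norm_num)).2 hlt
      obtain ⟨s3, M', hrun, hkeep', h8', hM', hMs', hMp'⟩ :=
        sortBody_spec (hS.of_keeps hkeep (by norm_num)) (fun p hp => hu p (hMp.mem_iff.1 hp)) h2'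
          h8 hM (by positivity) hMs
      rw [hMp.length_eq] at hrun hkeep'
      refine ⟨s3, _, _, hrun, ⟨e + 1, M', ?_, hM', ?_, hMp'.trans hMp, hkeep.trans hkeep', rfl⟩, ?_⟩
      · rw [h8', pow_succ, mul_comm]
      · rwa [pow_succ, mul_comm]
      · rw [show Nat.clog 2 L.length - e = Nat.clog 2 L.length - (e + 1) + 1 by omega,
          mul_add (sortCost * (L.length + 1)) _ 1, mul_one]
        omega)
    s1 (sortCost * (L.length + 1) * Nat.clog 2 L.length)
    ⟨0, L, by simp [hs1, Expr.eval], hL, fun a => by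
      rw [pow_zero]
      have : (segment L (a * 1) (a * 1 + 1)).length ≤ 1 := by
        rw [segment, List.length_drop, List.length_take]
        omega
      generalize segment L (a * 1) (a * 1 + 1) = X at *
      rcases X with _ | ⟨x, _ | ⟨y, X⟩⟩
      · exact .nil
      · exact List.pairwise_singleton _ _
      · simp at this, .refl _, hk1.mono le_rfl (by omega), rfl⟩
  have hge : M.length ≤ 2 ^ e := by
    have : ¬ ((2 ^ e : ℕ) : ℝ) < L.length := by
      rw [← h8, ← h2, ← hkeep.reg 2 (by norm_num)]; simpa [Expr.eval] using hn
    rw [hMp.length_eq]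
    exact not_lt.1 (by exact_mod_cast this)
  refine ⟨s', M, ((runs_denote _ rfl s).seq hrun).mono ?_, hkeep, hM, ?_, hMp⟩
  · have h1 : (Program.assign 8 (.const 1)).size + ((Test.lt (.reg 8) (.reg 2)).cost + 1) ≤
        sortCost * (L.length + 1) := by
      refine le_trans ?_ (Nat.le_mul_of_pos_right _ (by omega))
      unfold sortCost
      omega
    rw [← mul_assoc, mul_add (sortCost * (L.length + 1)) _ 1, mul_one]
    omega
  · have := hMs 0
    rwa [zero_mul, zero_add, segment, List.drop_zero, List.take_of_length_le hge] at this

/-! ### Linked records and the stack of unfinished vertices -/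

/-- A variant of `Encodes` where all records lie between the addresses `lo` and `hi`. -/
inductive EncodesIn (mem : ℕ → ℝ) (lo hi : ℕ) : ℝ → List GTree → Prop
  | nil : EncodesIn mem lo hi (-1) []
  | leaf (a : ℕ) (p : Plane) (ts : List GTree) (hlo : lo ≤ a) (hhi : a + 4 ≤ hi)
      (hx : mem a = p 0) (hy : mem (a + 1) = p 1)
      (hc : mem (a + 2) = -1) (hs : EncodesIn mem lo hi (mem (a + 3)) ts) :
      EncodesIn mem lo hi (a : ℝ) (.leaf p :: ts)
  | node (a : ℕ) (o : Plane) (cs ts : List GTree) (hlo : lo ≤ a) (hhi : a + 4 ≤ hi)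
      (hx : mem a = o 0) (hy : mem (a + 1) = o 1)
      (hc : EncodesIn mem lo hi (mem (a + 2)) cs) (hs : EncodesIn mem lo hi (mem (a + 3)) ts) :
      EncodesIn mem lo hi (a : ℝ) (.node o cs :: ts)

theorem EncodesIn.encodes {mem : ℕ → ℝ} {lo hi : ℕ} {r : ℝ} {ts : List GTree}
    (h : EncodesIn mem lo hi r ts) : Encodes mem r ts := by
  induction h with
  | nil => exact .nil
  | leaf a p ts _ _ hx hy hc _ ih => exact .leaf a p ts hx hy hc ih
  | node a o cs ts _ _ hx hy _ _ ih ih' => exact .node a o cs ts hx hy ih ih'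

/-- This is what the address bounds are for: finished records survive writes outside their range. -/
theorem EncodesIn.congr {mem mem' : ℕ → ℝ} {lo hi hi' : ℕ} {r : ℝ} {ts : List GTree}
    (h : EncodesIn mem lo hi r ts) (hm : ∀ a, lo ≤ a → a < hi → mem' a = mem a) (hhi : hi ≤ hi') :
    EncodesIn mem' lo hi' r ts := by
  induction h with
  | nil => exact .nil
  | leaf a p ts hlo hhi hx hy hc _ ih =>
    refine .leaf a p ts hlo (by omega) ?_ ?_ ?_ ?_
    · rw [hm _ (by omega) (by omega), hx]
    · rw [hm _ (by omega) (by omega), hy]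
    · rw [hm _ (by omega) (by omega), hc]
    · rwa [hm _ (by omega) (by omega)]
  | node a o cs ts hlo hhi hx hy _ _ ih ih' =>
    refine .node a o cs ts hlo (by omega) ?_ ?_ ?_ ?_
    · rw [hm _ (by omega) (by omega), hx]
    · rw [hm _ (by omega) (by omega), hy]
    · rwa [hm _ (by omega) (by omega)]
    · rwa [hm _ (by omega) (by omega)]

/-- The data of a record for the root of a tree. -/
def RootAt (mem : ℕ → ℝ) (lo hi : ℕ) (x y c : ℝ) : GTree → Prop
  | .leaf p => x = p 0 ∧ y = p 1 ∧ c = -1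
  | .node o cs => x = o 0 ∧ y = o 1 ∧ EncodesIn mem lo hi c cs

/-- The memory after a new record has been written at the address `f`. -/
noncomputable def withRecord (mem : ℕ → ℝ) (f : ℕ) (x y c d : ℝ) : ℕ → ℝ :=
  Function.update (Function.update (Function.update (Function.update mem f x) (f + 1) y) (f + 2) c)
    (f + 3) d

theorem withRecord_of_ne {mem : ℕ → ℝ} {f a : ℕ} {x y c d : ℝ} (h : a < f ∨ f + 4 ≤ a) :
    withRecord mem f x y c d a = mem a := by
  simp only [withRecord, Function.update_of_ne (show a ≠ f + 3 by omega),
    Function.update_of_ne (show a ≠ f + 2 by omega), Function.update_of_ne (show a ≠ f + 1 by omega),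
    Function.update_of_ne (show a ≠ f by omega)]

/-- The root of the current tree stays in registers until its next sibling is known. Writing its
record at the first free address then prepends the tree to the list of its siblings. -/
theorem RootAt.encodesIn {mem : ℕ → ℝ} {lo f : ℕ} {x y c d : ℝ} {T : GTree} {ts : List GTree}
    (hT : RootAt mem lo f x y c T) (hts : EncodesIn mem lo f d ts) (hlo : lo ≤ f) :
    EncodesIn (withRecord mem f x y c d) lo (f + 4) f (T :: ts) := by
  have h0 : withRecord mem f x y c d f = x := by simp [withRecord]
  have h1 : withRecord mem f x y c d (f + 1) = y := by simp [withRecord]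
  have h2 : withRecord mem f x y c d (f + 2) = c := by simp [withRecord]
  have h3 : withRecord mem f x y c d (f + 3) = d := by simp [withRecord]
  have hold : ∀ a, lo ≤ a → a < f → withRecord mem f x y c d a = mem a :=
    fun a _ ha => withRecord_of_ne (Or.inl ha)
  cases T with
  | leaf p =>
    obtain ⟨hx, hy, hc⟩ := hT
    refine .leaf f p ts hlo le_rfl (by rw [h0, hx]) (by rw [h1, hy]) (by rw [h2, hc]) ?_
    rw [h3]
    exact hts.congr hold (by omega)
  | node o cs =>
    obtain ⟨hx, hy, hc⟩ := hT
    refine .node f o cs ts hlo le_rfl (by rw [h0, hx]) (by rw [h1, hy]) ?_ ?_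
    · rw [h2]
      exact hc.congr hold (by omega)
    · rw [h3]
      exact hts.congr hold (by omega)

/-- The memory from `base` on holds a stack of unfinished vertices, each with its gap and a pointer
to the list of its finished children. -/
def StackAt (mem : ℕ → ℝ) (lo hi base : ℕ) : List (ℝ × List GTree) → Prop
  | [] => True
  | e :: st => mem (base + 2 * st.length) = e.1 ∧
      EncodesIn mem lo hi (mem (base + 2 * st.length + 1)) e.2 ∧ StackAt mem lo hi base st

theorem StackAt.congr {mem mem' : ℕ → ℝ} {lo hi hi' base : ℕ} {st : List (ℝ × List GTree)}
    (h : StackAt mem lo hi base st) (hm : ∀ a, lo ≤ a → a < hi → mem' a = mem a) (hhi : hi ≤ hi')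
    (hst : ∀ a, base ≤ a → a < base + 2 * st.length → mem' a = mem a) :
    StackAt mem' lo hi' base st := by
  induction st with
  | nil => trivial
  | cons e st ih =>
    obtain ⟨h1, h2, h3⟩ := h
    rw [List.length_cons] at hst
    refine ⟨?_, ?_, ih h3 fun a ha ha' => hst a ha (by omega)⟩
    · rw [hst _ (by omega) (by omega), h1]
    · rw [hst _ (by omega) (by omega)]
      exact h2.congr hm hhi

-- The stack of ancestors of the current block

/-- `Pending gap ctr A st L`: the list `L` starts with the block `A`, whose tree is finished; the
entries of the stack are the ancestors of this block that are still to be completed. -/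
inductive Pending (gap : Plane → Plane → ℝ) (ctr : ℝ → Plane → Plane) :
    List Plane → List (ℝ × List GTree) → List Plane → Prop
  | nil (A : List Plane) : Pending gap ctr A [] A
  | cons (g : ℝ) (A B L : List Plane) (ts : List GTree) (st : List (ℝ × List GTree))
      (hA : A.IsChain fun p q => gap p q < g)
      (hAB : ∀ p ∈ A.getLast?, ∀ q ∈ B.head?, gap p q = g) (hB : Forest gap ctr g B ts)
      (hts : ts ≠ []) (h : Pending gap ctr (A ++ B) st L) :
      Pending gap ctr A ((g, ts) :: st) L

section Pending

variable {gap : Plane → Plane → ℝ} {ctr : ℝ → Plane → Plane}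

theorem Forest.ne_nil {g : ℝ} {B : List Plane} {ts : List GTree} (h : Forest gap ctr g B ts)
    (hts : ts ≠ []) : B ≠ [] := by
  cases h with
  | nil => exact absurd rfl hts
  | cons _ A B T ts hT => simp [hT.ne_nil]

/-- The current block is a prefix of the block to which each deeper entry refers, and smallness of
all gaps passes to prefixes. -/
theorem Pending.isChain {A L : List Plane} {st : List (ℝ × List GTree)}
    (h : Pending gap ctr A st L) : ∀ e ∈ st, A.IsChain fun p q => gap p q < e.1 := by
  induction h with
  | nil => simp
  | cons g A B L ts st hA hAB hB hts h ih =>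
    intro e he
    rcases List.mem_cons.1 he with rfl | he
    · exact hA
    · exact (ih e he).left_of_append

/-- The gap g behind A lies inside the block of every deeper entry, where all gaps are smaller than
that of the entry. So the gaps increase strictly from the top of the stack down. -/
theorem Pending.lt_of_mem {A L : List Plane} {g : ℝ} {ts : List GTree} {st : List (ℝ × List GTree)}
    (h : Pending gap ctr A ((g, ts) :: st) L) (hA : A ≠ []) : ∀ e ∈ st, g < e.1 := by
  cases h with
  | cons _ A B L ts st hA' hAB hB hts h =>
  intro e he
  have h1 := h.isChain e he
  obtain ⟨p, hp⟩ : ∃ p, p ∈ A.getLast? := ⟨_, List.getLast?_eq_some_getLast hA⟩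
  obtain ⟨q, hq⟩ := Option.isSome_iff_exists.1 (List.isSome_head?.2 (hB.ne_nil hts))
  rw [List.isChain_append] at h1
  rw [← hAB p hp q hq]
  exact h1.2.2 p hp q hq

/-- Each entry has leaves of its own, so there are at most as many entries as points; this keeps the
stack inside its part of the memory. -/
theorem Pending.length_le {A L : List Plane} {st : List (ℝ × List GTree)}
    (h : Pending gap ctr A st L) : A.length + st.length ≤ L.length := by
  induction h with
  | nil => simp
  | cons g A B L ts st hA hAB hB hts h ih =>
    have := List.length_pos_iff.2 (hB.ne_nil hts)
    rw [List.length_append] at ih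
    rw [List.length_cons]
    omega

theorem Pending.cons_point {A L : List Plane} {st : List (ℝ × List GTree)}
    (h : Pending gap ctr A st L) {x p : Plane} (hp : p ∈ A.head?)
    (hx : ∀ e ∈ st, gap x p < e.1) : Pending gap ctr (x :: A) st (x :: L) := by
  induction h with
  | nil => exact .nil _
  | cons g A B L ts st hA hAB hB hts h ih =>
    have hne : A ≠ [] := by
      rintro rfl
      simp at hp
    refine .cons g (x :: A) B (x :: L) ts st ?_ ?_ hB hts (ih ?_ fun e he => hx e (by simp [he]))
    · rw [List.isChain_cons]
      refine ⟨fun q hq => ?_, hA⟩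
      rw [Option.mem_unique hq hp]
      exact hx (g, ts) (by simp)
    · rwa [List.getLast?_cons_of_ne_nil hne]
    · rw [List.head?_append_of_ne_nil _ hne]
      exact hp

/-- The topmost entry already holds the children to the right of A. With the tree for A as first
child its vertex is complete, and the first leaf, which determines the centre, remains the same. -/
theorem Pending.pop {A L : List Plane} {g : ℝ} {ts : List GTree} {st : List (ℝ × List GTree)}
    {p : Plane} {T : GTree} (h : Pending gap ctr A ((g, ts) :: st) L) (hT : Dendro gap ctr A T)
    (hp : A.head? = some p) : ∃ B, Dendro gap ctr (A ++ B) (.node (ctr g p) (T :: ts)) ∧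
      (A ++ B).head? = some p ∧ Pending gap ctr (A ++ B) st L ∧
      (A ++ B).IsChain fun p q => gap p q ≤ g := by
  cases h with
  | cons _ A B L ts st hA hAB hB hts h =>
  have hF : Forest gap ctr g (A ++ B) (T :: ts) := .cons g A B T ts hT hA hAB hB
  rcases A with _ | ⟨a, A⟩
  · simp at hp
  obtain rfl : a = p := by simpa using hp
  refine ⟨B, .node g a (A ++ B) (T :: ts) hF ?_, by simp, h, hF.isChain⟩
  have := List.length_pos_iff.2 hts
  rw [List.length_cons]
  omega

end Pending

-- Completing vertices on the machine

/-- Write a new record for the root of the current tree, with the next sibling in register `43`. -/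
def allocProgram : Program :=
  .store (.reg 7) (.reg 33) ;; .store (.reg 7 + .const 1) (.reg 34) ;;
  .store (.reg 7 + .const 2) (.reg 35) ;; .store (.reg 7 + .const 3) (.reg 43)

theorem denote_allocProgram {s : State} {f : ℕ} (hf : s.reg 7 = f) : allocProgram.denote s =
    ⟨s.reg, withRecord s.mem f (s.reg 33) (s.reg 34) (s.reg 35) (s.reg 43)⟩ := by
  have h1 : ⌊(f : ℝ) + 1⌋₊ = f + 1 := natFloor_eq_of_eq_cast (by push_cast; ring)
  have h2 : ⌊(f : ℝ) + 2⌋₊ = f + 2 := natFloor_eq_of_eq_cast (by push_cast; ring)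
  have h3 : ⌊(f : ℝ) + 3⌋₊ = f + 3 := natFloor_eq_of_eq_cast (by push_cast; ring)
  simp [allocProgram, withRecord, Expr.eval, hf, h1, h2, h3]

/-- Write the value of `cellAt` for the gap in register `40` into the register `out`. -/
def cellProgram (x out : ℕ) : Program :=
  .assign out (.floor (.reg x / (.const 2 * .reg 40))) ;;
  .ite (.le (.const 1 / (.const 2 * .reg 40)) (.reg out)) (.assign out (.reg out - .const 1)) .skip

theorem denote_cellProgram (x out : ℕ) (hout : 40 ≠ out) (s : State) :
    (cellProgram x out).denote s =
      ⟨Function.update s.reg out (Square.cellAt (s.reg 40) (s.reg x)), s.mem⟩ := by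
  simp only [cellProgram, Program.denote_seq, Program.denote_assign, Program.denote_ite,
    Program.denote_skip, Test.holds_le, Expr.eval, Expr.eval_div, Expr.eval_sub,
    Function.update_self, Function.update_of_ne hout, Square.cellAt, Rat.cast_one, Rat.cast_ofNat]
  split_ifs with h
  · simp
  · rfl

/-- The expression for the scaled coordinate of the centre of a cell. -/
def centreExpr (c : ℕ) : Expr :=
  (.const 2 * .reg c + .const 1) * (.const 2 * .reg 40) - .const 1

/-- The address of the topmost entry of the stack. -/
def topExpr : Expr := .const 4 * .reg 2 + .const 2 * .reg 36 - .const 2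

/-- Complete the topmost vertex of the stack: its last child is the current tree. -/
def popBody : Program :=
  (.assign 40 (.load topExpr) ;; .assign 43 (.load (topExpr + .const 1))) ;;
  allocProgram ;; (.assign 35 (.reg 7) ;; .assign 7 (.reg 7 + .const 4)) ;;
  cellProgram 38 41 ;; cellProgram 39 42 ;;
  (.assign 33 (.reg 3 + centreExpr 41 * .reg 5 - centreExpr 42 * .reg 6) ;;
  .assign 34 (.reg 4 + centreExpr 41 * .reg 6 + centreExpr 42 * .reg 5) ;;
  .assign 36 (.reg 36 - .const 1))

/-- The state of the construction: the points `L` have been processed, `T` is the current tree with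
the leaves `A`, the first of which is `p`; the next free address is `f`. -/
structure BuildInv (S : Square) (n lo : ℕ) (p : Plane) (A : List Plane) (T : GTree)
    (st : List (ℝ × List GTree)) (L : List Plane) (f : ℕ) (s : State) : Prop where
  framed : Framed S s
  reg2 : s.reg 2 = n
  reg7 : s.reg 7 = f
  root : RootAt s.mem lo f (s.reg 33) (s.reg 34) (s.reg 35) T
  reg36 : s.reg 36 = st.length
  reg38 : s.reg 38 = S.coordX p
  reg39 : s.reg 39 = S.coordY p
  stack : StackAt s.mem lo f (4 * n) st
  le_lo : 8 * n ≤ lo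
  lo_le : lo ≤ f
  dendro : Dendro S.gap S.nodeCentre A T
  head : A.head? = some p
  pending : Pending S.gap S.nodeCentre A st L
  length : L.length ≤ n

/-- What the construction leaves unchanged. -/
structure BuildKeeps (n lo : ℕ) (s s' : State) : Prop where
  reg : ∀ r, r < 7 ∨ 8 ≤ r ∧ r < 33 ∨ r = 37 → s'.reg r = s.reg r
  mem : ∀ a, a < 4 * n ∨ 8 * n ≤ a ∧ a < lo → s'.mem a = s.mem a

theorem BuildKeeps.refl (n lo : ℕ) (s : State) : BuildKeeps n lo s s :=
  ⟨fun _ _ => rfl, fun _ _ => rfl⟩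

theorem BuildKeeps.trans {n lo : ℕ} {s s' s'' : State} (h : BuildKeeps n lo s s')
    (h' : BuildKeeps n lo s' s'') : BuildKeeps n lo s s'' :=
  ⟨fun r hr => (h'.reg r hr).trans (h.reg r hr), fun a ha => (h'.mem a ha).trans (h.mem a ha)⟩

theorem BuildInv.length_lt {S : Square} {n lo : ℕ} {p : Plane} {A : List Plane} {T : GTree}
    {st : List (ℝ × List GTree)} {L : List Plane} {f : ℕ} {s : State}
    (h : BuildInv S n lo p A T st L f s) : st.length < n := by
  have h1 := h.pending.length_le
  have h2 := List.length_pos_iff.2 h.dendro.ne_nil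
  have h3 := h.length
  omega

/-- The current tree becomes the first child of the topmost vertex, which replaces it as the current
tree. Its centre needs only the gap and the coordinates of the first leaf, which are kept in the
registers 38 and 39. -/
theorem popBody_spec {S : Square} {n lo : ℕ} {p : Plane} {A : List Plane} {T : GTree} {g : ℝ}
    {ts : List GTree} {st : List (ℝ × List GTree)} {L : List Plane} {f : ℕ} {s : State}
    (h : BuildInv S n lo p A T ((g, ts) :: st) L f s) :
    ∃ A' T', BuildInv S n lo p A' T' st L (f + 4) (popBody.denote s) ∧
      BuildKeeps n lo s (popBody.denote s) ∧ A'.IsChain fun p q => S.gap p q ≤ g := by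
  obtain ⟨B, hD, hhead, hpend, hchain⟩ := h.pending.pop h.dendro h.head
  have hlt := h.length_lt
  obtain ⟨hst1, hst2, hst3⟩ := h.stack
  have hlo := h.le_lo
  have hlo' := h.lo_le
  rw [List.length_cons] at hlt
  dsimp only at hst1 hst2
  have haddr : ⌊4 * (n : ℝ) + 2 * (st.length + 1) - 2⌋₊ = 4 * n + 2 * st.length :=
    natFloor_eq_of_eq_cast (by push_cast; ring)
  have haddr' : ⌊4 * (n : ℝ) + 2 * (st.length + 1) - 2 + 1⌋₊ = 4 * n + 2 * st.length + 1 :=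
    natFloor_eq_of_eq_cast (by push_cast; ring)
  have h36 := h.reg36
  rw [List.length_cons, Nat.cast_add_one] at h36
  set d := s.mem (4 * n + 2 * st.length + 1) with hd
  set mem' := withRecord s.mem f (s.reg 33) (s.reg 34) (s.reg 35) d with hmem'
  have hden : popBody.denote s = ⟨Function.update (Function.update (Function.update (Function.update
      (Function.update (Function.update (Function.update (Function.update (Function.update s.reg
        40 g) 43 d) 35 f) 7 (f + 4)) 41 (Square.cellAt g (S.coordX p)))
        42 (Square.cellAt g (S.coordY p))) 33 (S.nodeCentre g p 0)) 34 (S.nodeCentre g p 1))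
        36 st.length, mem'⟩ := by
    set s1 : State := ⟨Function.update (Function.update s.reg 40 g) 43 d, s.mem⟩ with hs1
    have e1 : (Program.assign 40 (.load topExpr) ;;
        .assign 43 (.load (topExpr + .const 1))).denote s = s1 := by
      simp [topExpr, Expr.eval, h.reg2, h36, haddr, haddr', hst1, hs1, hd]
    rw [popBody, Program.denote_seq, e1, Program.denote_seq, denote_allocProgram (f := f)
      (by simp [hs1, h.reg7])]
    simp only [Program.denote_seq, denote_cellProgram _ _ (show 40 ≠ 41 by norm_num),
      denote_cellProgram _ _ (show 40 ≠ 42 by norm_num)]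
    simp [hs1, Expr.eval, h.reg7, h.reg38, h.reg39, centreExpr, h.framed.1, h.framed.2, h.framed.3,
      h.framed.4, h36, Square.nodeCentre, Square.point, hmem']
  have hold : ∀ a, a < f → mem' a = s.mem a := fun a ha => withRecord_of_ne (Or.inl ha)
  have hkeep : BuildKeeps n lo s (popBody.denote s) := by
    rw [hden]
    constructor
    · intro r hr
      have h1 : ∀ m, m = 7 ∨ 33 ≤ m ∧ m < 37 ∨ 38 ≤ m → r ≠ m := by omega
      simp [h1]
    · exact fun a ha => hold a (by omega)
  refine ⟨A ++ B, .node (S.nodeCentre g p) (T :: ts), ?_, hkeep, hchain⟩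
  refine ⟨⟨?_, ?_, ?_, ?_⟩, ?_, ?_, ?_, ?_, ?_, ?_, ?_, hlo, by omega, hD, hhead, hpend, h.length⟩
  · rw [hkeep.reg 3 (by norm_num), h.framed.1]
  · rw [hkeep.reg 4 (by norm_num), h.framed.2]
  · rw [hkeep.reg 5 (by norm_num), h.framed.3]
  · rw [hkeep.reg 6 (by norm_num), h.framed.4]
  · rw [hkeep.reg 2 (by norm_num), h.reg2]
  · simp [hden]
  · rw [hden]
    refine ⟨by simp, by simp, ?_⟩
    have := h.root.encodesIn hst2 hlo'
    simpa using this
  · simp [hden]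
  · simp [hden, h.reg38]
  · simp [hden, h.reg39]
  · rw [hden]
    exact hst3.congr (fun a _ ha => hold a ha) (by omega) fun a _ ha => hold a (by omega)

/-! ### The construction of the tree from the sorted points -/

/-- The number of steps for the completion of a vertex, with the test of either loop. -/
def popCost : ℕ :=
  (Test.and (.le (.const 1) (.reg 36)) (.lt (.load topExpr) (.reg 30))).cost + 1 +
    ((Test.le (.const 1) (.reg 36)).cost + 1) + popBody.size

/-- Complete all vertices with a gap smaller than the one in register `30`. -/
def closeLoop : Program :=
  .loop (.and (.le (.const 1) (.reg 36)) (.lt (.load topExpr) (.reg 30))) popBody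

theorem BuildInv.eval_topExpr {S : Square} {n lo : ℕ} {p : Plane} {A : List Plane} {T : GTree}
    {g : ℝ} {ts : List GTree} {st : List (ℝ × List GTree)} {L : List Plane} {f : ℕ} {s : State}
    (h : BuildInv S n lo p A T ((g, ts) :: st) L f s) :
    (Expr.load topExpr).eval s = g ∧ topExpr.eval s = (4 * n + 2 * st.length : ℕ) := by
  have h36 := h.reg36
  rw [List.length_cons, Nat.cast_add_one] at h36
  have h1 : topExpr.eval s = (4 * n + 2 * st.length : ℕ) := by
    simp [topExpr, Expr.eval, h36, h.reg2]
    ring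
  refine ⟨?_, h1⟩
  rw [Expr.eval, h1, Nat.floor_natCast]
  exact h.stack.1

/-- Every entry of the stack carries `popCost` to pay for its completion. A completed vertex has a
gap below g₀, so the enlarged current block again has only gaps below g₀. -/
theorem runs_closeLoop {S : Square} {n lo : ℕ} {p : Plane} {A : List Plane} {T : GTree}
    {st : List (ℝ × List GTree)} {L : List Plane} {f : ℕ} {s : State} {g₀ : ℝ}
    (h : BuildInv S n lo p A T st L f s) (h30 : s.reg 30 = g₀)
    (hA : A.IsChain fun p q => S.gap p q < g₀) :
    ∃ s' A' T' st' f' k, Runs closeLoop s s' k ∧ k + popCost * st'.length ≤ popCost * st.length +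
        (Test.and (.le (.const 1) (.reg 36)) (.lt (.load topExpr) (.reg 30))).cost + 1 ∧
      BuildInv S n lo p A' T' st' L f' s' ∧ BuildKeeps n lo s s' ∧
      (A'.IsChain fun p q => S.gap p q < g₀) ∧ ∀ e ∈ st'.head?, g₀ ≤ e.1 := by
  -- For an empty stack the load in the test reads an irrelevant cell, but the first conjunct
  -- already fails.
  have key : ∀ {s' : State} {A' T' st' f'}, BuildInv S n lo p A' T' st' L f' s' → s'.reg 30 = g₀ →
      ((Test.and (.le (.const 1) (.reg 36)) (.lt (.load topExpr) (.reg 30))).Holds s' ↔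
        ∃ e ∈ st'.head?, e.1 < g₀) := by
    intro s' A' T' st' f' h h30
    rcases st' with _ | ⟨⟨g, ts⟩, st'⟩
    · simp only [Test.holds_and, Test.holds_le, Expr.eval, h.reg36, List.length_nil]
      simp
    · simp only [Test.holds_and, Test.holds_le, Test.holds_lt, h.eval_topExpr.1]
      simp only [Expr.eval, h.reg36, h30, List.length_cons]
      simp
  obtain ⟨s', φ', k, hrun, ⟨A', T', st', f', hI, hkeep, hA', rfl⟩, hn, hk⟩ :=
    runs_loop (c := popBody) (fun s' φ => ∃ A' T' st' f', BuildInv S n lo p A' T' st' L f' s' ∧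
      BuildKeeps n lo s s' ∧ (A'.IsChain fun p q => S.gap p q < g₀) ∧ φ = popCost * st'.length)
    (by
      rintro s1 φ ⟨A', T', st', f', hI, hkeep, hA', rfl⟩ ht
      rw [key hI ((hkeep.reg 30 (by norm_num)).trans h30)] at ht
      obtain ⟨e, he, hlt⟩ := ht
      rcases st' with _ | ⟨⟨g, ts⟩, st'⟩
      · simp at he
      obtain rfl : (g, ts) = e := by simpa using he
      obtain ⟨A'', T'', hI', hkeep', hA''⟩ := popBody_spec hI
      refine ⟨_, _, _, runs_denote popBody rfl s1, ⟨A'', T'', st', _, hI', hkeep.trans hkeep',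
        hA''.imp fun _ _ h => h.trans_lt hlt, rfl⟩, ?_⟩
      rw [List.length_cons, mul_add, mul_one, popCost]
      omega)
    s (popCost * st.length) ⟨A, T, st, f, h, .refl _ _ _, hA, rfl⟩
  refine ⟨s', A', T', st', f', k, hrun, hk, hI, hkeep, hA', fun e he => ?_⟩
  rw [key hI ((hkeep.reg 30 (by norm_num)).trans h30)] at hn
  by_contra hlt
  exact hn ⟨e, he, not_le.1 hlt⟩

/-- Complete all vertices. -/
def finishLoop : Program := .loop (.le (.const 1) (.reg 36)) popBody

theorem runs_finishLoop {S : Square} {n lo : ℕ} {p : Plane} {A : List Plane} {T : GTree}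
    {st : List (ℝ × List GTree)} {L : List Plane} {f : ℕ} {s : State}
    (h : BuildInv S n lo p A T st L f s) :
    ∃ s' T' f', Runs finishLoop s s' (popCost * (st.length + 1)) ∧
      BuildInv S n lo p L T' [] L f' s' ∧ BuildKeeps n lo s s' := by
  obtain ⟨s', φ', k, hrun, ⟨A', T', st', f', hI, hkeep, rfl⟩, hn, hk⟩ :=
    runs_loop (t := .le (.const 1) (.reg 36)) (c := popBody) (fun s' φ => ∃ A' T' st' f',
      BuildInv S n lo p A' T' st' L f' s' ∧ BuildKeeps n lo s s' ∧ φ = popCost * st'.length)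
    (by
      rintro s1 φ ⟨A', T', st', f', hI, hkeep, rfl⟩ ht
      rcases st' with _ | ⟨⟨g, ts⟩, st'⟩
      · simp only [Test.holds_le, Expr.eval, hI.reg36, List.length_nil] at ht
        norm_num at ht
      obtain ⟨A'', T'', hI', hkeep', hA''⟩ := popBody_spec hI
      refine ⟨_, _, _, runs_denote popBody rfl s1, ⟨A'', T'', st', _, hI', hkeep.trans hkeep', rfl⟩,
        ?_⟩
      rw [List.length_cons, mul_add, mul_one, popCost]
      omega)
    s (popCost * st.length) ⟨A, T, st, f, h, .refl _ _ _, rfl⟩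
  have hst : st' = [] := by
    rcases st' with _ | ⟨e, st'⟩
    · rfl
    · simp only [Test.holds_le, Expr.eval, hI.reg36, List.length_cons] at hn
      simp at hn
  subst hst
  have hAL : A' = L := by cases hI.pending; rfl
  subst hAL
  refine ⟨s', T', f', hrun.mono ?_, hI, hkeep⟩
  have : (Test.le (.const 1) (.reg 36)).cost + 1 ≤ popCost := by unfold popCost; omega
  rw [mul_add, mul_one]
  omega

/-- Make the point in the registers `20`, `21`, with the coordinates `24`, `25`, the current tree. -/
def setCurrent : Program :=
  .assign 33 (.reg 20) ;; .assign 34 (.reg 21) ;; .assign 35 (.const (-1)) ;;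
  .assign 38 (.reg 24) ;; .assign 39 (.reg 25)

theorem denote_setCurrent (s : State) : setCurrent.denote s =
    ⟨Function.update (Function.update (Function.update (Function.update (Function.update s.reg
      33 (s.reg 20)) 34 (s.reg 21)) 35 (-1)) 38 (s.reg 24)) 39 (s.reg 25), s.mem⟩ := by
  simp [setCurrent, Expr.eval]

/-- Add the current tree to the topmost entry of the stack, which has the gap in register `30`. -/
def linkTop : Program :=
  .assign 43 (.load (topExpr + .const 1)) ;; allocProgram ;; .store (topExpr + .const 1) (.reg 7) ;;
  .assign 7 (.reg 7 + .const 4)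

/-- Push a new entry with the gap in register `30` and with the current tree. -/
def linkPush : Program :=
  .assign 43 (.const (-1)) ;; allocProgram ;;
  .store (.const 4 * .reg 2 + .const 2 * .reg 36) (.reg 30) ;;
  .store (.const 4 * .reg 2 + .const 2 * .reg 36 + .const 1) (.reg 7) ;;
  .assign 7 (.reg 7 + .const 4) ;; .assign 36 (.reg 36 + .const 1)

/-- Move the current tree to the stack, and make the next point the current tree. -/
def linkBody : Program :=
  .ite (.and (.le (.const 1) (.reg 36)) (.le (.load topExpr) (.reg 30))) linkTop linkPush ;;
  setCurrent

/-- Once the smaller gaps are closed, the gap to the new point is at most that of the topmost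
vertex. If they are equal, the current tree becomes one more child of this vertex, which is how
equal maxima share a vertex; if it is smaller, a new vertex is opened. In both cases the new point
forms the current block alone. -/
theorem linkBody_spec {S : Square} {n lo : ℕ} {p x : Plane} {A : List Plane} {T : GTree}
    {st : List (ℝ × List GTree)} {L : List Plane} {f : ℕ} {s : State}
    (h : BuildInv S n lo p A T st L f s) (h30 : s.reg 30 = S.gap x p)
    (hA : A.IsChain fun q r => S.gap q r < S.gap x p) (hst : ∀ e ∈ st.head?, S.gap x p ≤ e.1)
    (hL : L.length < n) (h20 : s.reg 20 = x 0) (h21 : s.reg 21 = x 1)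
    (h24 : s.reg 24 = S.coordX x) (h25 : s.reg 25 = S.coordY x) :
    ∃ st', BuildInv S n lo x [x] (.leaf x) st' (x :: L) (f + 4) (linkBody.denote s) ∧
      BuildKeeps n lo s (linkBody.denote s) ∧ st'.length ≤ st.length + 1 := by
  have hlt := h.length_lt
  have hlo := h.le_lo
  have hlo' := h.lo_le
  have hAne := h.dendro.ne_nil
  have hpA : p ∈ A.head? := h.head
  have hsuff : ∀ (st' : List (ℝ × List GTree)) (s1 : State), BuildKeeps n lo s s1 →
      s1.reg 7 = (f + 4 : ℕ) → s1.reg 36 = st'.length → StackAt s1.mem lo (f + 4) (4 * n) st' →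
      Pending S.gap S.nodeCentre [x] st' (x :: L) →
      BuildInv S n lo x [x] (.leaf x) st' (x :: L) (f + 4) (setCurrent.denote s1) ∧
        BuildKeeps n lo s (setCurrent.denote s1) := by
    intro st' s1 hk h7 h36 hstk hpend
    have hk' : BuildKeeps n lo s1 (setCurrent.denote s1) := by
      rw [denote_setCurrent]
      refine ⟨fun r hr => ?_, fun _ _ => rfl⟩
      have h1 : ∀ m, 33 ≤ m ∧ m < 37 ∨ 38 ≤ m → r ≠ m := by omega
      simp [h1]
    have hk2 := hk.trans hk'
    refine ⟨⟨⟨?_, ?_, ?_, ?_⟩, ?_, ?_, ?_, ?_, ?_, ?_, ?_, hlo, by omega, .leaf x, rfl, hpend, hL⟩,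
      hk2⟩
    · rw [hk2.reg 3 (by norm_num), h.framed.1]
    · rw [hk2.reg 4 (by norm_num), h.framed.2]
    · rw [hk2.reg 5 (by norm_num), h.framed.3]
    · rw [hk2.reg 6 (by norm_num), h.framed.4]
    · rw [hk2.reg 2 (by norm_num), h.reg2]
    · simp [denote_setCurrent, h7]
    · simp [denote_setCurrent, RootAt, hk.reg 20 (by norm_num), hk.reg 21 (by norm_num), h20, h21]
    · simp [denote_setCurrent, h36]
    · simp [denote_setCurrent, hk.reg 24 (by norm_num), h24]
    · simp [denote_setCurrent, hk.reg 25 (by norm_num), h25]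
    · rw [denote_setCurrent]; exact hstk
  have hlink : ∀ B : List Plane, ∀ q ∈ [x].getLast?, ∀ r ∈ (A ++ B).head?,
      S.gap q r = S.gap x p := by
    intro B q hq r hr
    rw [List.head?_append_of_ne_nil _ hAne] at hr
    rw [Option.mem_unique hr hpA, ← Option.mem_unique (a := x) (by simp) hq]
  by_cases ht : (Test.and (.le (.const 1) (.reg 36)) (.le (.load topExpr) (.reg 30))).Holds s
  · obtain ⟨g, ts, st, rfl⟩ : ∃ g ts st', st = (g, ts) :: st' := by
      rcases st with _ | ⟨⟨g, ts⟩, st⟩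
      · have h1 := ht.1
        simp only [Test.holds_le, Expr.eval, h.reg36, List.length_nil] at h1
        norm_num at h1
      · exact ⟨g, ts, st, rfl⟩
    obtain ⟨e1, e2⟩ := h.eval_topExpr
    have hg : g = S.gap x p := by
      refine le_antisymm ?_ (hst (g, ts) (by simp))
      have h1 := ht.2
      rw [Test.holds_le, e1] at h1
      rwa [← h30]
    subst hg
    rw [List.length_cons] at hlt
    obtain ⟨-, hst2, hst3⟩ := h.stack
    dsimp only at hst2
    set d := s.mem (4 * n + 2 * st.length + 1) with hd
    have haddr : ⌊4 * (n : ℝ) + 2 * (st.length + 1) - 2 + 1⌋₊ = 4 * n + 2 * st.length + 1 :=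
      natFloor_eq_of_eq_cast (by push_cast; ring)
    have h36 := h.reg36
    rw [List.length_cons, Nat.cast_add_one] at h36
    have hden : linkTop.denote s = ⟨Function.update (Function.update s.reg 43 d) 7 (f + 4),
        Function.update (withRecord s.mem f (s.reg 33) (s.reg 34) (s.reg 35) d)
          (4 * n + 2 * st.length + 1) f⟩ := by
      rw [linkTop, Program.denote_seq, Program.denote_seq, denote_allocProgram (f := f)
        (by simp [h.reg7])]
      simp [topExpr, Expr.eval, h36, h.reg2, h.reg7, haddr, hd]
    have hrec : ∀ a, lo ≤ a → a < f + 4 →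
        Function.update (withRecord s.mem f (s.reg 33) (s.reg 34) (s.reg 35) d)
          (4 * n + 2 * st.length + 1) f a =
        withRecord s.mem f (s.reg 33) (s.reg 34) (s.reg 35) d a :=
      fun a _ _ => Function.update_of_ne (by omega) _ _
    have hold : ∀ a, a < f → a ≠ 4 * n + 2 * st.length + 1 →
        Function.update (withRecord s.mem f (s.reg 33) (s.reg 34) (s.reg 35) d)
          (4 * n + 2 * st.length + 1) f a = s.mem a :=
      fun a ha ha' => by rw [Function.update_of_ne ha', withRecord_of_ne (Or.inl ha)]
    have hk : BuildKeeps n lo s (linkTop.denote s) := by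
      rw [hden]
      refine ⟨fun r hr => ?_, fun a ha => hold a (by omega) (by omega)⟩
      have h1 : ∀ m, m = 7 ∨ 38 ≤ m → r ≠ m := by omega
      simp [h1]
    rw [linkBody, Program.denote_seq, Program.denote_ite, if_pos ht]
    have hmain := hsuff ((S.gap x p, T :: ts) :: st) (linkTop.denote s) hk (by simp [hden])
      (by simp [hden, h36]) ?_ ?_
    · exact ⟨_, hmain.1, hmain.2, by simp⟩
    · rw [hden]
      refine ⟨?_, ?_, ?_⟩
      · dsimp only
        rw [hold _ (by omega) (by omega)]
        exact h.stack.1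
      · dsimp only
        rw [Function.update_self]
        exact (h.root.encodesIn hst2 hlo').congr hrec le_rfl
      · exact hst3.congr (fun a ha ha' => hold a ha' (by omega)) (by omega)
          fun a ha ha' => hold a (by omega) (by omega)
    · have hp := h.pending
      have hlt' := hp.lt_of_mem hAne
      cases hp with
      | cons _ A B L ts st hA' hAB hB hts hp =>
      exact .cons _ [x] (A ++ B) _ _ _ (List.isChain_singleton _) (hlink B)
        (.cons _ A B T ts h.dendro hA' hAB hB) (by simp)
        (hp.cons_point (by rwa [List.head?_append_of_ne_nil _ hAne]) hlt')
  · have hlt' : ∀ e ∈ st, S.gap x p < e.1 := by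
      rcases st with _ | ⟨⟨g, ts⟩, st⟩
      · simp
      · have h1 : S.gap x p < g := by
          by_contra hg
          apply ht
          simp only [Test.holds_and, Test.holds_le, h.eval_topExpr.1]
          simp only [Expr.eval, h.reg36, h30, List.length_cons]
          exact ⟨by simp, not_lt.1 hg⟩
        intro e he
        rcases List.mem_cons.1 he with rfl | he
        · exact h1
        · exact h1.trans (h.pending.lt_of_mem hAne e he)
    have haddr : ⌊4 * (n : ℝ) + 2 * st.length⌋₊ = 4 * n + 2 * st.length :=
      natFloor_eq_of_eq_cast (by push_cast; ring)
    have haddr' : ⌊4 * (n : ℝ) + 2 * st.length + 1⌋₊ = 4 * n + 2 * st.length + 1 :=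
      natFloor_eq_of_eq_cast (by push_cast; ring)
    have hden : linkPush.denote s = ⟨Function.update (Function.update (Function.update s.reg 43 (-1))
        7 (f + 4)) 36 (st.length + 1),
        Function.update (Function.update (withRecord s.mem f (s.reg 33) (s.reg 34) (s.reg 35) (-1))
          (4 * n + 2 * st.length) (S.gap x p)) (4 * n + 2 * st.length + 1) f⟩ := by
      rw [linkPush, Program.denote_seq, Program.denote_seq, denote_allocProgram (f := f)
        (by simp [h.reg7])]
      simp [Expr.eval, h.reg36, h.reg2, h.reg7, haddr, haddr', h30]
    have hrec : ∀ a, lo ≤ a → a < f + 4 →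
        Function.update (Function.update (withRecord s.mem f (s.reg 33) (s.reg 34) (s.reg 35) (-1))
          (4 * n + 2 * st.length) (S.gap x p)) (4 * n + 2 * st.length + 1) f a =
        withRecord s.mem f (s.reg 33) (s.reg 34) (s.reg 35) (-1) a :=
      fun a _ _ => by rw [Function.update_of_ne (by omega), Function.update_of_ne (by omega)]
    have hold : ∀ a, a < f → a < 4 * n + 2 * st.length ∨ 8 * n ≤ a →
        Function.update (Function.update (withRecord s.mem f (s.reg 33) (s.reg 34) (s.reg 35) (-1))
          (4 * n + 2 * st.length) (S.gap x p)) (4 * n + 2 * st.length + 1) f a = s.mem a :=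
      fun a ha ha' => by
        rw [Function.update_of_ne (by omega), Function.update_of_ne (by omega),
          withRecord_of_ne (Or.inl ha)]
    have hk : BuildKeeps n lo s (linkPush.denote s) := by
      rw [hden]
      refine ⟨fun r hr => ?_, fun a ha => hold a (by omega) (by omega)⟩
      have h1 : ∀ m, m = 7 ∨ m = 36 ∨ 38 ≤ m → r ≠ m := by omega
      simp [h1]
    rw [linkBody, Program.denote_seq, Program.denote_ite, if_neg ht]
    have hmain := hsuff ((S.gap x p, [T]) :: st) (linkPush.denote s) hk (by simp [hden])
      (by simp [hden]) ?_ ?_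
    · exact ⟨_, hmain.1, hmain.2, by simp⟩
    · rw [hden]
      refine ⟨?_, ?_, ?_⟩
      · dsimp only
        rw [Function.update_of_ne (by omega), Function.update_self]
      · dsimp only
        rw [Function.update_self]
        exact (h.root.encodesIn .nil hlo').congr hrec le_rfl
      · exact h.stack.congr (fun a ha ha' => hold a ha' (by omega)) (by omega)
          fun a ha ha' => hold a (by omega) (by omega)
    · have hF : Forest S.gap S.nodeCentre (S.gap x p) (A ++ []) [T] :=
        .cons _ A [] T [] h.dendro hA (by simp) (.nil _)
      have hl := hlink []
      rw [List.append_nil] at hF hl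
      exact .cons _ [x] A _ _ _ (List.isChain_singleton _) hl hF (by simp)
        (h.pending.cons_point hpA hlt')

/-- Write the gap between the points of the loaded pair into register `30`. -/
def gapProgram : Program :=
  .ite (.le (.reg 29) (.reg 28)) (.assign 30 (.reg 28)) (.assign 30 (.reg 29)) ;;
  .assign 31 (diffPower (.reg 24) (.reg 24 - .reg 30)) ;;
  .assign 32 (diffPower (.reg 25) (.reg 25 - .reg 30)) ;;
  .ite (.and (.eq (.reg 24 / .reg 30) (.floor (.reg 24 / .reg 30)))
      (.and (.eq (.reg 25 / .reg 30) (.floor (.reg 25 / .reg 30)))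
        (.and (.eq (.reg 31) (.reg 32)) (.le (.reg 31) (.const (1 / 2))))))
    (.assign 30 (.reg 31)) .skip

theorem gapProgram_spec {S : Square} {p q : Plane} {s : State} (h : PairLoaded S p q s) :
    (gapProgram.denote s).reg 30 = S.gap p q ∧ (gapProgram.denote s).mem = s.mem ∧
      ∀ r, r < 30 ∨ 33 ≤ r → (gapProgram.denote s).reg r = s.reg r := by
  have h1 : (Program.ite (.le (.reg 29) (.reg 28)) (.assign 30 (.reg 28))
      (.assign 30 (.reg 29))).denote s = ⟨Function.update s.reg 30
        (max (sep (S.coordY p) (S.coordY q)) (sep (S.coordX p) (S.coordX q))), s.mem⟩ := by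
    simp only [Program.denote_ite, Test.holds_le, Expr.eval, h.sepX, h.sepY, Program.denote_assign]
    split_ifs with h'
    · rw [max_eq_right h']
    · rw [max_eq_left (not_le.1 h').le]
  rw [gapProgram, Program.denote_seq, h1]
  simp only [Square.gap, centreSide]
  generalize max (sep (S.coordY p) (S.coordY q)) (sep (S.coordX p) (S.coordX q)) = σ
  simp only [Program.denote_seq, Program.denote_assign, Program.denote_ite, Program.denote_skip,
    Test.holds_and, Test.holds_eq, Test.holds_le, eval_diffPower, Expr.eval_div, Expr.eval_sub,
    Expr.eval]
  simp only [Function.update_apply, h.coordXp, h.coordYp]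
  norm_num
  split_ifs with h2
  · refine ⟨by simp, rfl, fun r hr => ?_⟩
    have : ∀ m, 30 ≤ m → m < 33 → r ≠ m := by omega
    simp [this]
  · refine ⟨by simp, rfl, fun r hr => ?_⟩
    have : ∀ m, 30 ≤ m → m < 33 → r ≠ m := by omega
    simp [this]

/-- The preparation for the insertion of a point. -/
def buildSetup : Program :=
  .assign 44 (.reg 37) ;; .assign 37 (.reg 37 - .const 1) ;; loadPair 37 44 ;; gapProgram

/-- Insert the point before the points that have been processed. -/
def buildBody : Program := buildSetup ;; closeLoop ;; linkBody

/-- Insert all points but the last one. -/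
def buildLoop : Program := .loop (.le (.const 1) (.reg 37)) buildBody

/-- Make the last point the current tree. -/
def buildInit : Program :=
  .assign 37 (.reg 2 - .const 1) ;; loadPair 37 37 ;; setCurrent ;; .assign 36 (.const 0)

/-- Store the record for the final tree, and write its address into the register `out`. -/
def buildFinal (out : ℕ) : Program :=
  .assign 43 (.const (-1)) ;; allocProgram ;; .assign out (.reg 7) ;; .assign 7 (.reg 7 + .const 4)

/-- Construct the tree for the sorted points; a pointer to it is written into register `out`. -/
def buildProgram (out : ℕ) : Program :=
  buildInit ;; buildLoop ;; finishLoop ;; buildFinal out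

/-- What the insertion of points leaves unchanged. -/
structure BuildFrame (n lo : ℕ) (s s' : State) : Prop where
  reg : ∀ r < 7, s'.reg r = s.reg r
  mem : ∀ a, a < 4 * n ∨ 8 * n ≤ a ∧ a < lo → s'.mem a = s.mem a

theorem BuildFrame.trans {n lo : ℕ} {s s' s'' : State} (h : BuildFrame n lo s s')
    (h' : BuildFrame n lo s' s'') : BuildFrame n lo s s'' :=
  ⟨fun r hr => (h'.reg r hr).trans (h.reg r hr), fun a ha => (h'.mem a ha).trans (h.mem a ha)⟩

theorem BuildKeeps.frame {n lo : ℕ} {s s' : State} (h : BuildKeeps n lo s s') :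
    BuildFrame n lo s s' :=
  ⟨fun r hr => h.reg r (Or.inl hr), h.mem⟩

theorem BuildInv.congr {S : Square} {n lo : ℕ} {p : Plane} {A : List Plane} {T : GTree}
    {st : List (ℝ × List GTree)} {L : List Plane} {f : ℕ} {s s' : State}
    (h : BuildInv S n lo p A T st L f s) (hmem : s'.mem = s.mem)
    (hreg : ∀ r, r < 8 ∨ r = 33 ∨ r = 34 ∨ r = 35 ∨ r = 36 ∨ r = 38 ∨ r = 39 →
      s'.reg r = s.reg r) : BuildInv S n lo p A T st L f s' := by
  refine ⟨⟨?_, ?_, ?_, ?_⟩, ?_, ?_, ?_, ?_, ?_, ?_, ?_, h.le_lo, h.lo_le, h.dendro, h.head,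
    h.pending, h.length⟩
  · rw [hreg 3 (by norm_num), h.framed.1]
  · rw [hreg 4 (by norm_num), h.framed.2]
  · rw [hreg 5 (by norm_num), h.framed.3]
  · rw [hreg 6 (by norm_num), h.framed.4]
  · rw [hreg 2 (by norm_num), h.reg2]
  · rw [hreg 7 (by norm_num), h.reg7]
  · rw [hreg 33 (by norm_num), hreg 34 (by norm_num), hreg 35 (by norm_num), hmem]
    exact h.root
  · rw [hreg 36 (by norm_num), h.reg36]
  · rw [hreg 38 (by norm_num), h.reg38]
  · rw [hreg 39 (by norm_num), h.reg39]
  · rw [hmem]; exact h.stack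

/-- The number of steps for the insertion of a point. -/
def buildCost : ℕ :=
  (Test.le (.const 1) (.reg 37)).cost + 1 + buildSetup.size +
    (Test.and (.le (.const 1) (.reg 36)) (.lt (.load topExpr) (.reg 30))).cost + 1 +
    linkBody.size + popCost

/-- An insertion pushes at most one entry, so adding `popCost` once per point pays for all
completions, however many occur in a single round. -/
theorem buildBody_spec {S : Square} {lo : ℕ} {M : List Plane} {i : ℕ}
    {st : List (ℝ × List GTree)} {f : ℕ} {s : State} (hM : ArrayAt s.mem 0 M)
    (hi : i + 1 < M.length) (h : BuildInv S M.length lo M[i + 1] [M[i + 1]] (.leaf M[i + 1]) st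
      (M.drop (i + 1)) f s) (h37 : s.reg 37 = (i + 1 : ℕ)) :
    ∃ s' st' f' k, Runs buildBody s s' k ∧
      (Test.le (.const 1) (.reg 37)).cost + 1 + k + popCost * st'.length ≤
        popCost * st.length + buildCost ∧
      BuildInv S M.length lo M[i] [M[i]] (.leaf M[i]) st' (M.drop i) f' s' ∧ s'.reg 37 = i ∧
      BuildFrame M.length lo s s' := by
  set s1 : State := ⟨Function.update (Function.update s.reg 44 (i + 1 : ℕ)) 37 (i : ℕ), s.mem⟩
    with hs1
  have hS1 : Framed S s1 := by
    constructor <;> simp [hs1, h.framed.1, h.framed.2, h.framed.3, h.framed.4]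
  obtain ⟨hp, hmem2, hreg2⟩ := loadPair_spec hS1 (a := 37) (b := 44) (i := i) (j := i + 1)
    (by simp [hs1]) (by simp [hs1]) (by norm_num) (by norm_num)
  obtain ⟨h30, hmem3, hreg3⟩ := gapProgram_spec hp
  have hden : buildSetup.denote s = gapProgram.denote ((loadPair 37 44).denote s1) := by
    simp only [buildSetup, Program.denote_seq, Program.denote_assign]
    congr 2
    simp [hs1, Expr.eval, h37]
  rw [← hden] at h30 hmem3 hreg3
  have hmem : (buildSetup.denote s).mem = s.mem := hmem3.trans hmem2
  have hreg : ∀ r, (r < 20 ∨ 33 ≤ r) ∧ r ≠ 37 ∧ r ≠ 44 → (buildSetup.denote s).reg r = s.reg r := by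
    rintro r ⟨hr, hr1, hr2⟩
    rw [hreg3 r (by omega), hreg2 r (by omega)]
    simp [hs1, hr1, hr2]
  have hpi : pointAt s.mem i = M[i] := hM.pointAt (by omega)
  have hpj : pointAt s.mem (i + 1) = M[i + 1] := hM.pointAt hi
  rw [show s1.mem = s.mem from rfl, hpi, hpj] at hp h30
  have hI := h.congr hmem fun r hr => hreg r (by omega)
  obtain ⟨s2, A', T', st', f', k, hrun, hk, hI', hkeep, hA', hst'⟩ :=
    runs_closeLoop hI h30 (List.isChain_singleton _)
  have hold : ∀ r, 20 ≤ r → r < 30 →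
      s2.reg r = ((loadPair 37 44).denote s1).reg r := fun r hr hr' =>
    (hkeep.reg r (by omega)).trans (hreg3 r (by omega))
  obtain ⟨st'', hI'', hkeep', hlen⟩ := linkBody_spec (x := M[i]) hI'
    ((hkeep.reg 30 (by norm_num)).trans h30) hA' hst' (by rw [List.length_drop]; omega)
    ((hold 20 (by norm_num) (by norm_num)).trans hp.px)
    ((hold 21 (by norm_num) (by norm_num)).trans hp.py)
    ((hold 24 (by norm_num) (by norm_num)).trans hp.coordXp)
    ((hold 25 (by norm_num) (by norm_num)).trans hp.coordYp)
  refine ⟨_, st'', f' + 4, _, (runs_denote buildSetup rfl s).seq (hrun.seq (runs_denote linkBody rfl s2)),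
    ?_, ?_, ?_, ?_⟩
  · have := Nat.mul_le_mul_left popCost hlen
    rw [mul_add, mul_one] at this
    rw [buildCost]
    omega
  · rwa [← List.drop_eq_getElem_cons] at hI''
  · rw [hkeep'.reg 37 (by norm_num), hkeep.reg 37 (by norm_num), hreg3 37 (by norm_num),
      hreg2 37 (by norm_num)]
    simp [hs1]
  · refine BuildFrame.trans ⟨fun r hr => hreg r (by omega), fun a _ => by rw [hmem]⟩
      (hkeep.trans hkeep').frame

theorem runs_buildLoop {S : Square} {lo : ℕ} {M : List Plane} {i : ℕ}
    {st : List (ℝ × List GTree)} {f : ℕ} {s : State} (hM : ArrayAt s.mem 0 M)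
    (hi : i < M.length) (h : BuildInv S M.length lo M[i] [M[i]] (.leaf M[i]) st (M.drop i) f s)
    (h37 : s.reg 37 = i) :
    ∃ s' p T st' f' k, Runs buildLoop s s' k ∧
      k + popCost * st'.length ≤ popCost * st.length + buildCost * (i + 1) ∧
      BuildInv S M.length lo p [p] T st' M f' s' ∧ BuildFrame M.length lo s s' := by
  obtain ⟨s', φ, k, hrun, ⟨j, hj, st', f', hI, hj37, hframe, rfl⟩, hn, hk⟩ :=
    runs_loop (t := .le (.const 1) (.reg 37)) (c := buildBody) (fun s' φ => ∃ (j : ℕ)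
      (hj : j < M.length) (st' : List (ℝ × List GTree)) (f' : ℕ),
      BuildInv S M.length lo M[j] [M[j]] (.leaf M[j]) st' (M.drop j) f' s' ∧ s'.reg 37 = j ∧
      BuildFrame M.length lo s s' ∧ φ = popCost * st'.length + buildCost * j)
    (by
      rintro s1 φ ⟨j, hj, st', f', hI, hj37, hframe, rfl⟩ ht
      rcases j with _ | j
      · simp only [Test.holds_le, Expr.eval, hj37] at ht
        norm_num at ht
      have hM1 : ArrayAt s1.mem 0 M := hM.congr fun a _ ha => hframe.mem a (by omega)
      obtain ⟨s2, st2, f2, k, hrun, hk, hI', h37', hframe'⟩ := buildBody_spec hM1 hj hI hj37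
      refine ⟨s2, _, k, hrun, ⟨j, by omega, st2, f2, hI', h37', hframe.trans hframe', rfl⟩, ?_⟩
      rw [mul_add buildCost, mul_one]
      omega)
    s _ ⟨i, hi, st, f, h, h37, ⟨fun _ _ => rfl, fun _ _ => rfl⟩, rfl⟩
  have hj0 : j = 0 := by
    by_contra hj0
    apply hn
    simp only [Test.holds_le, Expr.eval, hj37]
    exact_mod_cast Nat.one_le_iff_ne_zero.2 hj0
  subst hj0
  refine ⟨s', _, _, st', f', k, hrun, ?_, hI, hframe⟩
  have : (Test.le (.const 1) (.reg 37)).cost + 1 ≤ buildCost := by unfold buildCost; omega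
  rw [mul_add buildCost, mul_one]
  omega

theorem buildInit_spec {S : Square} {lo : ℕ} {M : List Plane} {s : State} (hS : Framed S s)
    {i : ℕ} (hM : ArrayAt s.mem 0 M) (hi : i + 1 = M.length) (h2 : s.reg 2 = M.length)
    (h7 : s.reg 7 = lo) (hlo : 8 * M.length ≤ lo) :
    BuildInv S M.length lo M[i] [M[i]] (.leaf M[i]) [] (M.drop i) lo (buildInit.denote s) ∧
      (buildInit.denote s).reg 37 = i ∧ BuildFrame M.length lo s (buildInit.denote s) := by
  obtain ⟨s1, hs1⟩ : ∃ s1 : State, s1 = ⟨Function.update s.reg 37 (i : ℕ), s.mem⟩ := ⟨_, rfl⟩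
  have hmem1 : s1.mem = s.mem := by rw [hs1]
  have h37 : s1.reg 37 = i := by simp [hs1]
  have hreg1 : ∀ r, r ≠ 37 → s1.reg r = s.reg r := fun r hr => by simp [hs1, hr]
  have hS1 : Framed S s1 := by
    constructor <;> simp [hs1, hS.1, hS.2, hS.3, hS.4]
  obtain ⟨hp, hmem, hreg⟩ := loadPair_spec hS1 (a := 37) (b := 37) (i := i) (j := i)
    h37 h37 (by norm_num) (by norm_num)
  rw [hmem1, hM.pointAt (show i < M.length by omega)] at hp
  have hcast : (i : ℝ) = M.length - 1 := by simp [← hi]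
  have hden : buildInit.denote s = ⟨Function.update (setCurrent.denote
      ((loadPair 37 37).denote s1)).reg 36 0, s.mem⟩ := by
    have h1 : (Program.assign 37 (.reg 2 - .const 1)).denote s = s1 := by
      simp [hs1, Expr.eval, h2, hcast]
    simp only [buildInit, Program.denote_seq]
    rw [h1]
    simp [denote_setCurrent, Expr.eval, hmem, hmem1]
  rw [denote_setCurrent] at hden
  have hr : ∀ r, r < 20 → (buildInit.denote s).reg r = s.reg r := by
    intro r hr
    have h1 : ∀ m, 20 ≤ m → r ≠ m := by omega
    rw [hden]
    simp [h1, hreg r (Or.inl hr), hreg1]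
  have hm : (buildInit.denote s).mem = s.mem := by rw [hden]
  refine ⟨⟨⟨?_, ?_, ?_, ?_⟩, ?_, ?_, ?_, ?_, ?_, ?_, trivial, hlo, le_rfl, .leaf _, rfl, ?_, ?_⟩,
    ?_, ⟨fun r h => hr r (by omega), fun a _ => by rw [hm]⟩⟩
  · rw [hr 3 (by norm_num), hS.1]
  · rw [hr 4 (by norm_num), hS.2]
  · rw [hr 5 (by norm_num), hS.3]
  · rw [hr 6 (by norm_num), hS.4]
  · rw [hr 2 (by norm_num), h2]
  · rw [hr 7 (by norm_num), h7]
  · rw [hden]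
    simp [RootAt, hp.px, hp.py]
  · rw [hden]
    simp
  · rw [hden]
    simp [hp.coordXp]
  · rw [hden]
    simp [hp.coordYp]
  · rw [List.drop_eq_getElem_cons (show i < M.length by omega),
      List.drop_eq_nil_of_le (show M.length ≤ i + 1 by omega)]
    exact .nil _
  · rw [List.length_drop]
    omega
  · rw [hden]
    simp [hreg 37 (by norm_num), h37]

/-- The number of steps for the construction of a tree, divided by the number of points. -/
def buildTotal (out : ℕ) : ℕ := buildInit.size + buildCost + popCost + (buildFinal out).size

/-- Scanning from right to left lets children be prepended to linked lists, and the point read last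
is the first leaf of its block. The stack lies between the cells 4n and 8n and new records start at
`lo`, so the points and older records survive. -/
theorem runs_buildProgram {S : Square} {lo : ℕ} {M : List Plane} {s : State} {out : ℕ}
    (hout : out < 2) (hS : Framed S s) (hM : ArrayAt s.mem 0 M) (hpos : 0 < M.length)
    (h2 : s.reg 2 = M.length) (h7 : s.reg 7 = lo) (hlo : 8 * M.length ≤ lo) :
    ∃ s' T f, Runs (buildProgram out) s s' (buildTotal out * (M.length + 1)) ∧
      Dendro S.gap S.nodeCentre M T ∧ EncodesIn s'.mem lo f (s'.reg out) [T] ∧ s'.reg 7 = f ∧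
      lo ≤ f ∧ (∀ r < 7, r ≠ out → s'.reg r = s.reg r) ∧
      ∀ a, a < 4 * M.length ∨ 8 * M.length ≤ a ∧ a < lo → s'.mem a = s.mem a := by
  obtain ⟨i, hi⟩ : ∃ i, i + 1 = M.length := ⟨M.length - 1, by omega⟩
  obtain ⟨hI, h37, hframe⟩ := buildInit_spec hS hM hi h2 h7 hlo
  have hM1 : ArrayAt (buildInit.denote s).mem 0 M :=
    hM.congr fun a _ ha => hframe.mem a (by omega)
  obtain ⟨s2, p, T2, st, f2, k, hrun2, hk, hI2, hframe2⟩ :=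
    runs_buildLoop hM1 (by omega) hI h37
  obtain ⟨s3, T, f, hrun3, hI3, hkeep3⟩ := runs_finishLoop hI2
  have hlof := hI3.lo_le
  have hfr := (hframe.trans hframe2).trans hkeep3.frame
  have hden : (buildFinal out).denote s3 = ⟨Function.update (Function.update (Function.update s3.reg
      43 (-1)) out f) 7 (f + 4), withRecord s3.mem f (s3.reg 33) (s3.reg 34) (s3.reg 35) (-1)⟩ := by
    rw [buildFinal, Program.denote_seq, Program.denote_seq, denote_allocProgram (f := f)
      (by simp [hI3.reg7])]
    have : 7 ≠ out := by omega
    simp [Expr.eval, hI3.reg7, this]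
  refine ⟨(buildFinal out).denote s3, T, f + 4, Runs.mono ((runs_denote buildInit rfl s).seq
    (hrun2.seq (hrun3.seq (runs_denote (buildFinal out) rfl s3)))) ?_, hI3.dendro, ?_, ?_, by omega,
    ?_, ?_⟩
  · rw [hi, List.length_nil, mul_zero, zero_add] at hk
    have h3 : buildInit.size + (buildFinal out).size ≤
        (buildInit.size + (buildFinal out).size) * (M.length + 1) :=
      Nat.le_mul_of_pos_right _ (by omega)
    have h4 : buildCost * M.length ≤ buildCost * (M.length + 1) :=
      Nat.mul_le_mul_left _ (by omega)
    have h5 : popCost * (st.length + 1) ≤ popCost * st.length + popCost * (M.length + 1) := by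
      rw [mul_add popCost st.length, mul_one]
      exact Nat.add_le_add_left (Nat.le_mul_of_pos_right _ (by omega)) _
    rw [buildTotal]
    have h6 : (buildInit.size + buildCost + popCost + (buildFinal out).size) * (M.length + 1) =
      (buildInit.size + (buildFinal out).size) * (M.length + 1) + buildCost * (M.length + 1) +
        popCost * (M.length + 1) := by ring
    rw [h6]
    omega
  · rw [hden]
    have h1 : out ≠ 7 := by omega
    simpa [h1] using hI3.root.encodesIn .nil hlof
  · rw [hden]
    simp
  · intro r hr hro
    rw [hden, ← hfr.reg r hr]
    have h1 : r ≠ 7 := by omega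
    have h2 : r ≠ 43 := by omega
    simp [h1, h2, hro]
  · intro a ha
    rw [hden, ← hfr.mem a ha]
    exact withRecord_of_ne (Or.inl (by omega))

/-- Sort the points and construct the tree for the current square. -/
def treeProgram (out : ℕ) : Program := sortProgram ;; buildProgram out

/-- A bound for the number of steps of `treeProgram`. -/
def treeCost (out n : ℕ) : ℕ :=
  sortCost * ((n + 1) * (Nat.clog 2 n + 1)) + buildTotal out * (n + 1)

/-- Sorting only permutes the points and uses the first 4n cells, so the program can be run again
for another square while the records of a first tree stay below `lo`. -/
theorem runs_treeProgram {S : Square} {lo : ℕ} {L : List Plane} {s : State} {out : ℕ}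
    (hout : out < 2) (hS : Framed S s) (hu : ∀ p ∈ L, S.InUnit p) (hL : ArrayAt s.mem 0 L)
    (hpos : 0 < L.length) (h2 : s.reg 2 = L.length) (h7 : s.reg 7 = lo) (hlo : 8 * L.length ≤ lo) :
    ∃ s' M T f, Runs (treeProgram out) s s' (treeCost out L.length) ∧ M.Perm L ∧
      M.Pairwise S.ZLe ∧ ArrayAt s'.mem 0 M ∧
      Dendro S.gap S.nodeCentre M T ∧ EncodesIn s'.mem lo f (s'.reg out) [T] ∧ s'.reg 7 = f ∧
      lo ≤ f ∧ (∀ r < 7, r ≠ out → s'.reg r = s.reg r) ∧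
      ∀ a, 8 * L.length ≤ a ∧ a < lo → s'.mem a = s.mem a := by
  obtain ⟨s1, M, hrun1, hkeep, hM, hsort, hperm⟩ := runs_sortProgram hS hu h2 hL
  have hlen := hperm.length_eq
  obtain ⟨s2, T, f, hrun2, hT, henc, hf, hlof, hreg, hmem⟩ := runs_buildProgram hout
    (hS.of_keeps hkeep (by norm_num)) hM (by omega)
    (by rw [hkeep.reg 2 (by norm_num), h2, hlen]) ((hkeep.reg 7 (by norm_num)).trans h7) (by omega)
  rw [hlen] at hrun2 hmem
  refine ⟨s2, M, T, f, hrun1.seq hrun2, hperm, hsort, ?_, hT, henc, hf, hlof, ?_, ?_⟩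
  · exact hM.congr fun a _ ha => hmem a (by omega)
  · intro r hr hro
    rw [hreg r hr hro, hkeep.reg r (by omega)]
  · intro a ha
    rw [hmem a (Or.inr ha), hkeep.mem a (by omega)]

/-! ### The smallest enclosing square -/

theorem Square.mem_carrier_axis {c p : Plane} {h : ℝ} (hh : 0 ≤ h) :
    p ∈ (Square.axis c h).carrier ↔ |p 0 - c 0| ≤ h ∧ |p 1 - c 1| ≤ h := by
  constructor
  · rintro ⟨a, b, ha, hb, rfl⟩
    simp only [axis, perp, PiLp.add_apply, PiLp.smul_apply, smul_eq_mul]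
    constructor
    · simpa [abs_mul, abs_of_nonneg hh] using mul_le_mul_of_nonneg_right ha hh
    · simpa [abs_mul, abs_of_nonneg hh] using mul_le_mul_of_nonneg_right hb hh
  · rintro ⟨h0, h1⟩
    have hdiv : ∀ x : ℝ, |x| ≤ h → |x / h| ≤ 1 ∧ x / h * h = x := by
      intro x hx
      refine ⟨?_, ?_⟩
      · rw [abs_div, abs_of_nonneg hh]
        exact div_le_one_of_le₀ hx hh
      · rcases hh.eq_or_lt with rfl | hh
        · simpa using (abs_nonpos_iff.1 hx).symm
        · exact div_mul_cancel₀ _ hh.ne'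
    refine ⟨(p 0 - c 0) / h, (p 1 - c 1) / h, (hdiv _ h0).1, (hdiv _ h1).1, ?_⟩
    ext l
    fin_cases l
    · simp [axis, perp, (hdiv _ h0).2]
    · simp [axis, perp, (hdiv _ h1).2]

/-- The factor √2 cancels the cosine and sine of π/4, so the machine can set up the blue square
without roots or trigonometric functions. -/
theorem Square.blue_axis (c : Plane) (h : ℝ) : (Square.axis c h).blue = ⟨c, !₂[h, h]⟩ := by
  have h2 : √2 * (√2 / 2 * h) = h := by
    rw [← mul_assoc, ← mul_div_assoc, Real.mul_self_sqrt (by norm_num)]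
    ring
  simp only [blue, axis, Square.mk.injEq, true_and]
  ext l
  fin_cases l <;> simp [rot, h2]

/-- In the rotated frame the coordinates a, b become (a + b)/2 and (b - a)/2, again of absolute
value at most 1. So the points have blue coordinates in the unit square. -/
theorem Square.carrier_axis_subset_blue (c : Plane) (h : ℝ) :
    (Square.axis c h).carrier ⊆ (Square.axis c h).blue.carrier := by
  rintro p ⟨a, b, ha, hb, rfl⟩
  rw [blue_axis]
  rw [abs_le] at ha hb
  refine ⟨(a + b) / 2, (b - a) / 2, abs_le.2 ⟨by linarith, by linarith⟩,
    abs_le.2 ⟨by linarith, by linarith⟩, ?_⟩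
  ext l
  fin_cases l
  · simp [axis, perp]
    ring
  · simp [axis, perp]
    ring

-- Extremes of the coordinates and the bounding box

/-- The numbers `lo` and `hi` are the least and the greatest value of `f` on the list. -/
structure ExtremesOn (f : Plane → ℝ) (L : List Plane) (lo hi : ℝ) : Prop where
  lo_le : ∀ p ∈ L, lo ≤ f p
  le_hi : ∀ p ∈ L, f p ≤ hi
  lo_mem : ∃ p ∈ L, f p = lo
  hi_mem : ∃ p ∈ L, f p = hi

theorem ExtremesOn.concat {f : Plane → ℝ} {L : List Plane} {lo hi : ℝ} (h : ExtremesOn f L lo hi)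
    (q : Plane) : ExtremesOn f (L ++ [q]) (min lo (f q)) (max hi (f q)) := by
  obtain ⟨h1, h2, ⟨a, ha, ha'⟩, ⟨b, hb, hb'⟩⟩ := h
  refine ⟨?_, ?_, ?_, ?_⟩
  · intro p hp
    rcases List.mem_append.1 hp with hp | hp
    · exact (min_le_left _ _).trans (h1 p hp)
    · rw [List.mem_singleton.1 hp]
      exact min_le_right _ _
  · intro p hp
    rcases List.mem_append.1 hp with hp | hp
    · exact (h2 p hp).trans (le_max_left _ _)
    · rw [List.mem_singleton.1 hp]
      exact le_max_right _ _
  · rcases min_choice lo (f q) with h | h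
    · exact ⟨a, by simp [ha], by rw [h, ha']⟩
    · exact ⟨q, by simp, h.symm⟩
  · rcases max_choice hi (f q) with h | h
    · exact ⟨b, by simp [hb], by rw [h, hb']⟩
    · exact ⟨q, by simp, h.symm⟩

/-- Both extremes of either coordinate are attained, so each side of the bounding box is a lower
bound for the side of an enclosing square; the longer one suffices for the square centred at the
box. -/
theorem ExtremesOn.isSmallestAxisSquare {L : List Plane} {x₀ x₁ y₀ y₁ : ℝ}
    (hx : ExtremesOn (fun p => p 0) L x₀ x₁) (hy : ExtremesOn (fun p => p 1) L y₀ y₁) :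
    IsSmallestAxisSquare {p | p ∈ L} !₂[(x₀ + x₁) / 2, (y₀ + y₁) / 2]
      (max ((x₁ - x₀) / 2) ((y₁ - y₀) / 2)) := by
  obtain ⟨p, hp, -⟩ := hx.lo_mem
  have h0 : 0 ≤ max ((x₁ - x₀) / 2) ((y₁ - y₀) / 2) := by
    have h1 := hx.lo_le p hp
    have h2 := hx.le_hi p hp
    exact le_max_of_le_left (by linarith)
  refine ⟨h0, ?_, ?_⟩
  · intro q hq
    have h1 := hx.lo_le q hq
    have h2 := hx.le_hi q hq
    have h3 := hy.lo_le q hq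
    have h4 := hy.le_hi q hq
    dsimp only at h1 h2 h3 h4
    rw [Square.mem_carrier_axis h0]
    constructor
    · refine le_trans (abs_le.2 ⟨?_, ?_⟩) (le_max_left _ _)
      · simp only [Matrix.cons_val_zero]
        linarith
      · simp only [Matrix.cons_val_zero]
        linarith
    · refine le_trans (abs_le.2 ⟨?_, ?_⟩) (le_max_right _ _)
      · simp only [Matrix.cons_val_one, Matrix.cons_val_fin_one]
        linarith
      · simp only [Matrix.cons_val_one, Matrix.cons_val_fin_one]
        linarith
  · intro c h hh hsub
    have hmem : ∀ q ∈ L, |q 0 - c 0| ≤ h ∧ |q 1 - c 1| ≤ h := fun q hq =>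
      (Square.mem_carrier_axis hh).1 (hsub hq)
    obtain ⟨a, ha, ha'⟩ := hx.lo_mem
    obtain ⟨b, hb, hb'⟩ := hx.hi_mem
    obtain ⟨d, hd, hd'⟩ := hy.lo_mem
    obtain ⟨e, he, he'⟩ := hy.hi_mem
    have h1 := abs_le.1 (hmem a ha).1
    have h2 := abs_le.1 (hmem b hb).1
    have h3 := abs_le.1 (hmem d hd).2
    have h4 := abs_le.1 (hmem e he).2
    dsimp only at ha' hb' hd' he'
    exact max_le (by linarith) (by linarith)

/-- Replace the register `i` by its minimum with the register `j`. -/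
def minReg (i j : ℕ) : Program := .ite (.le (.reg i) (.reg j)) .skip (.assign i (.reg j))

/-- Replace the register `i` by its maximum with the register `j`. -/
def maxReg (i j : ℕ) : Program := .ite (.le (.reg j) (.reg i)) .skip (.assign i (.reg j))

theorem denote_minReg (i j : ℕ) (s : State) :
    (minReg i j).denote s = ⟨Function.update s.reg i (min (s.reg i) (s.reg j)), s.mem⟩ := by
  simp only [minReg, Program.denote_ite, Program.denote_skip, Program.denote_assign, Test.holds_le,
    Expr.eval]
  split_ifs with h
  · rw [min_eq_left h, Function.update_eq_self]
  · rw [min_eq_right (not_le.1 h).le]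

theorem denote_maxReg (i j : ℕ) (s : State) :
    (maxReg i j).denote s = ⟨Function.update s.reg i (max (s.reg i) (s.reg j)), s.mem⟩ := by
  simp only [maxReg, Program.denote_ite, Program.denote_skip, Program.denote_assign, Test.holds_le,
    Expr.eval]
  split_ifs with h
  · rw [max_eq_left h, Function.update_eq_self]
  · rw [max_eq_right (not_le.1 h).le]

/-- Start with the bounding box of the first point. -/
def boxInit : Program :=
  .assign 2 (.reg 0) ;; .assign 8 (.const 1) ;; .assign 10 (.load (.const 0)) ;;
  .assign 11 (.load (.const 0)) ;; .assign 12 (.load (.const 1)) ;; .assign 13 (.load (.const 1))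

/-- Extend the bounding box by the next point. -/
def boxBody : Program :=
  .assign 14 (.load (.const 2 * .reg 8)) ;; .assign 15 (.load (.const 2 * .reg 8 + .const 1)) ;;
  minReg 10 14 ;; maxReg 11 14 ;; minReg 12 15 ;; maxReg 13 15 ;; .assign 8 (.reg 8 + .const 1)

/-- The computation of the bounding box. -/
def boxLoop : Program := .loop (.lt (.reg 8) (.reg 2)) boxBody

/-- Determine the smallest square that encloses the bounding box. -/
def boxSquare : Program :=
  .assign 3 ((.reg 10 + .reg 11) / .const 2) ;; .assign 4 ((.reg 12 + .reg 13) / .const 2) ;;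
  .assign 5 ((.reg 11 - .reg 10) / .const 2) ;; .assign 6 ((.reg 13 - .reg 12) / .const 2) ;;
  maxReg 5 6 ;; .assign 6 (.const 0) ;; .assign 7 (.const 8 * .reg 2)

/-- Compute the smallest enclosing square, and prepare the construction of the trees. -/
def boxProgram : Program := boxInit ;; boxLoop ;; boxSquare

/-- The number of steps of `boxProgram`, divided by the number of points. -/
def boxCost : ℕ := boxInit.size + (Test.lt (.reg 8) (.reg 2)).cost + 1 + boxBody.size + boxSquare.size

/-- The invariant of the computation of the bounding box: the first `i` points are processed. -/
structure BoxInv (L : List Plane) (i : ℕ) (s : State) : Prop where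
  pos : 1 ≤ i
  le_length : i ≤ L.length
  reg2 : s.reg 2 = L.length
  reg8 : s.reg 8 = i
  extremes_x : ExtremesOn (fun p => p 0) (L.take i) (s.reg 10) (s.reg 11)
  extremes_y : ExtremesOn (fun p => p 1) (L.take i) (s.reg 12) (s.reg 13)
  array : ArrayAt s.mem 0 L

theorem boxBody_spec {L : List Plane} {i : ℕ} {s : State} (h : BoxInv L i s) (hi : i < L.length) :
    BoxInv L (i + 1) (boxBody.denote s) := by
  have haddr : ⌊2 * (i : ℝ)⌋₊ = 2 * i := natFloor_eq_of_eq_cast (by push_cast; ring)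
  have haddr' : ⌊2 * (i : ℝ) + 1⌋₊ = 2 * i + 1 := natFloor_eq_of_eq_cast (by push_cast; ring)
  have hpt := h.array i hi
  rw [zero_add] at hpt
  have hden : boxBody.denote s = ⟨Function.update (Function.update (Function.update (Function.update
      (Function.update (Function.update (Function.update s.reg 14 (L[i] 0)) 15 (L[i] 1))
        10 (min (s.reg 10) (L[i] 0))) 11 (max (s.reg 11) (L[i] 0))) 12 (min (s.reg 12) (L[i] 1)))
        13 (max (s.reg 13) (L[i] 1))) 8 (i + 1), s.mem⟩ := by
    simp [boxBody, denote_minReg, denote_maxReg, Expr.eval, h.reg8, haddr, haddr', hpt.1, hpt.2]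
  rw [hden]
  refine ⟨by omega, hi, ?_, ?_, ?_, ?_, h.array⟩
  · simp [h.reg2]
  · simp
  · simpa [List.take_succ_eq_append_getElem hi, -List.take_append_getElem] using
      h.extremes_x.concat L[i]
  · simpa [List.take_succ_eq_append_getElem hi, -List.take_append_getElem] using
      h.extremes_y.concat L[i]

theorem runs_boxProgram {L : List Plane} {s : State} (hL : ArrayAt s.mem 0 L) (hpos : 0 < L.length)
    (h0 : s.reg 0 = L.length) :
    ∃ s' c h, Runs boxProgram s s' (boxCost * (L.length + 1)) ∧
      IsSmallestAxisSquare {p | p ∈ L} c h ∧ Framed (Square.axis c h) s' ∧ s'.reg 2 = L.length ∧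
      s'.reg 7 = (8 * L.length : ℕ) ∧ ArrayAt s'.mem 0 L := by
  have hpt := hL 0 hpos
  simp only [mul_zero, zero_add] at hpt
  have hinit : BoxInv L 1 (boxInit.denote s) := by
    have hden : boxInit.denote s = ⟨Function.update (Function.update (Function.update
        (Function.update (Function.update (Function.update s.reg 2 L.length) 8 1)
          10 (L[0] 0)) 11 (L[0] 0)) 12 (L[0] 1)) 13 (L[0] 1), s.mem⟩ := by
      simp [boxInit, Expr.eval, h0, hpt.1, hpt.2]
    have htake : L.take 1 = [L[0]] := by
      rw [List.take_one, List.head?_eq_getElem?, List.getElem?_eq_getElem hpos]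
      rfl
    rw [hden]
    refine ⟨le_rfl, hpos, ?_, ?_, ?_, ?_, hL⟩
    · simp
    · simp
    · rw [htake]
      constructor <;> simp
    · rw [htake]
      constructor <;> simp
  obtain ⟨s1, φ, k, hrun, ⟨i, hI, rfl⟩, hn, hk⟩ :=
    runs_loop (t := .lt (.reg 8) (.reg 2)) (c := boxBody) (fun s' φ => ∃ i, BoxInv L i s' ∧
      φ = ((Test.lt (.reg 8) (.reg 2)).cost + 1 + boxBody.size) * (L.length - i))
    (by
      rintro s1 φ ⟨i, hI, rfl⟩ ht
      have hi : i < L.length := by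
        simpa only [Test.holds_lt, Expr.eval, hI.reg8, hI.reg2, Nat.cast_lt] using ht
      refine ⟨_, _, _, runs_denote boxBody rfl s1, ⟨i + 1, boxBody_spec hI hi, rfl⟩, ?_⟩
      rw [show L.length - i = L.length - (i + 1) + 1 by omega, mul_add _ _ 1, mul_one]
      omega)
    (boxInit.denote s) _ ⟨1, hinit, rfl⟩
  have hi : i = L.length := by
    refine le_antisymm hI.le_length ?_
    simpa only [Test.holds_lt, Expr.eval, hI.reg8, hI.reg2, Nat.cast_lt, not_lt] using hn
  subst hi
  have hx := hI.extremes_x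
  have hy := hI.extremes_y
  rw [List.take_length] at hx hy
  have hden : boxSquare.denote s1 = ⟨Function.update (Function.update (Function.update
      (Function.update (Function.update (Function.update (Function.update s1.reg
        3 ((s1.reg 10 + s1.reg 11) / 2)) 4 ((s1.reg 12 + s1.reg 13) / 2))
        5 ((s1.reg 11 - s1.reg 10) / 2)) 6 ((s1.reg 13 - s1.reg 12) / 2))
        5 (max ((s1.reg 11 - s1.reg 10) / 2) ((s1.reg 13 - s1.reg 12) / 2))) 6 0)
        7 (8 * L.length), s1.mem⟩ := by
    simp [boxSquare, denote_maxReg, Expr.eval, hI.reg2]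
  refine ⟨_, _, _, Runs.mono ((runs_denote boxInit rfl s).seq (hrun.seq (runs_denote boxSquare rfl s1))) ?_,
    hx.isSmallestAxisSquare hy, ?_, ?_, ?_, ?_⟩
  · have h2 : ((Test.lt (.reg 8) (.reg 2)).cost + 1 + boxBody.size) * (L.length - 1) ≤
      ((Test.lt (.reg 8) (.reg 2)).cost + 1 + boxBody.size) * L.length :=
      Nat.mul_le_mul_left _ (by omega)
    have h3 : boxInit.size + boxSquare.size ≤ (boxInit.size + boxSquare.size) * L.length :=
      Nat.le_mul_of_pos_right _ hpos
    have h4 : boxCost * (L.length + 1) = (boxInit.size + boxSquare.size) * L.length +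
      ((Test.lt (.reg 8) (.reg 2)).cost + 1 + boxBody.size) * L.length + boxCost := by
      rw [boxCost]
      ring
    rw [h4, boxCost]
    omega
  · rw [hden]
    constructor <;> simp [Square.axis]
  · simp [hden, hI.reg2]
  · simp [hden]
  · rw [hden]
    exact hI.array

/-! ### The two trees -/

/-- A single point goes with the degenerate square, where the tree is a leaf. Otherwise the arm is
nonzero, and since the points are distinct the weak order is strict. -/
theorem isCompressedQuadtree_of_sorted {S : Square} {L M : List Plane} {T : GTree}
    (hnd : L.Nodup) (hu : ∀ p ∈ L, S.InUnit p) (harm : S.arm = 0 ↔ L.length = 1)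
    (hpos : 0 < L.length) (hperm : M.Perm L) (hsort : M.Pairwise S.ZLe)
    (hT : Dendro S.gap S.nodeCentre M T) : IsCompressedQuadtree S {p | p ∈ L} T := by
  have hset : {p | p ∈ L} = {p | p ∈ M} := Set.ext fun p => hperm.mem_iff.symm
  rw [hset]
  rcases (show L.length = 1 ∨ 2 ≤ L.length by omega) with h1 | h2
  · obtain ⟨p, rfl⟩ := List.length_eq_one_iff.1 (hperm.length_eq.trans h1)
    rw [hT.eq_leaf]
    simpa using isCompressedQuadtree_singleton (harm.2 h1) p
  · have hS : S.arm ≠ 0 := fun h => by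
      have := harm.1 h
      omega
    have huM : ∀ p ∈ M, S.InUnit p := fun p hp => hu p (hperm.mem_iff.1 hp)
    refine Square.isCompressedQuadtree hS huM ?_ (h2.trans hperm.length_eq.ge) hT
    exact ((hperm.nodup_iff.2 hnd).and hsort).imp_of_mem fun {p q} hp hq h =>
      h.2.lt hS (huM p hp) (huM q hq) h.1

theorem arrayAt_inputState {n : ℕ} (p : Fin n → Plane) :
    ArrayAt (inputState p).mem 0 (List.ofFn p) := by
  intro i hi
  rw [List.length_ofFn] at hi
  have h1 : 2 * i / 2 = i := by omega
  have h2 : (2 * i + 1) / 2 = i := by omega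
  have h3 : (2 * i + 1) % 2 ≠ 0 := by omega
  simp [inputState, h1, h2, hi]

/-- For n ≥ 2 write the rounded-up logarithm as k + 1, where 2^k ≤ n. From log 2 ≥ 1/2 one gets k +
2 ≤ 6 log n, and n + 1 ≤ 2n gives the factor 12. The summand 1 on the right covers n = 1. -/
theorem succ_mul_clog_le (n : ℕ) (hn : 1 ≤ n) :
    (((n + 1) * (Nat.clog 2 n + 1) : ℕ) : ℝ) ≤ 12 * (n * Real.log n + 1) := by
  rcases hn.eq_or_lt with rfl | hn
  · norm_num
  have hn' : (2 : ℝ) ≤ n := by exact_mod_cast hn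
  have hlog2 : (1 / 2 : ℝ) ≤ Real.log 2 := by linarith [Real.log_two_gt_d9]
  have hlogn : Real.log 2 ≤ Real.log n := Real.log_le_log (by norm_num) hn'
  obtain ⟨k, hk⟩ : ∃ k, Nat.clog 2 n = k + 1 :=
    Nat.exists_eq_succ_of_ne_zero (Nat.clog_pos (by norm_num) hn).ne'
  have hpow : (2 : ℝ) ^ k ≤ n := by
    have := Nat.pow_pred_clog_lt_self (b := 2) (by norm_num) hn
    rw [hk] at this
    exact_mod_cast this.le
  have hle : k * Real.log 2 ≤ Real.log n := by
    rw [← Real.log_pow]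
    exact Real.log_le_log (by positivity) hpow
  have hk' : (k : ℝ) ≤ 2 * Real.log n := by nlinarith [Nat.cast_nonneg (α := ℝ) k]
  rw [hk]
  push_cast
  calc ((n : ℝ) + 1) * (k + 1 + 1) ≤ 2 * n * (6 * Real.log n) := by
        gcongr
        · linarith
        · linarith
    _ ≤ 12 * (n * Real.log n + 1) := by linarith

/-- The construction of both trees. -/
def coverProgram : Program :=
  boxProgram ;; treeProgram 0 ;; .assign 6 (.reg 5) ;; treeProgram 1

/-- The number of steps of `coverProgram`, divided by the running time bound. -/
def coverCost : ℕ := boxCost + sortCost + buildTotal 0 + 2 + sortCost + buildTotal 1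

theorem runs_coverProgram {n : ℕ} (p : Fin n → Plane) (hn : 1 ≤ n) (hp : Function.Injective p) :
    ∃ s, Runs coverProgram (inputState p) s (coverCost * ((n + 1) * (Nat.clog 2 n + 1))) ∧
      ∃ c h, IsSmallestAxisSquare (Set.range p) c h ∧
        ∃ (M N : List Plane) (R B : GTree), M.length = n ∧ N.length = n ∧
          IsCompressedQuadtree (Square.axis c h) (Set.range p) R ∧
          IsCompressedQuadtree (Square.axis c h).blue (Set.range p) B ∧
          Encodes s.mem (s.reg 0) [R] ∧ Encodes s.mem (s.reg 1) [B] ∧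
          Dendro (Square.axis c h).gap (Square.axis c h).nodeCentre M R ∧
          Dendro (Square.axis c h).blue.gap (Square.axis c h).blue.nodeCentre N B := by
  obtain ⟨L, hL⟩ : ∃ L, L = List.ofFn p := ⟨_, rfl⟩
  have hlen : L.length = n := by rw [hL, List.length_ofFn]
  have hnd : L.Nodup := by rw [hL]; exact List.nodup_ofFn.2 hp
  have hset : {q | q ∈ L} = Set.range p := by
    ext q
    rw [hL, Set.mem_ofPred_eq, List.mem_ofFn']
  have hA : ArrayAt (inputState p).mem 0 L := hL ▸ arrayAt_inputState p
  clear hL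
  subst hlen
  obtain ⟨s1, c, h, hrun1, hbox, hS1, h2, h7, hA1⟩ := runs_boxProgram hA hn (by simp [inputState])
  have hmem : ∀ q ∈ L, q ∈ (Square.axis c h).carrier := fun q hq => hbox.2.1 hq
  -- A square of side 0 contains only its centre, and the points are distinct.
  have hh : h = 0 ↔ L.length = 1 := by
    constructor
    · rintro rfl
      have hc : ∀ q ∈ L, q = c := by
        intro q hq
        have := (Square.mem_carrier_axis le_rfl).1 (hmem q hq)
        ext l
        fin_cases l
        · exact sub_eq_zero.1 (abs_nonpos_iff.1 this.1)
        · exact sub_eq_zero.1 (abs_nonpos_iff.1 this.2)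
      have h1 := List.nodup_replicate.1 (List.eq_replicate_of_mem hc ▸ hnd)
      omega
    · intro h1
      obtain ⟨q, rfl⟩ := List.length_eq_one_iff.1 h1
      refine le_antisymm (hbox.2.2 q 0 le_rfl ?_) hbox.1
      intro r hr
      rw [Square.mem_carrier_axis le_rfl]
      simp [List.mem_singleton.1 hr]
  have harm : (Square.axis c h).arm = 0 ↔ L.length = 1 := by
    rw [← hh]
    constructor
    · intro h0
      simpa [Square.axis] using congrFun (congrArg WithLp.ofLp h0) 0
    · rintro rfl
      ext l
      fin_cases l <;> rfl
  have harm' : (Square.axis c h).blue.arm = 0 ↔ L.length = 1 := by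
    rw [← hh, Square.blue_axis]
    constructor
    · intro h0
      simpa using congrFun (congrArg WithLp.ofLp h0) 0
    · rintro rfl
      ext l
      fin_cases l <;> rfl
  have hu : ∀ q ∈ L, (Square.axis c h).InUnit q := fun q hq =>
    Square.inUnit_of_mem_carrier (hmem q hq)
  have hu' : ∀ q ∈ L, (Square.axis c h).blue.InUnit q := fun q hq =>
    Square.inUnit_of_mem_carrier (Square.carrier_axis_subset_blue c h (hmem q hq))
  obtain ⟨s2, M, R, f, hrun2, hM, hsort, hA2, hR, henc, hf, hlf, hreg2, -⟩ :=
    runs_treeProgram (out := 0) (by norm_num) hS1 hu hA1 hn h2 h7 le_rfl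
  obtain ⟨s3, hs3⟩ : ∃ s3, s3 = (Program.assign 6 (.reg 5)).denote s2 := ⟨_, rfl⟩
  have hS3 : Framed (Square.axis c h).blue s3 := by
    rw [hs3, Square.blue_axis]
    constructor <;> simp [Expr.eval, hreg2, hS1.1, hS1.2, hS1.3, Square.axis]
  have hmem3 : s3.mem = s2.mem := by rw [hs3]; rfl
  have hreg3 : ∀ r, r ≠ 6 → s3.reg r = s2.reg r := fun r hr => by simp [hs3, hr]
  have hlenM := hM.length_eq
  -- The second run starts from the sorted list of the first one and writes its records from f on,
  -- so the red records remain intact.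
  obtain ⟨s4, N, B, f', hrun4, hN, hsort', -, hB, henc', -, -, hreg4, hmem4⟩ :=
    runs_treeProgram (out := 1) (L := M) (lo := f) (s := s3) (by norm_num) hS3
      (fun q hq => hu' q (hM.mem_iff.1 hq)) (by rw [hmem3]; exact hA2) (by omega)
      (by rw [hreg3 2 (by norm_num), hreg2 2 (by norm_num) (by norm_num), h2, hlenM])
      (by rw [hreg3 7 (by norm_num), hf]) (by omega)
  have hrun3 : Runs (.assign 6 (.reg 5)) s2 s3 2 := hs3 ▸ runs_denote _ rfl s2
  refine ⟨s4, Runs.mono (hrun1.seq (hrun2.seq (hrun3.seq hrun4))) ?_, c, h,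
    hset ▸ hbox, M, N, R, B, hlenM, (hN.trans hM).length_eq, ?_, ?_, ?_, henc'.encodes, hR, hB⟩
  · rw [hlenM]
    simp only [treeCost, coverCost]
    have h1 : L.length + 1 ≤ (L.length + 1) * (Nat.clog 2 L.length + 1) :=
      Nat.le_mul_of_pos_right _ (by omega)
    generalize (L.length + 1) * (Nat.clog 2 L.length + 1) = w at h1 ⊢
    have h2 := Nat.mul_le_mul_left (boxCost + buildTotal 0 + buildTotal 1) h1
    have h3 : 2 ≤ 2 * w := by omega
    linarith
  · rw [← hset]
    exact isCompressedQuadtree_of_sorted hnd hu harm hn hM hsort hR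
  · rw [← hset]
    exact isCompressedQuadtree_of_sorted hnd hu' harm' hn (hN.trans hM) hsort' hB
  · rw [hreg4 0 (by norm_num) (by norm_num), hreg3 0 (by norm_num)]
    refine (henc.congr (fun a ha ha' => ?_) le_rfl).encodes
    rw [hmem4 a ⟨by omega, ha'⟩, hmem3]

end SteinerCover

-- Conclusion

open SteinerCover

theorem lemma1 :
    ∃ (prog : Program) (C : ℝ), ∀ (n : ℕ) (p : Fin n → Plane), 1 ≤ n → Function.Injective p →
      ∃ (s : State) (k : ℕ),
        Exec prog (inputState p) s k ∧
        (k : ℝ) ≤ C * (n * Real.log n + 1) ∧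
        ∃ (c : Plane) (h : ℝ), IsSmallestAxisSquare (Set.range p) c h ∧
          ∃ R B : GTree,
            IsCompressedQuadtree (Square.axis c h) (Set.range p) R ∧
            IsCompressedQuadtree (Square.axis c h).blue (Set.range p) B ∧
            Encodes s.mem (s.reg 0) [R] ∧
            Encodes s.mem (s.reg 1) [B] ∧
            R.NoSingleChild ∧ B.NoSingleChild ∧
            R.numVertices ≤ 2 * n - 1 ∧ B.numVertices ≤ 2 * n - 1 := by
  -- The factor 12 comes from `succ_mul_clog_le`.
  refine ⟨coverProgram, coverCost * 12, fun n p hn hp => ?_⟩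
  obtain ⟨s, ⟨k, hk, hexec⟩, c, h, hbox, M, N, R, B, hM, hN, hR, hB, heR, heB, hdR, hdB⟩ :=
    runs_coverProgram p hn hp
  refine ⟨s, k, hexec, ?_, c, h, hbox, R, B, hR, hB, heR, heB, Dendro.noSingleChild R hdR,
    Dendro.noSingleChild B hdB, ?_, ?_⟩
  · calc (k : ℝ) ≤ (coverCost * ((n + 1) * (Nat.clog 2 n + 1)) : ℕ) := by exact_mod_cast hk
      _ = coverCost * (((n + 1) * (Nat.clog 2 n + 1) : ℕ) : ℝ) := by push_cast; ring
      _ ≤ coverCost * (12 * (n * Real.log n + 1)) := by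
        gcongr
        exact succ_mul_clog_le n hn
      _ = coverCost * 12 * (n * Real.log n + 1) := by ring
  · have := Dendro.numVertices_lt R hdR
    omega
  · have := Dendro.numVertices_lt B hdB
    omega
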